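/- An instance $x$ of quantum 2-SAT on $n$ qubits is a family of orthogonal projectors $\Pi_{a,b}$ on $\mathbb C^2\otimes\mathbb C^2$, one for each pair of qubits $a<b$; write $r_{a,b}$ for the rank of $\Pi_{a,b}$. A satisfying assignment (SA) of $x$ is a nonzero vector $\Psi\in(\mathbb C^2)^{\otimes n}$ with $\Pi_{a,b}\Psi=0$ for all $a<b$, where $\Pi_{a,b}$ acts on the qubits $a,b$ and as the identity elsewhere; $x$ is satisfiable if it has an SA, and homogeneous if $r_{a,b}\le 1$ for all $a<b$. A tensor $\phi=(\phi_{\alpha\beta})$ is a constraint tensor of $x$ at $(a,b)$ if the vector with components $\overline{\phi_{\alpha\beta}}$ lies in the range of $\Pi_{a,b}$ (so that $\sum_{\alpha_a,\alpha_b}\phi_{\alpha_a\alpha_b}\Psi_{\dots\alpha_a\dots\alpha_b\dots}=0$ for every SA $\Psi$); at $(b,a)$ the constraint tensors are the transposes. Let $\epsilon=\begin{pmatrix}0&1\\-1&0\end{pmatrix}$. A rule step replaces a homogeneous instance by one in which, for some distinct $a,b,c$ and constraint tensors $\phi$ at $(a,b)$ and $\theta$ at $(b,c)$, the tensor $\phi\,\epsilon\,\theta$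 has been added to the span of the constraint tensors at $(a,c)$, all other pairs being unchanged. Running times are counted for programs (assignments, sequencing, branching, while loops) that use finitely many arrays of natural numbers and of complex numbers. Each exact field operation, complex conjugation, equality test on complex numbers, index operation $+,-,\times$, comparison and array access has cost one; no square roots are available and the only constants are natural numbers. On inputs with $n$ qubits, the natural numbers met in index arithmetic must be bounded by a fixed polynomial in $n$. The input consists of $n$ and the matrix entries of the $\Pi_{a,b}$; other memory cells may hold anything initially. **Theorem.** There are fixed programs $\mathcal R$ (a round) and $\mathcal B$ (for at most two qubits) such that the following hold. 1. For every instance $x$ on $n\ge 3$ qubits, $\mathcal R$ halts after $O(n^3)$ steps with one of the following outputs. * Output 1: the report that $x$ has no SA, and this is so. * Output 2: vectors $\psi_1,\dots,\psi_n\in\mathbb C^2$ such that $\psi_1\otimes\cdots\otimes\psi_n$ is an SA of $x$ (in particular, it is nonzero). * Output 3: an instance $y$ on $m<n$ qubits, stored in place of $x$, which is satisfiable if and only if $x$ is, and which arises from $x$ in one of these ways: * (elimination) for some $a<b$ with $r_{a,b}=3$ and some $\phi\neq0$ with $\Pi_{a,b}\phi=0$, the qubits of $y$ are the qubits of $x$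 other than $a,b$, and the SAs of $x$ are exactly the vectors $\phi_{ab}\otimes\Psi'$ with $\Psi'$ an SA of $y$; * (merging) for some $a<b$ with $r_{a,b}=2$, the qubits of $y$ are those of $x$ other than $a,b$ together with one logical qubit $c$, and there is an injective linear map $V:\mathbb C^2\to\mathbb C^2\otimes\mathbb C^2$ with range $\ker\Pi_{a,b}$ such that the SAs of $x$ are exactly the vectors $V_c\Psi'$ with $\Psi'$ an SA of $y$; if $n=3$, merging is also allowed for $r_{a,b}=3$, with the range of $V$ only required to contain $\ker\Pi_{a,b}$; * (closing under the rule) $x$ is homogeneous, finitely many rule steps lead from $x$ to an instance $x'$ whose projector at some pair has rank two, and $y$ arises from $x'$ by merging that pair. 2. Consider the iterated algorithm: apply $\mathcal R$ as long as the current instance has at least three qubits and the last round (if any) gave Output 3; if this leaves an instance on at most two qubits, apply $\mathcal B$ to it. For every instance $x$ on $n\ge 0$ qubits it halts after $O((n+1)^4)$ steps and decides correctly whether $x$ is satisfiable. -/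

import Mathlib

namespace Q2SAT

/-! ## Quantum 2-SAT -/

/-- Vectors of the space of `n` qubits, in the computational basis. A state is a nonzero vector
(up to normalisation and phase). -/
abbrev QVec (n : ℕ) := (Fin n → Fin 2) → ℂ

/-- Operators on two qubits, in the basis `|i, j⟩`. -/
abbrev TwoQubitOp := Matrix (Fin 2 × Fin 2) (Fin 2 × Fin 2) ℂ

/-- `P` acting on the qubits `a`, `b` (in this order), tensored with the identity elsewhere. -/
def applyPair {n : ℕ} (P : TwoQubitOp) (a b : Fin n) (Ψ : QVec n) : QVec n :=
  fun σ => ∑ τ : Fin 2 × Fin 2,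
    P (σ a, σ b) τ * Ψ (Function.update (Function.update σ a τ.1) b τ.2)

/-- An instance of quantum 2-SAT on `n` qubits: a two-qubit orthogonal projector `proj a b` for
every pair `a < b`. The values of `proj` at the other pairs are not part of the data and are never
used. -/
structure Instance (n : ℕ) where
  proj : Fin n → Fin n → TwoQubitOp
  isProj : ∀ a b, a < b → IsStarProjection (proj a b)

/-- The product vector `ψ 0 ⊗ ⋯ ⊗ ψ (n-1)`. -/
def productVec {n : ℕ} (ψ : Fin n → Fin 2 → ℂ) : QVec n := fun σ => ∏ j, ψ j (σ j)

namespace Instance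

variable {n m : ℕ}

/-- `Ψ` is a satisfying assignment: a state with `Π_{a,b} Ψ = 0` for all `a < b`. -/
def IsSA (x : Instance n) (Ψ : QVec n) : Prop :=
  Ψ ≠ 0 ∧ ∀ a b, a < b → applyPair (x.proj a b) a b Ψ = 0

def Satisfiable (x : Instance n) : Prop := ∃ Ψ, x.IsSA Ψ

/-- All projectors have rank at most one. -/
def Homogeneous (x : Instance n) : Prop := ∀ a b, a < b → (x.proj a b).rank ≤ 1

/-- The projector of an unordered pair, with its first tensor factor at `a` and its second one
at `b`. -/
def cons (x : Instance n) (a b : Fin n) : TwoQubitOp :=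
  if a < b then x.proj a b else (x.proj b a).submatrix Prod.swap Prod.swap

/-- The rank-two tensors `φ` whose contraction `∑ φ_{α_a α_b} ψ_{… α_a … α_b …} = 0` is imposed by
the projector of the pair `a`, `b`: the vector with components `conj φ_{α β}` lies in the
forbidden subspace (the range of the projector). -/
def tensors (x : Instance n) (a b : Fin n) : Submodule ℂ (Matrix (Fin 2) (Fin 2) ℂ) where
  carrier := {φ | ((x.cons a b).map star).mulVec (fun τ => φ τ.1 τ.2) = fun τ => φ τ.1 τ.2}
  add_mem' := by
    intro φ θ hφ hθ
    exact (Matrix.mulVec_add _ (fun τ : Fin 2 × Fin 2 => φ τ.1 τ.2) fun τ => θ τ.1 τ.2).trans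
      (congrArg₂ (· + ·) hφ hθ)
  zero_mem' := Matrix.mulVec_zero ((x.cons a b).map star)
  smul_mem' := by
    intro k φ hφ
    exact (Matrix.mulVec_smul _ k fun τ : Fin 2 × Fin 2 => φ τ.1 τ.2).trans
      (congrArg (k • ·) hφ)

end Instance

/-- The antisymmetric tensor. -/
def eps : Matrix (Fin 2) (Fin 2) ℂ := !![0, 1; -1, 0]

/-- One application of the rule for generating constraints to a homogeneous instance `x`: from
constraint tensors `φ` at `(a, b)` and `θ` at `(b, c)`, the constraint `φ ε θ` at `(a, c)` is added,
and nothing else changes. -/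
def RuleStep {n : ℕ} (x x' : Instance n) : Prop :=
  x.Homogeneous ∧ ∃ a b c : Fin n, a ≠ b ∧ b ≠ c ∧ a ≠ c ∧
    ∃ φ ∈ x.tensors a b, ∃ θ ∈ x.tensors b c,
      x'.tensors a c = x.tensors a c ⊔ Submodule.span ℂ {φ * eps * θ} ∧
      ∀ p q, p ≠ q → s(p, q) ≠ s(a, c) → x'.tensors p q = x.tensors p q

/-- `y` arises from `x` by splitting off the qubits `a`, `b` in the state `φ`. Qubit `i` of `y` is
qubit `e i` of `x`, and `Ψ` is a satisfying assignment of `x` iff `Ψ = φ_{ab} ⊗ Ψ'` for a satisfying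
assignment `Ψ'` of `y`. -/
def EliminatesTo {n m : ℕ} (x : Instance n) (y : Instance m) (a b : Fin n) : Prop :=
  ∃ (φ : Fin 2 × Fin 2 → ℂ) (e : Fin m → Fin n),
    φ ≠ 0 ∧ (x.proj a b).mulVec φ = 0 ∧
    Function.Injective e ∧ Set.range e = {a, b}ᶜ ∧
    ∀ Ψ, x.IsSA Ψ ↔ ∃ Ψ', y.IsSA Ψ' ∧ Ψ = fun σ => φ (σ a, σ b) * Ψ' (σ ∘ e)

/-- `y` arises from `x` by merging the qubits `a`, `b` into one logical qubit `c`, by an injective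
linear map `V : ℂ² → ℂ² ⊗ ℂ²` whose range contains the zero space of `Π_{a,b}` (and is equal to it if
`Π_{a,b}` has rank two). A qubit `i ≠ c` of `y` is qubit `e i` of `x`, and `Ψ` is a satisfying
assignment of `x` iff `Ψ = V_c Ψ'` for a satisfying assignment `Ψ'` of `y`. -/
def MergesTo {n m : ℕ} (x : Instance n) (y : Instance m) (a b : Fin n) : Prop :=
  ∃ (V : Matrix (Fin 2 × Fin 2) (Fin 2) ℂ) (c : Fin m) (e : Fin m → Fin n),
    Function.Injective V.mulVec ∧
    (∀ v, (x.proj a b).mulVec v = 0 → ∃ u, V.mulVec u = v) ∧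
    Function.Injective e ∧ Set.range e = {b}ᶜ ∧ e c = a ∧
    ∀ Ψ, x.IsSA Ψ ↔ ∃ Ψ', y.IsSA Ψ' ∧
      Ψ = fun σ => ∑ s : Fin 2, V (σ a, σ b) s * Ψ' (Function.update (σ ∘ e) c s)

/-- The reductions of one round. -/
inductive ReducesTo {n m : ℕ} (x : Instance n) (y : Instance m) : Prop
  /-- A rank-three projector is eliminated, and its two qubits with it. -/
  | eliminate (a b : Fin n) (hab : a < b) (hr : (x.proj a b).rank = 3)
      (h : EliminatesTo x y a b)
  /-- Two qubits joined by a rank-two projector are merged. On three qubits, where eliminating a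
  rank-three projector would leave a single qubit and no pair to carry a constraint on it, its
  qubits may be merged instead. -/
  | merge (a b : Fin n) (hab : a < b)
      (hr : (x.proj a b).rank = 2 ∨ n = 3 ∧ (x.proj a b).rank = 3)
      (h : MergesTo x y a b)
  /-- A homogeneous instance is extended by the rule, until two independent constraints are met at
  some pair, whose qubits are merged. -/
  | close (x' : Instance n) (hx : x.Homogeneous)
      (hs : Relation.ReflTransGen RuleStep x x') (a b : Fin n) (hab : a < b)
      (hr : (x'.proj a b).rank = 2) (h : MergesTo x' y a b)

/-! ## The machine model

A structured program over finitely many named arrays, some holding natural numbers (used as indices,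
counters and pointers), the others holding complex numbers. On complex numbers the program can do
exact field operations, complex conjugation and equality tests, starting from the input and from
natural-number constants; each operation, array access and test costs one step. The numbers in index
arithmetic have to stay below a word bound `W`. -/

/-- The contents of the arrays: `ints k i` and `nums k i` are the cells `i` of the arrays number `k`. -/
structure Memory where
  ints : ℕ → ℕ → ℕ
  nums : ℕ → ℕ → ℂ

/-- Index expressions. -/
inductive IExp where
  | lit (k : ℕ)
  | get (arr : ℕ) (i : IExp)
  | add (e f : IExp)
  | sub (e f : IExp)
  | mul (e f : IExp)

namespace IExp

def eval (s : Memory) : IExp → ℕ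
  | lit k => k
  | get arr i => s.ints arr (i.eval s)
  | add e f => e.eval s + f.eval s
  | sub e f => e.eval s - f.eval s
  | mul e f => e.eval s * f.eval s

/-- Number of operations and accesses. -/
def cost : IExp → ℕ
  | lit _ => 1
  | get _ i => i.cost + 1
  | add e f => e.cost + f.cost + 1
  | sub e f => e.cost + f.cost + 1
  | mul e f => e.cost + f.cost + 1

/-- All values met in the evaluation are at most `W`. -/
def fits (W : ℕ) (s : Memory) : IExp → Prop
  | lit k => k ≤ W
  | get arr i => i.fits W s ∧ s.ints arr (i.eval s) ≤ W
  | add e f => e.fits W s ∧ f.fits W s ∧ e.eval s + f.eval s ≤ W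
  | sub e f => e.fits W s ∧ f.fits W s
  | mul e f => e.fits W s ∧ f.fits W s ∧ e.eval s * f.eval s ≤ W

end IExp

/-- Expressions for complex numbers. -/
inductive NExp where
  | lit (k : ℕ)
  | get (arr : ℕ) (i : IExp)
  | add (e f : NExp)
  | sub (e f : NExp)
  | mul (e f : NExp)
  | div (e f : NExp)
  | conj (e : NExp)

namespace NExp

noncomputable def eval (s : Memory) : NExp → ℂ
  | lit k => (k : ℂ)
  | get arr i => s.nums arr (i.eval s)
  | add e f => e.eval s + f.eval s
  | sub e f => e.eval s - f.eval s
  | mul e f => e.eval s * f.eval s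
  | div e f => e.eval s / f.eval s
  | conj e => star (e.eval s)

def cost : NExp → ℕ
  | lit _ => 1
  | get _ i => i.cost + 1
  | add e f => e.cost + f.cost + 1
  | sub e f => e.cost + f.cost + 1
  | mul e f => e.cost + f.cost + 1
  | div e f => e.cost + f.cost + 1
  | conj e => e.cost + 1

/-- All index values met in the evaluation are at most `W`, and there is no division by zero. -/
def fits (W : ℕ) (s : Memory) : NExp → Prop
  | lit _ => True
  | get _ i => i.fits W s
  | add e f => e.fits W s ∧ f.fits W s
  | sub e f => e.fits W s ∧ f.fits W s
  | mul e f => e.fits W s ∧ f.fits W s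
  | div e f => e.fits W s ∧ f.fits W s ∧ f.eval s ≠ 0
  | conj e => e.fits W s

end NExp

/-- Tests. -/
inductive Test where
  | le (e f : IExp)
  | eq (e f : NExp)
  | not (t : Test)
  | and (t u : Test)

namespace Test

def holds (s : Memory) : Test → Prop
  | le e f => e.eval s ≤ f.eval s
  | eq e f => e.eval s = f.eval s
  | not t => ¬ t.holds s
  | and t u => t.holds s ∧ u.holds s

def cost : Test → ℕ
  | le e f => e.cost + f.cost + 1
  | eq e f => e.cost + f.cost + 1
  | not t => t.cost + 1
  | and t u => t.cost + u.cost + 1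

def fits (W : ℕ) (s : Memory) : Test → Prop
  | le e f => e.fits W s ∧ f.fits W s
  | eq e f => e.fits W s ∧ f.fits W s
  | not t => t.fits W s
  | and t u => t.fits W s ∧ u.fits W s

end Test

/-- Programs: assignments to array cells, sequencing, branching, loops. -/
inductive Program where
  | skip
  | setInt (arr : ℕ) (i : IExp) (e : IExp)
  | setNum (arr : ℕ) (i : IExp) (e : NExp)
  | seq (p q : Program)
  | ite (t : Test) (p q : Program)
  | loop (t : Test) (p : Program)

def Memory.setInt (s : Memory) (arr i v : ℕ) : Memory :=
  { s with ints := Function.update s.ints arr (Function.update (s.ints arr) i v) }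

noncomputable def Memory.setNum (s : Memory) (arr i : ℕ) (v : ℂ) : Memory :=
  { s with nums := Function.update s.nums arr (Function.update (s.nums arr) i v) }

/-- `Runs W p s t s'`: started in `s`, with word bound `W`, the program `p` halts in `s'` after
exactly `t` steps. -/
inductive Runs (W : ℕ) : Program → Memory → ℕ → Memory → Prop
  | skip (s) : Runs W .skip s 1 s
  | setInt (s arr i e) (hi : i.fits W s) (he : e.fits W s) :
      Runs W (.setInt arr i e) s (i.cost + e.cost + 1) (s.setInt arr (i.eval s) (e.eval s))
  | setNum (s arr i e) (hi : i.fits W s) (he : e.fits W s) :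
      Runs W (.setNum arr i e) s (i.cost + e.cost + 1) (s.setNum arr (i.eval s) (e.eval s))
  | seq {p q s s' s'' t t'} (hp : Runs W p s t s') (hq : Runs W q s' t' s'') :
      Runs W (.seq p q) s (t + t') s''
  | iteTrue {c p q s s' t} (hf : c.fits W s) (hc : c.holds s) (hp : Runs W p s t s') :
      Runs W (.ite c p q) s (c.cost + t) s'
  | iteFalse {c p q s s' t} (hf : c.fits W s) (hc : ¬ c.holds s) (hq : Runs W q s t s') :
      Runs W (.ite c p q) s (c.cost + t) s'
  | loopTrue {c p s s' s'' t t'} (hf : c.fits W s) (hc : c.holds s) (hp : Runs W p s t s')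
      (hl : Runs W (.loop c p) s' t' s'') : Runs W (.loop c p) s (c.cost + t + t') s''
  | loopFalse {c p s} (hf : c.fits W s) (hc : ¬ c.holds s) : Runs W (.loop c p) s c.cost s

/-! ## Input, output, iteration -/

/-- The memory holds the instance `x`: the number of qubits in the first cell of integer array `0`, and
the entries `⟨i, j| Π_{a,b} |k, l⟩`, `a < b`, in array `0` of complex numbers. All other cells are
arbitrary. -/
def Holds {n : ℕ} (s : Memory) (x : Instance n) : Prop :=
  s.ints 0 0 = n ∧ ∀ a b : Fin n, a < b → ∀ i j k l : Fin 2,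
    s.nums 0 (16 * (n * (a : ℕ) + (b : ℕ)) + (8 * (i : ℕ) + 4 * (j : ℕ) + 2 * (k : ℕ) + (l : ℕ)))
      = x.proj a b (i, j) (k, l)

/-- The kind of output (1, 2 or 3), in the first cell of integer array `1`. -/
def Memory.status (s : Memory) : ℕ := s.ints 1 0

/-- The one-qubit vectors in array `1` of complex numbers. -/
def Memory.vectors (s : Memory) (n : ℕ) : Fin n → Fin 2 → ℂ :=
  fun j i => s.nums 1 (2 * (j : ℕ) + (i : ℕ))

/-- Final memories of a correct round on the instance `x`. -/
inductive RoundOutput {n : ℕ} (x : Instance n) (s : Memory) : Prop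
  /-- Output 1: there is no satisfying assignment. -/
  | unsat (hs : s.status = 1) (h : ¬ x.Satisfiable)
  /-- Output 2: one-qubit states whose product is a satisfying assignment. -/
  | product (hs : s.status = 2) (h : x.IsSA (productVec (s.vectors n)))
  /-- Output 3: an equivalent instance on fewer qubits, in the place of the old one. -/
  | reduced (hs : s.status = 3) (m : ℕ) (y : Instance m) (hm : m < n) (hy : Holds s y)
      (hequiv : x.Satisfiable ↔ y.Satisfiable) (hred : ReducesTo x y)

/-- The test `status = 3`. -/
def statusIsThree : Test :=
  .and (.le (.lit 3) (.get 1 (.lit 0))) (.le (.get 1 (.lit 0)) (.lit 3))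

/-- The iterated algorithm: rounds are performed as long as there are at least three qubits and the
last round gave Output 3; if an instance on at most two qubits is left, it is passed to the program
`base`. -/
def iterated (round base : Program) : Program :=
  .seq (.setInt 1 (.lit 0) (.lit 3))
    (.seq (.loop (.and statusIsThree (.le (.lit 3) (.get 0 (.lit 0)))) round)
      (.ite statusIsThree base .skip))

end Q2SAT

/-!
# One round of quantum 2-SAT in cubic time

A vector is a satisfying assignment iff all its two-qubit slices (`slice`) are annihilated by the
projectors, so everything about constraints is linear algebra on `ℂ² ⊗ ℂ²`. A projector is only
ever changed by adding a tensor `w` to its row space, which is a Gram-Schmidt step (`addTensor`):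
the residual `r = w - w P` contributes `r† r / (r r†)`, which needs no square roots. Ranks are
read off as traces (`rank_eq_trace`).

*Pairs of rank at least two.* If `Π_{a,b}` has rank four, its kernel is zero and nothing is
satisfying. If it has rank two, or three, a satisfying assignment takes values in its kernel on
the two qubits, and is therefore `V_c Ψ'` or `φ_{ab} ⊗ Ψ'` for a unique `Ψ'`. The constraints on
`Ψ'` are those of the original instance contracted with `V` or `φ`: `Instance.mergesTo_of`,
`Instance.eliminatesTo_of`. Contractions produce constraints on one qubit too, and these are
stored as constraints on pairs containing this qubit; for this to be possible at least two qubits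
must remain, which is why three qubits with a pair of rank three are merged rather than reduced to
a single qubit.

*Homogeneous instances.* For each qubit `k` in turn, all compositions `φ ε θ` through `k` are
added (`Instance.Stage`). If a rank-two pair arises, the process stops there and the pair is
merged. Otherwise one pass over `k` is enough: since composition is associative, and going from a
qubit to another one and back along the same (unique) tensor `φ` gives `φ ε φᵀ = det φ • ε`, the
stage `k` does not destroy the closure under compositions through the earlier qubits
(`Instance.Stage.closedBelow_succ`). In an instance that is closed under the rule a product
solution is found greedily: qubit `p` is given the state `(ψ q φ) ε` forced by some earlier qubit
`q` with a nonzero contraction `ψ q φ`, or any state if there is none. The tensors between `p` and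
the other earlier qubits are then satisfied because the composition through `p` is a constraint on
two earlier qubits (`Instance.isSA_productVec`).

*Programs.* The machine is handled by the relation `Does`, a total-correctness triple that carries
the syntactic time bound `Program.bound`, in which every loop is assumed to make at most `N`
turns. A program whose loops are nested at most three deep runs for `O(N ^ 3)` steps
(`Program.exists_bound_le`). The round has depth three, `does_roundProg` is its correctness, and
`exists_runs_iterated` that of the iteration, which terminates since each reduction removes a
qubit.
-/

namespace Q2SAT

open Matrix
open scoped ComplexOrder

/-! ### Orthogonal projectors and their row spaces -/

section LinearAlgebra

variable {ι : Type*} [Fintype ι]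

/-- The orthogonal projector whose row space is that of the orthogonal projector `P` with the
covector `w` added: the residual of `w` is normalised and its projector is added to `P`. If the
residual is zero, then so is its (junk) inverse square norm, and the result is `P`. -/
noncomputable def addTensor (P : Matrix ι ι ℂ) (w : ι → ℂ) : Matrix ι ι ℂ :=
  P + ((w - w ᵥ* P) ⬝ᵥ star (w - w ᵥ* P))⁻¹ • vecMulVec (star (w - w ᵥ* P)) (w - w ᵥ* P)

variable {P : Matrix ι ι ℂ}

theorem residual_vecMul (hP : IsStarProjection P) (w : ι → ℂ) : (w - w ᵥ* P) ᵥ* P = 0 := by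
  rw [sub_vecMul, vecMul_vecMul, hP.isIdempotentElem.eq, sub_self]

theorem mulVec_star_residual (hP : IsStarProjection P) (w : ι → ℂ) :
    P *ᵥ star (w - w ᵥ* P) = 0 := by
  have h := congrArg star (residual_vecMul hP w)
  rwa [star_vecMul, ← star_eq_conjTranspose, hP.isSelfAdjoint.star_eq, star_zero] at h

theorem addTensor_of_residual_eq_zero {w : ι → ℂ} (h : w - w ᵥ* P = 0) : addTensor P w = P := by
  simp [addTensor, h]

theorem isStarProjection_addTensor (hP : IsStarProjection P) (w : ι → ℂ) :
    IsStarProjection (addTensor P w) := by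
  have h1 := residual_vecMul hP w
  have h2 := mulVec_star_residual hP w
  unfold addTensor
  set r := w - w ᵥ* P
  by_cases hr : r = 0
  · simpa [hr] using hP
  have hn : r ⬝ᵥ star r ≠ 0 := fun h => hr (dotProduct_self_star_eq_zero.1 h)
  constructor
  · unfold IsIdempotentElem
    rw [add_mul, mul_add, mul_add, hP.isIdempotentElem.eq, mul_smul_comm, smul_mul_assoc,
      smul_mul_assoc, mul_smul_comm, mul_vecMulVec, vecMulVec_mul, h1, h2,
      vecMulVec_mul_vecMulVec]
    ext i j
    simp only [zero_vecMulVec, vecMulVec_zero, vecMulVec_smul, smul_zero, add_zero, zero_add,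
      Matrix.add_apply, Matrix.smul_apply, smul_eq_mul]
    field_simp
  · have : star (r ⬝ᵥ star r) = r ⬝ᵥ star r := by
      rw [← star_dotProduct_star, star_star, dotProduct_comm]
    unfold IsSelfAdjoint
    rw [star_add, star_smul, star_inv₀, this, hP.isSelfAdjoint.star_eq, star_eq_conjTranspose,
      conjTranspose_vecMulVec, star_star]

/-- The row space of an orthogonal projector consists of the covectors that vanish on its kernel. -/
theorem vecMul_eq_self_iff (hP : IsStarProjection P) (w : ι → ℂ) :
    w ᵥ* P = w ↔ ∀ v, P *ᵥ v = 0 → w ⬝ᵥ v = 0 := by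
  constructor
  · intro h v hv
    rw [← h, ← dotProduct_mulVec, hv, dotProduct_zero]
  · intro h
    have := h _ (mulVec_star_residual hP w)
    have h3 : (w - w ᵥ* P) ⬝ᵥ star (w - w ᵥ* P) = 0 := by
      rw [sub_dotProduct, this, ← dotProduct_mulVec, mulVec_star_residual hP w, dotProduct_zero,
        sub_zero]
    exact (sub_eq_zero.1 (dotProduct_self_star_eq_zero.1 h3)).symm

theorem row_vecMul (hP : IsStarProjection P) (τ : ι) : P τ ᵥ* P = P τ := by
  have := congrFun hP.isIdempotentElem.eq τ
  rwa [mul_apply_eq_vecMul] at this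

theorem mulVec_eq_zero_iff_row (P : Matrix ι ι ℂ) (v : ι → ℂ) :
    P *ᵥ v = 0 ↔ ∀ τ, P τ ⬝ᵥ v = 0 := funext_iff

theorem vecMul_addTensor_eq_self_iff (hP : IsStarProjection P) (w u : ι → ℂ) :
    u ᵥ* addTensor P w = u ↔ ∃ c : ℂ, (u - c • w) ᵥ* P = u - c • w := by
  have h1 := residual_vecMul hP w
  have h2 := mulVec_star_residual hP w
  unfold addTensor
  set r := w - w ᵥ* P with hr'
  have hw : w ᵥ* P = w - r := by simp [r]
  rw [vecMul_add, vecMul_smul, vecMul_vecMulVec, smul_smul]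
  constructor
  · intro h
    refine ⟨(r ⬝ᵥ star r)⁻¹ * (u ⬝ᵥ star r), ?_⟩
    set c := (r ⬝ᵥ star r)⁻¹ * (u ⬝ᵥ star r)
    rw [sub_vecMul, smul_vecMul, hw]
    nth_rewrite 2 [← h]
    rw [smul_sub]; abel
  · rintro ⟨c, hc⟩
    have hu : u ⬝ᵥ star r = c * (r ⬝ᵥ star r) := by
      have h3 : (u - c • w) ⬝ᵥ star r = 0 := by
        rw [← hc, ← dotProduct_mulVec, h2, dotProduct_zero]
      have h4 : w ⬝ᵥ star r = r ⬝ᵥ star r := by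
        have : (w ᵥ* P) ⬝ᵥ star r = 0 := by rw [← dotProduct_mulVec, h2, dotProduct_zero]
        rw [hw, sub_dotProduct, sub_eq_zero] at this
        exact this
      rw [sub_dotProduct, smul_dotProduct, h4, sub_eq_zero] at h3
      exact h3
    rw [sub_vecMul, smul_vecMul, hw] at hc
    have hc' : u ᵥ* P = u - c • r := by
      rw [sub_eq_iff_eq_add] at hc
      rw [hc, smul_sub]; abel
    rw [hc', hu]
    by_cases hr : r = 0
    · simp [hr]
    have hn : r ⬝ᵥ star r ≠ 0 := fun h => hr (dotProduct_self_star_eq_zero.1 h)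
    have : (r ⬝ᵥ star r)⁻¹ * (c * (r ⬝ᵥ star r)) = c := by field_simp
    rw [this, sub_add_cancel]

theorem addTensor_mulVec_eq_zero_iff (hP : IsStarProjection P) (w v : ι → ℂ) :
    addTensor P w *ᵥ v = 0 ↔ P *ᵥ v = 0 ∧ w ⬝ᵥ v = 0 := by
  have hQ := isStarProjection_addTensor hP w
  constructor
  · intro h
    have key : ∀ u, (∃ c : ℂ, (u - c • w) ᵥ* P = u - c • w) → u ⬝ᵥ v = 0 := fun u hu =>
      (vecMul_eq_self_iff hQ u).1 ((vecMul_addTensor_eq_self_iff hP w u).2 hu) v h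
    refine ⟨(mulVec_eq_zero_iff_row P v).2 fun τ => key _ ⟨0, ?_⟩, key w ⟨1, ?_⟩⟩
    · simpa using row_vecMul hP τ
    · simp
  · rintro ⟨h1, h2⟩
    refine (mulVec_eq_zero_iff_row _ v).2 fun τ => ?_
    obtain ⟨c, hc⟩ := (vecMul_addTensor_eq_self_iff hP w _).1 (row_vecMul hQ τ)
    have := (vecMul_eq_self_iff hP _).1 hc v h1
    rwa [sub_dotProduct, smul_dotProduct, h2, smul_zero, sub_zero] at this

/-- The vectors annihilated by a projector and by a list of tensors are the kernel of the projector
obtained by adding the tensors one after the other. -/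
theorem foldl_addTensor {α : Type*} (w : α → ι → ℂ) (L : List α) (hP : IsStarProjection P) :
    IsStarProjection (L.foldl (fun P x => addTensor P (w x)) P) ∧
      ∀ v, L.foldl (fun P x => addTensor P (w x)) P *ᵥ v = 0 ↔
        P *ᵥ v = 0 ∧ ∀ x ∈ L, w x ⬝ᵥ v = 0 := by
  induction L generalizing P with
  | nil => simp [hP]
  | cons x L ih =>
    obtain ⟨h1, h2⟩ := ih (isStarProjection_addTensor hP (w x))
    refine ⟨h1, fun v => ?_⟩
    rw [List.foldl_cons, h2, addTensor_mulVec_eq_zero_iff hP, List.forall_mem_cons, and_assoc]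

theorem rank_eq_trace [DecidableEq ι] (hP : IsStarProjection P) : (P.rank : ℂ) = P.trace := by
  have h : IsIdempotentElem (toLin' P) := by
    unfold IsIdempotentElem
    rw [Module.End.mul_eq_comp, ← toLin'_mul, hP.isIdempotentElem.eq]
  have h1 := (LinearMap.IsIdempotentElem.isProj_range _ h).trace
  rw [← trace_toLin'_eq, h1]
  rfl

theorem rank_addTensor_le (P : Matrix ι ι ℂ) (w : ι → ℂ) : (addTensor P w).rank ≤ P.rank + 1 := by
  have h1 := rank_vecMulVec_le (R := ℂ)
    (((w - w ᵥ* P) ⬝ᵥ star (w - w ᵥ* P))⁻¹ • star (w - w ᵥ* P)) (w - w ᵥ* P)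
  rw [smul_vecMulVec] at h1
  refine le_trans ?_ (Nat.add_le_add_left h1 _)
  unfold addTensor Matrix.rank
  rw [mulVecLin_add]
  refine (Submodule.finrank_mono (LinearMap.range_add_le _ _)).trans
    (Submodule.finrank_add_le_finrank_add_finrank _ _)

theorem finrank_ker_add_rank (P : Matrix ι ι ℂ) :
    Module.finrank ℂ (LinearMap.ker P.mulVecLin) + P.rank = Fintype.card ι := by
  rw [add_comm, Matrix.rank, LinearMap.finrank_range_add_finrank_ker,
    Module.finrank_fintype_fun_eq_card]

theorem mulVec_col_one_sub [DecidableEq ι] (hP : IsStarProjection P) (ρ : ι) :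
    P *ᵥ (fun τ => (1 - P) τ ρ) = 0 := by
  have : P * (1 - P) = 0 := by rw [mul_sub, mul_one, hP.isIdempotentElem.eq, sub_self]
  ext τ
  exact congrFun (congrFun this τ) ρ

/-- In an orthogonal projector of rank at most one, all rows are multiples of any nonzero one. -/
theorem exists_smul_of_rank_le_one (h : P.rank ≤ 1) {T w : ι → ℂ} (hT : T ≠ 0)
    (hTP : T ᵥ* P = T) (hw : w ᵥ* P = w) : ∃ c : ℂ, w = c • T := by
  have h1 : Module.finrank ℂ (LinearMap.range (Pᵀ).mulVecLin) ≤ 1 := by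
    have := rank_transpose P
    rw [Matrix.rank] at this
    rw [this]; exact h
  have hm : ∀ u, u ᵥ* P = u → u ∈ LinearMap.range (Pᵀ).mulVecLin := fun u hu =>
    ⟨u, by rw [mulVecLin_apply, mulVec_transpose, hu]⟩
  obtain ⟨v, hv⟩ := finrank_le_one_iff.1 h1
  obtain ⟨c, hc⟩ := hv ⟨T, hm T hTP⟩
  obtain ⟨d, hd⟩ := hv ⟨w, hm w hw⟩
  have hc' : c • (v : ι → ℂ) = T := congrArg Subtype.val hc
  have hd' : d • (v : ι → ℂ) = w := congrArg Subtype.val hd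
  have hc0 : c ≠ 0 := by rintro rfl; exact hT (by rw [← hc', zero_smul])
  exact ⟨d / c, by rw [← hc', ← hd', smul_smul, div_mul_cancel₀ _ hc0]⟩

theorem exists_mulVec_eq_zero_iff_rank_lt :
    (∃ v, v ≠ 0 ∧ P *ᵥ v = 0) ↔ P.rank < Fintype.card ι := by
  have h := finrank_ker_add_rank P
  constructor
  · rintro ⟨v, hv, hPv⟩
    have : 0 < Module.finrank ℂ (LinearMap.ker P.mulVecLin) := by
      rw [Module.finrank_pos_iff_exists_ne_zero]
      exact ⟨⟨v, hPv⟩, fun h => hv (congrArg Subtype.val h)⟩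
    omega
  · intro hr
    have : 0 < Module.finrank ℂ (LinearMap.ker P.mulVecLin) := by omega
    rw [Module.finrank_pos_iff_exists_ne_zero] at this
    obtain ⟨⟨v, hv⟩, h0⟩ := this
    exact ⟨v, fun h => h0 (Subtype.ext h), hv⟩

/-- A nonzero kernel is met by a nonzero column of the complementary projector. -/
theorem eq_zero_of_mulVec_eq_zero_of_cols [DecidableEq ι]
    (h : ∀ ρ, (fun τ => (1 - P) τ ρ) = 0) : ∀ v, P *ᵥ v = 0 → v = 0 := by
  have h1 : 1 - P = 0 := by ext τ ρ; exact congrFun (h ρ) τ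
  intro v hv
  rw [← sub_eq_zero.1 h1, one_mulVec] at hv
  exact hv

/-- If the kernel of `P` is at most two-dimensional, then the matrix with columns `v₀`, `v₁` is an
embedding of `ℂ²` whose range contains the kernel, provided that `v₀` is a zero vector and `v₁` is
orthogonal to `v₀` and, unless the kernel is spanned by `v₀`, a zero vector. -/
theorem exists_mulVec_eq_of_finrank_le {v₀ v₁ : ι → ℂ} (h0 : v₀ ≠ 0) (h1 : v₁ ≠ 0)
    (h01 : star v₀ ⬝ᵥ v₁ = 0) (hv0 : P *ᵥ v₀ = 0) (hr : Fintype.card ι ≤ P.rank + 2)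
    (hv1 : P *ᵥ v₁ = 0 ∨ ∀ v, P *ᵥ v = 0 → star v₀ ⬝ᵥ v = 0 → v = 0) :
    Function.Injective (Matrix.of fun τ (s : Fin 2) => if s = 0 then v₀ τ else v₁ τ).mulVec ∧
      ∀ v, P *ᵥ v = 0 →
        ∃ u, (Matrix.of fun τ (s : Fin 2) => if s = 0 then v₀ τ else v₁ τ).mulVec u = v := by
  have hV : ∀ u : Fin 2 → ℂ,
      (Matrix.of fun τ (s : Fin 2) => if s = 0 then v₀ τ else v₁ τ).mulVec u
        = u 0 • v₀ + u 1 • v₁ := by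
    intro u; ext τ
    simp [mulVec, dotProduct, Fin.sum_univ_two]; ring
  have hn0 : star v₀ ⬝ᵥ v₀ ≠ 0 := fun h => h0 (dotProduct_star_self_eq_zero.1 h)
  have hind : ∀ c d : ℂ, c • v₀ + d • v₁ = 0 → c = 0 ∧ d = 0 := by
    intro c d h
    have hc : c = 0 := by
      have := congrArg (star v₀ ⬝ᵥ ·) h
      simpa [dotProduct_add, h01, hn0] using this
    refine ⟨hc, ?_⟩
    rw [hc, zero_smul, zero_add] at h
    exact (smul_eq_zero.1 h).resolve_right h1
  constructor
  · intro u u' h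
    simp only [hV] at h
    obtain ⟨e0, e1⟩ := hind (u 0 - u' 0) (u 1 - u' 1) (by
      rw [sub_smul, sub_smul, sub_add_sub_comm, h, sub_self])
    ext s; fin_cases s
    · exact sub_eq_zero.1 e0
    · exact sub_eq_zero.1 e1
  · intro v hv
    rcases hv1 with hv1 | hv1
    -- the kernel is spanned by `v₀` and `v₁`, or by `v₀` alone
    · have hli : LinearIndependent ℂ
          ![(⟨v₀, hv0⟩ : LinearMap.ker P.mulVecLin), ⟨v₁, hv1⟩] := by
        rw [LinearIndependent.pair_iff]
        intro c d h
        exact hind c d (congrArg Subtype.val h)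
      have hk := finrank_ker_add_rank P
      have hc := hli.fintype_card_le_finrank
      rw [Fintype.card_fin] at hc
      have hs := hli.span_eq_top_of_card_eq_finrank (by rw [Fintype.card_fin]; omega)
      have hm : (⟨v, hv⟩ : LinearMap.ker P.mulVecLin) ∈ Submodule.span ℂ
          (Set.range ![(⟨v₀, hv0⟩ : LinearMap.ker P.mulVecLin), ⟨v₁, hv1⟩]) := by
        rw [hs]; trivial
      rw [Matrix.range_cons, Matrix.range_cons, Matrix.range_empty, Set.union_empty,
        Set.singleton_union, Submodule.mem_span_pair] at hm
      obtain ⟨c, d, h⟩ := hm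
      exact ⟨![c, d], by rw [hV]; exact congrArg Subtype.val h⟩
    · refine ⟨![(star v₀ ⬝ᵥ v) / (star v₀ ⬝ᵥ v₀), 0], ?_⟩
      rw [hV]
      have := hv1 (v - ((star v₀ ⬝ᵥ v) / (star v₀ ⬝ᵥ v₀)) • v₀)
        (by rw [mulVec_sub, mulVec_smul, hv, hv0, smul_zero, sub_zero])
        (by rw [dotProduct_sub, dotProduct_smul, smul_eq_mul, div_mul_cancel₀ _ hn0, sub_self])
      simpa using (sub_eq_zero.1 this).symm

end LinearAlgebra

/-! ### Slices -/

section Slices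

variable {n : ℕ}

/-- The two-qubit vector obtained from `Ψ` by fixing the qubits other than `a`, `b` as in `σ`. -/
def slice (Ψ : QVec n) (a b : Fin n) (σ : Fin n → Fin 2) : Fin 2 × Fin 2 → ℂ :=
  fun τ => Ψ (Function.update (Function.update σ a τ.1) b τ.2)

theorem slice_update_update (Ψ : QVec n) (a b : Fin n) (σ : Fin n → Fin 2)
    (i j : Fin 2) :
    slice Ψ a b (Function.update (Function.update σ a i) b j) = slice Ψ a b σ := by
  funext τ
  unfold slice
  congr 1
  funext g
  simp only [Function.update_apply]
  split_ifs <;> rfl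

theorem slice_apply_self (Ψ : QVec n) (a b : Fin n) (σ : Fin n → Fin 2) :
    slice Ψ a b σ (σ a, σ b) = Ψ σ := by
  simp [slice]

theorem slice_swap (Ψ : QVec n) {a b : Fin n} (hab : a ≠ b) (σ : Fin n → Fin 2) :
    slice Ψ b a σ = slice Ψ a b σ ∘ Prod.swap := by
  funext τ
  simp only [slice, Function.comp, Prod.fst_swap, Prod.snd_swap]
  rw [Function.update_comm hab]

/-- An operator on a pair of qubits annihilates a vector iff it annihilates its slices. -/
theorem applyPair_eq_zero_iff (P : TwoQubitOp) {a b : Fin n} (hab : a ≠ b) (Ψ : QVec n) :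
    applyPair P a b Ψ = 0 ↔ ∀ σ, P *ᵥ slice Ψ a b σ = 0 := by
  constructor
  · intro h σ
    funext τ
    have := congrFun h (Function.update (Function.update σ a τ.1) b τ.2)
    have e : (P *ᵥ slice Ψ a b (Function.update (Function.update σ a τ.1) b τ.2)) τ = 0 := by
      simpa [applyPair, mulVec, dotProduct, slice, Function.update_of_ne hab] using this
    rwa [slice_update_update Ψ a b] at e
  · intro h
    funext σ
    exact congrFun (h σ) (σ a, σ b)

theorem submatrix_swap_mulVec (P : TwoQubitOp) (v : Fin 2 × Fin 2 → ℂ) :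
    P.submatrix Prod.swap Prod.swap *ᵥ v = (P *ᵥ (v ∘ Prod.swap)) ∘ Prod.swap :=
  submatrix_mulVec_equiv P v Prod.swap (Equiv.prodComm (Fin 2) (Fin 2))

theorem submatrix_swap_mulVec_eq_zero_iff (P : TwoQubitOp) (v : Fin 2 × Fin 2 → ℂ) :
    P.submatrix Prod.swap Prod.swap *ᵥ v = 0 ↔ P *ᵥ (v ∘ Prod.swap) = 0 := by
  rw [submatrix_swap_mulVec]
  constructor
  · intro h; funext τ; exact congrFun h τ.swap
  · intro h; rw [h]; rfl

theorem isStarProjection_submatrix_swap {P : TwoQubitOp} (hP : IsStarProjection P) :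
    IsStarProjection (P.submatrix Prod.swap Prod.swap) := by
  constructor
  · have := submatrix_mul_equiv P P Prod.swap (Equiv.prodComm (Fin 2) (Fin 2)) Prod.swap
    unfold IsIdempotentElem
    rw [hP.isIdempotentElem.eq] at this
    exact this
  · unfold IsSelfAdjoint
    rw [star_eq_conjTranspose, conjTranspose_submatrix, ← star_eq_conjTranspose,
      hP.isSelfAdjoint.star_eq]

/-- A two-tensor as a covector on two qubits. -/
def flat (φ : Matrix (Fin 2) (Fin 2) ℂ) : Fin 2 × Fin 2 → ℂ := fun τ => φ τ.1 τ.2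

theorem flat_transpose (φ : Matrix (Fin 2) (Fin 2) ℂ) : flat φᵀ = flat φ ∘ Prod.swap := rfl

theorem comp_swap_dotProduct (v w : Fin 2 × Fin 2 → ℂ) :
    (v ∘ Prod.swap) ⬝ᵥ w = v ⬝ᵥ (w ∘ Prod.swap) :=
  comp_equiv_dotProduct_comp_equiv v (w ∘ Prod.swap) (Equiv.prodComm (Fin 2) (Fin 2))

end Slices

namespace Instance

variable {n m : ℕ} (x : Instance n)

theorem cons_of_lt {a b : Fin n} (h : a < b) : x.cons a b = x.proj a b := if_pos h

theorem cons_swap {a b : Fin n} (h : a ≠ b) :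
    x.cons b a = (x.cons a b).submatrix Prod.swap Prod.swap := by
  unfold cons
  rcases lt_or_gt_of_ne h with h | h
  · rw [if_neg h.not_gt, if_pos h]
  · rw [if_pos h, if_neg h.not_gt, submatrix_submatrix]; rfl

theorem isStarProjection_cons {a b : Fin n} (h : a ≠ b) : IsStarProjection (x.cons a b) := by
  unfold cons
  split_ifs with hab
  · exact x.isProj a b hab
  · exact isStarProjection_submatrix_swap (x.isProj b a (lt_of_le_of_ne (not_lt.1 hab) h.symm))

theorem cons_mulVec_slice_swap {a b : Fin n} (h : a ≠ b) (Ψ : QVec n) (σ : Fin n → Fin 2) :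
    x.cons b a *ᵥ slice Ψ b a σ = 0 ↔ x.cons a b *ᵥ slice Ψ a b σ = 0 := by
  rw [x.cons_swap h, submatrix_swap_mulVec_eq_zero_iff, slice_swap Ψ h]
  rfl

theorem isSA_iff {Ψ : QVec n} :
    x.IsSA Ψ ↔ Ψ ≠ 0 ∧ ∀ a b, a ≠ b → ∀ σ, x.cons a b *ᵥ slice Ψ a b σ = 0 := by
  refine and_congr_right fun _ => ⟨fun h a b hab σ => ?_, fun h a b hab => ?_⟩
  · rcases lt_or_gt_of_ne hab with hl | hl
    · rw [x.cons_of_lt hl]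
      exact (applyPair_eq_zero_iff _ hab Ψ).1 (h a b hl) σ
    · rw [x.cons_mulVec_slice_swap hab.symm, x.cons_of_lt hl]
      exact (applyPair_eq_zero_iff _ hab.symm Ψ).1 (h b a hl) σ
  · rw [applyPair_eq_zero_iff _ hab.ne, ← x.cons_of_lt hab]
    exact h a b hab.ne

/-- The constraint tensors are the row space of the projector. -/
theorem mem_tensors_iff {a b : Fin n} (h : a ≠ b) {φ : Matrix (Fin 2) (Fin 2) ℂ} :
    φ ∈ x.tensors a b ↔ flat φ ᵥ* x.cons a b = flat φ := by
  have : (x.cons a b).map star = (x.cons a b)ᵀ := by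
    rw [← conjTranspose_transpose, ← star_eq_conjTranspose,
      (x.isStarProjection_cons h).isSelfAdjoint.star_eq]
  change ((x.cons a b).map star).mulVec (flat φ) = flat φ ↔ _
  rw [this, mulVec_transpose]

theorem mem_tensors_iff_ker {a b : Fin n} (h : a ≠ b) {φ : Matrix (Fin 2) (Fin 2) ℂ} :
    φ ∈ x.tensors a b ↔ ∀ v, x.cons a b *ᵥ v = 0 → flat φ ⬝ᵥ v = 0 := by
  rw [x.mem_tensors_iff h, vecMul_eq_self_iff (x.isStarProjection_cons h)]

theorem row_mem_tensors {a b : Fin n} (h : a ≠ b) (τ : Fin 2 × Fin 2) :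
    (Matrix.of fun i j => x.cons a b τ (i, j)) ∈ x.tensors a b :=
  (x.mem_tensors_iff h).2 (row_vecMul (x.isStarProjection_cons h) τ)

theorem transpose_mem_tensors {a b : Fin n} (h : a ≠ b) {φ : Matrix (Fin 2) (Fin 2) ℂ} :
    φᵀ ∈ x.tensors b a ↔ φ ∈ x.tensors a b := by
  rw [x.mem_tensors_iff_ker h.symm, x.mem_tensors_iff_ker h, x.cons_swap h, flat_transpose]
  simp only [submatrix_swap_mulVec_eq_zero_iff, comp_swap_dotProduct]
  exact ⟨fun H v hv => H (v ∘ Prod.swap) hv, fun H v hv => H _ hv⟩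

theorem cons_mulVec_eq_zero_iff {a b : Fin n} (h : a ≠ b) (v : Fin 2 × Fin 2 → ℂ) :
    x.cons a b *ᵥ v = 0 ↔ ∀ φ ∈ x.tensors a b, flat φ ⬝ᵥ v = 0 := by
  refine ⟨fun hv φ hφ => (x.mem_tensors_iff_ker h).1 hφ v hv, fun H => ?_⟩
  exact (mulVec_eq_zero_iff_row _ v).2 fun τ => H _ (x.row_mem_tensors h τ)

theorem isSA_iff_tensors {Ψ : QVec n} :
    x.IsSA Ψ ↔ Ψ ≠ 0 ∧ ∀ a b, a ≠ b → ∀ φ ∈ x.tensors a b, ∀ σ, flat φ ⬝ᵥ slice Ψ a b σ = 0 := by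
  rw [isSA_iff]
  refine and_congr_right fun _ => forall_congr' fun a => forall_congr' fun b =>
    forall_congr' fun hab => ?_
  simp only [x.cons_mulVec_eq_zero_iff hab]
  exact ⟨fun H φ hφ σ => H σ φ hφ, fun H σ φ hφ => H φ hφ σ⟩

theorem satisfiable_congr {x : Instance n} {y : Instance m} {F : QVec m → QVec n}
    (h : ∀ Ψ, x.IsSA Ψ ↔ ∃ Ψ', y.IsSA Ψ' ∧ Ψ = F Ψ') : x.Satisfiable ↔ y.Satisfiable := by
  constructor
  · rintro ⟨Ψ, hΨ⟩
    obtain ⟨Ψ', h', -⟩ := (h Ψ).1 hΨ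
    exact ⟨Ψ', h'⟩
  · rintro ⟨Ψ', hΨ⟩
    exact ⟨_, (h _).2 ⟨Ψ', hΨ, rfl⟩⟩

/-! ### The rule -/

/-- `x` with the tensor `w` added to the constraints at the pair `a`, `b`. -/
noncomputable def addAt (a b : Fin n) (w : Fin 2 × Fin 2 → ℂ) : Instance n where
  proj p q := if p = a ∧ q = b then addTensor (x.proj p q) w else x.proj p q
  isProj p q h := by
    split_ifs
    · exact isStarProjection_addTensor (x.isProj p q h) w
    · exact x.isProj p q h

theorem addAt_proj_self (a b : Fin n) (w : Fin 2 × Fin 2 → ℂ) :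
    (x.addAt a b w).proj a b = addTensor (x.proj a b) w := if_pos ⟨rfl, rfl⟩

theorem addAt_proj_of_ne {a b p q : Fin n} (h : ¬ (p = a ∧ q = b)) (w : Fin 2 × Fin 2 → ℂ) :
    (x.addAt a b w).proj p q = x.proj p q := if_neg h

theorem addAt_cons_of_ne {a b p q : Fin n} (h : s(p, q) ≠ s(a, b)) (w : Fin 2 × Fin 2 → ℂ) :
    (x.addAt a b w).cons p q = x.cons p q := by
  have h1 : ¬ (p = a ∧ q = b) := by rintro ⟨rfl, rfl⟩; exact h rfl
  have h2 : ¬ (q = a ∧ p = b) := by rintro ⟨rfl, rfl⟩; exact h Sym2.eq_swap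
  unfold cons
  rw [addAt_proj_of_ne x h1, addAt_proj_of_ne x h2]

theorem mem_addAt_tensors_self {a b : Fin n} (hab : a < b) (w φ : Matrix (Fin 2) (Fin 2) ℂ) :
    φ ∈ (x.addAt a b (flat w)).tensors a b ↔ ∃ c : ℂ, φ - c • w ∈ x.tensors a b := by
  rw [mem_tensors_iff _ hab.ne, cons_of_lt _ hab, addAt_proj_self,
    vecMul_addTensor_eq_self_iff (x.isProj a b hab)]
  refine exists_congr fun c => ?_
  rw [mem_tensors_iff _ hab.ne, cons_of_lt _ hab]
  rfl

theorem tensors_congr {x x' : Instance n} {p q : Fin n} (h : x'.cons p q = x.cons p q) :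
    x'.tensors p q = x.tensors p q := by
  ext φ
  change ((x'.cons p q).map star).mulVec (flat φ) = flat φ ↔
    ((x.cons p q).map star).mulVec (flat φ) = flat φ
  rw [h]

theorem ruleStep_addAt (hx : x.Homogeneous) {p k q : Fin n} (hpq : p < q) (hpk : p ≠ k)
    (hkq : k ≠ q) {φ θ : Matrix (Fin 2) (Fin 2) ℂ} (hφ : φ ∈ x.tensors p k)
    (hθ : θ ∈ x.tensors k q) : RuleStep x (x.addAt p q (flat (φ * eps * θ))) := by
  refine ⟨hx, p, k, q, hpk, hkq, hpq.ne, φ, hφ, θ, hθ, ?_, fun a b _ hne =>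
    tensors_congr (x.addAt_cons_of_ne hne _)⟩
  ext χ
  rw [mem_addAt_tensors_self x hpq, Submodule.mem_sup]
  constructor
  · rintro ⟨c, hc⟩
    exact ⟨_, hc, c • (φ * eps * θ), Submodule.smul_mem _ _ (Submodule.mem_span_singleton_self _),
      sub_add_cancel _ _⟩
  · rintro ⟨y, hy, z, hz, rfl⟩
    obtain ⟨c, rfl⟩ := Submodule.mem_span_singleton.1 hz
    exact ⟨c, by rwa [add_sub_cancel_right]⟩

end Instance

/-- Soundness of the rule: a vector that is annihilated by `φ` at `(a, b)` and by `θ` at `(b, c)` is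
annihilated by `φ ε θ` at `(a, c)`. -/
theorem flat_mul_eps_mul_dotProduct_slice {n : ℕ} {Ψ : QVec n} {a b c : Fin n} (hab : a ≠ b)
    (hbc : b ≠ c) (hac : a ≠ c) {φ θ : Matrix (Fin 2) (Fin 2) ℂ}
    (hφ : ∀ σ, flat φ ⬝ᵥ slice Ψ a b σ = 0) (hθ : ∀ σ, flat θ ⬝ᵥ slice Ψ b c σ = 0)
    (σ : Fin n → Fin 2) : flat (φ * eps * θ) ⬝ᵥ slice Ψ a c σ = 0 := by
  let F : Fin 2 → Fin 2 → Fin 2 → ℂ := fun α β γ =>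
    Ψ (Function.update (Function.update (Function.update σ a α) b β) c γ)
  have h1 : ∀ γ, φ 0 0 * F 0 0 γ + φ 0 1 * F 0 1 γ + (φ 1 0 * F 1 0 γ + φ 1 1 * F 1 1 γ) = 0 := by
    intro γ
    have := hφ (Function.update σ c γ)
    simp only [flat, slice, dotProduct, Fintype.sum_prod_type, Fin.sum_univ_two,
      Function.update_comm hac.symm, Function.update_comm hbc.symm] at this
    exact this
  have h2 : ∀ α, θ 0 0 * F α 0 0 + θ 0 1 * F α 0 1 + (θ 1 0 * F α 1 0 + θ 1 1 * F α 1 1) = 0 := by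
    intro α
    have := hθ (Function.update σ a α)
    simp only [flat, slice, dotProduct, Fintype.sum_prod_type, Fin.sum_univ_two] at this
    exact this
  have h3 : ∀ α γ, slice Ψ a c σ (α, γ) = F α (σ b) γ := by
    intro α γ
    simp only [slice, F]
    congr 2
    rw [Function.update_comm hab, Function.update_eq_self]
  simp only [dotProduct, Fintype.sum_prod_type, Fin.sum_univ_two, h3, flat, eps, mul_apply,
    Matrix.of_apply, cons_val', cons_val_zero, cons_val_one, cons_val_fin_one]
  have hb : σ b = 0 ∨ σ b = 1 := by omega
  rcases hb with hb | hb <;> rw [hb]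
  · linear_combination θ 1 0 * h1 0 + θ 1 1 * h1 1 - φ 0 1 * h2 0 - φ 1 1 * h2 1
  · linear_combination φ 0 0 * h2 0 + φ 1 0 * h2 1 - θ 0 0 * h1 0 - θ 0 1 * h1 1

theorem RuleStep.isSA_iff {n : ℕ} {x x' : Instance n} (h : RuleStep x x') (Ψ : QVec n) :
    x.IsSA Ψ ↔ x'.IsSA Ψ := by
  obtain ⟨-, a, b, c, hab, hbc, hac, φ, hφ, θ, hθ, h1, h2⟩ := h
  rw [x.isSA_iff_tensors, x'.isSA_iff_tensors]
  refine and_congr_right fun _ => ⟨fun H p q hpq χ hχ σ => ?_, fun H p q hpq χ hχ σ => ?_⟩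
  · have key : ∀ χ ∈ x'.tensors a c, ∀ σ, flat χ ⬝ᵥ slice Ψ a c σ = 0 := by
      intro χ hχ σ
      rw [h1, Submodule.mem_sup] at hχ
      obtain ⟨y, hy, z, hz, rfl⟩ := hχ
      obtain ⟨d, rfl⟩ := Submodule.mem_span_singleton.1 hz
      have e : flat (y + d • (φ * eps * θ)) = flat y + d • flat (φ * eps * θ) := rfl
      rw [e, add_dotProduct, smul_dotProduct, H a c hac y hy σ,
        flat_mul_eps_mul_dotProduct_slice hab hbc hac (H a b hab φ hφ) (H b c hbc θ hθ), smul_zero,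
        add_zero]
    by_cases hs : s(p, q) = s(a, c)
    · rcases Sym2.eq_iff.1 hs with ⟨rfl, rfl⟩ | ⟨rfl, rfl⟩
      · exact key χ hχ σ
      · have := key χᵀ ((x'.transpose_mem_tensors hpq).2 hχ) σ
        rwa [flat_transpose, comp_swap_dotProduct, slice_swap Ψ hpq, Function.comp_assoc,
          Prod.swap_swap_eq, Function.comp_id] at this
    · rw [h2 p q hpq hs] at hχ
      exact H p q hpq χ hχ σ
  · refine H p q hpq χ ?_ σ
    by_cases hs : s(p, q) = s(a, c)
    · rcases Sym2.eq_iff.1 hs with ⟨rfl, rfl⟩ | ⟨rfl, rfl⟩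
      · rw [h1]; exact Submodule.mem_sup_left hχ
      · rw [← x'.transpose_mem_tensors hpq, h1]
        exact Submodule.mem_sup_left ((x.transpose_mem_tensors hpq).2 hχ)
    · rwa [h2 p q hpq hs]

theorem isSA_iff_of_reflTransGen {n : ℕ} {x x' : Instance n}
    (h : Relation.ReflTransGen RuleStep x x') (Ψ : QVec n) : x.IsSA Ψ ↔ x'.IsSA Ψ := by
  induction h with
  | refl => rfl
  | tail _ h ih => exact ih.trans (h.isSA_iff Ψ)

/-! ### Composition of tensors -/

theorem mul_eps_mul_transpose (φ : Matrix (Fin 2) (Fin 2) ℂ) : φ * eps * φᵀ = φ.det • eps := by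
  ext i j
  fin_cases i <;> fin_cases j <;>
    simp [eps, mul_apply, Fin.sum_univ_two, det_fin_two] <;> ring

theorem eps_mul_eps : eps * eps = -1 := by
  ext i j
  fin_cases i <;> fin_cases j <;> simp [eps, mul_apply, Fin.sum_univ_two]

theorem transpose_eps : epsᵀ = -eps := by
  ext i j
  fin_cases i <;> fin_cases j <;> simp [eps]

theorem transpose_mul_eps_mul (φ θ : Matrix (Fin 2) (Fin 2) ℂ) :
    (φ * eps * θ)ᵀ = -(θᵀ * eps * φᵀ) := by
  rw [transpose_mul, transpose_mul, transpose_eps, neg_mul, mul_neg, mul_assoc]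

theorem flat_injective : Function.Injective flat := by
  intro φ θ h
  ext i j
  exact congrFun h (i, j)

namespace Instance

variable {n : ℕ}

theorem Homogeneous.rank_cons {x : Instance n} (hx : x.Homogeneous) {a b : Fin n} (h : a ≠ b) :
    (x.cons a b).rank ≤ 1 := by
  unfold cons
  split_ifs with hab
  · exact hx a b hab
  · have := rank_submatrix (x.proj b a) (Equiv.prodComm (Fin 2) (Fin 2))
      (Equiv.prodComm (Fin 2) (Fin 2))
    change ((x.proj b a).submatrix (Equiv.prodComm (Fin 2) (Fin 2))
      (Equiv.prodComm (Fin 2) (Fin 2))).rank ≤ 1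
    rw [this]
    exact hx b a (lt_of_le_of_ne (not_lt.1 hab) h.symm)

theorem Homogeneous.exists_smul {x : Instance n} (hx : x.Homogeneous) {a b : Fin n} (h : a ≠ b)
    {T φ : Matrix (Fin 2) (Fin 2) ℂ} (hT : T ∈ x.tensors a b) (hT0 : T ≠ 0)
    (hφ : φ ∈ x.tensors a b) : ∃ c : ℂ, φ = c • T := by
  obtain ⟨c, hc⟩ := exists_smul_of_rank_le_one (hx.rank_cons h)
    (fun h => hT0 (flat_injective h)) ((x.mem_tensors_iff h).1 hT) ((x.mem_tensors_iff h).1 hφ)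
  exact ⟨c, flat_injective hc⟩

/-- Going back and forth along a pair is trivial in a homogeneous instance. -/
theorem Homogeneous.mul_eps_mul {x : Instance n} (hx : x.Homogeneous) {a b : Fin n} (h : a ≠ b)
    {φ θ : Matrix (Fin 2) (Fin 2) ℂ} (hφ : φ ∈ x.tensors a b) (hθ : θ ∈ x.tensors b a) :
    ∃ e : ℂ, φ * eps * θ = e • eps := by
  by_cases h0 : φ = 0
  · exact ⟨0, by simp [h0]⟩
  obtain ⟨c, hc⟩ := hx.exists_smul h hφ h0 ((x.transpose_mem_tensors h.symm).2 hθ)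
  refine ⟨c * φ.det, ?_⟩
  rw [← transpose_transpose θ, hc, transpose_smul, mul_smul_comm, mul_eps_mul_transpose, smul_smul]

/-! ### Closure under the rule -/

/-- The compositions through the first `k` qubits are constraints already. -/
def ClosedBelow (x : Instance n) (k : ℕ) : Prop :=
  ∀ a b c : Fin n, a ≠ b → b ≠ c → a ≠ c → (b : ℕ) < k →
    ∀ φ ∈ x.tensors a b, ∀ θ ∈ x.tensors b c, φ * eps * θ ∈ x.tensors a c

/-- The constraints of `x` at `p`, `q` are those of `y` together with the composition through `k`
of the spanning tensors `T₁` at `(p, k)` and `T₂` at `(k, q)`; these may be zero. -/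
def Joined (y x : Instance n) (k p q : Fin n) : Prop :=
  ∃ T₁ ∈ y.tensors p k, ∃ T₂ ∈ y.tensors k q,
    (∀ φ ∈ y.tensors p k, ∃ c : ℂ, φ = c • T₁) ∧ (∀ φ ∈ y.tensors k q, ∃ c : ℂ, φ = c • T₂) ∧
    ∀ φ, φ ∈ x.tensors p q ↔ ∃ c : ℂ, φ - c • (T₁ * eps * T₂) ∈ y.tensors p q

theorem Joined.symm {y x : Instance n} {k p q : Fin n} (hpk : p ≠ k) (hkq : k ≠ q) (hpq : p ≠ q)
    (h : Joined y x k p q) : Joined y x k q p := by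
  obtain ⟨T₁, h1, T₂, h2, s1, s2, h3⟩ := h
  refine ⟨T₂ᵀ, (y.transpose_mem_tensors hkq).2 h2, T₁ᵀ, (y.transpose_mem_tensors hpk).2 h1,
    fun φ hφ => ?_, fun φ hφ => ?_, fun φ => ?_⟩
  · obtain ⟨c, hc⟩ := s2 φᵀ ((y.transpose_mem_tensors hkq.symm).2 hφ)
    exact ⟨c, by rw [← transpose_smul, ← hc, transpose_transpose]⟩
  · obtain ⟨c, hc⟩ := s1 φᵀ ((y.transpose_mem_tensors hpk.symm).2 hφ)
    exact ⟨c, by rw [← transpose_smul, ← hc, transpose_transpose]⟩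
  · rw [← x.transpose_mem_tensors hpq.symm, h3]
    constructor
    · rintro ⟨c, hc⟩
      refine ⟨-c, ?_⟩
      rw [← y.transpose_mem_tensors hpq, transpose_sub, transpose_smul, transpose_mul_eps_mul,
        transpose_transpose] at hc
      simpa using hc
    · rintro ⟨c, hc⟩
      refine ⟨-c, ?_⟩
      rw [← y.transpose_mem_tensors hpq.symm, transpose_sub, transpose_smul, transpose_mul_eps_mul,
        transpose_transpose] at hc
      simpa using hc

/-- A stage of the closure: the compositions through the qubit `k` have been added at the pairs in
`S`. -/
def Stage (y x : Instance n) (k : Fin n) (S : Set (ℕ × ℕ)) : Prop :=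
  ∀ p q : Fin n, p < q →
    (((p : ℕ), (q : ℕ)) ∈ S ∧ p ≠ k ∧ k ≠ q → Joined y x k p q) ∧
      (¬ (((p : ℕ), (q : ℕ)) ∈ S ∧ p ≠ k ∧ k ≠ q) → x.tensors p q = y.tensors p q)

theorem stage_empty (y : Instance n) (k : Fin n) : Stage y y k ∅ := by
  intro p q _
  simp

theorem Stage.tensors_eq {y x : Instance n} {k : Fin n} {S : Set (ℕ × ℕ)} (h : Stage y x k S)
    {p q : Fin n} (hpq : p ≠ q) (hk : p = k ∨ k = q) : x.tensors p q = y.tensors p q := by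
  have key : ∀ p q : Fin n, p < q → (p = k ∨ k = q) → x.tensors p q = y.tensors p q := by
    intro p q hpq hk
    exact (h p q hpq).2 (by tauto)
  rcases lt_or_gt_of_ne hpq with hl | hl
  · exact key p q hl hk
  · have := key q p hl (hk.symm.imp Eq.symm Eq.symm)
    ext φ
    rw [← x.transpose_mem_tensors hpq, this, y.transpose_mem_tensors hpq]

theorem Stage.insert_of_eq {y x : Instance n} {k : Fin n} {S : Set (ℕ × ℕ)} (h : Stage y x k S)
    {p q : Fin n} (hk : p = k ∨ k = q) : Stage y x k (insert ((p : ℕ), (q : ℕ)) S) := by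
  intro a b hab
  have := h a b hab
  by_cases he : a = p ∧ b = q
  · obtain ⟨rfl, rfl⟩ := he
    exact ⟨by tauto, fun _ => this.2 (by tauto)⟩
  · have hne : ((a : ℕ), (b : ℕ)) ≠ ((p : ℕ), (q : ℕ)) := fun hh =>
      he ⟨Fin.ext (congrArg Prod.fst hh), Fin.ext (congrArg Prod.snd hh)⟩
    rwa [Set.mem_insert_iff, or_iff_right hne]

theorem Stage.insert_addAt {y x : Instance n} {k : Fin n} {S : Set (ℕ × ℕ)} (h : Stage y x k S)
    {p q : Fin n} (hpq : p < q) (hpk : p ≠ k) (hkq : k ≠ q) (hS : ((p : ℕ), (q : ℕ)) ∉ S)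
    {T₁ T₂ : Matrix (Fin 2) (Fin 2) ℂ} (h1 : T₁ ∈ x.tensors p k) (h2 : T₂ ∈ x.tensors k q)
    (s1 : ∀ φ ∈ x.tensors p k, ∃ c : ℂ, φ = c • T₁)
    (s2 : ∀ φ ∈ x.tensors k q, ∃ c : ℂ, φ = c • T₂) :
    Stage y (x.addAt p q (flat (T₁ * eps * T₂))) k (insert ((p : ℕ), (q : ℕ)) S) := by
  intro a b hab
  by_cases he : a = p ∧ b = q
  · obtain ⟨rfl, rfl⟩ := he
    have e := (h a b hab).2 (by tauto)
    refine ⟨fun _ => ?_, fun hn => absurd ⟨Set.mem_insert _ _, hpk, hkq⟩ hn⟩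
    rw [h.tensors_eq hpk (.inr rfl)] at h1 s1
    rw [h.tensors_eq hkq (.inl rfl)] at h2 s2
    exact ⟨T₁, h1, T₂, h2, s1, s2, fun φ => by rw [mem_addAt_tensors_self x hab, e]⟩
  · have hne : ((a : ℕ), (b : ℕ)) ≠ ((p : ℕ), (q : ℕ)) := fun hh =>
      he ⟨Fin.ext (congrArg Prod.fst hh), Fin.ext (congrArg Prod.snd hh)⟩
    have hs : s(a, b) ≠ s(p, q) := by
      intro hs
      rcases Sym2.eq_iff.1 hs with hh | ⟨rfl, rfl⟩
      · exact he hh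
      · exact absurd hab hpq.not_gt
    have e : (x.addAt p q (flat (T₁ * eps * T₂))).tensors a b = x.tensors a b :=
      tensors_congr (x.addAt_cons_of_ne hs _)
    have := h a b hab
    rw [Set.mem_insert_iff, or_iff_right hne]
    simpa only [Joined, e] using this

/-- After the stage `k`, all compositions through `k` are present, and those through the earlier
qubits are still present, because composition is associative and going back and forth along a pair
is trivial. -/
theorem Stage.closedBelow_succ {y x : Instance n} {k : Fin n} {S : Set (ℕ × ℕ)}
    (h : Stage y x k S) (hS : ∀ p q : Fin n, p < q → ((p : ℕ), (q : ℕ)) ∈ S)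
    (hy : y.Homogeneous) (hc : y.ClosedBelow k) : x.ClosedBelow (k + 1) := by
  have hJ : ∀ p q : Fin n, p ≠ k → k ≠ q → p ≠ q → Joined y x k p q := by
    have key : ∀ p q : Fin n, p ≠ k → k ≠ q → p < q → Joined y x k p q := by
      intro p q hpk hkq hpq
      exact (h p q hpq).1 ⟨hS p q hpq, hpk, hkq⟩
    intro p q hpk hkq hpq
    rcases lt_or_gt_of_ne hpq with hl | hl
    · exact key p q hpk hkq hl
    · exact (key q p hkq.symm hpk.symm hl).symm hkq.symm hpk.symm hpq.symm
  -- the old constraints, the compositions through `k`, and nothing else, are constraints of `x`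
  have hi : ∀ p q : Fin n, p ≠ q → ∀ φ ∈ y.tensors p q, φ ∈ x.tensors p q := by
    intro p q hpq φ hφ
    by_cases hk : p = k ∨ k = q
    · rwa [h.tensors_eq hpq hk]
    · push Not at hk
      obtain ⟨T₁, -, T₂, -, -, -, h3⟩ := hJ p q hk.1 hk.2 hpq
      exact (h3 φ).2 ⟨0, by simpa using hφ⟩
  have hii : ∀ p q : Fin n, p ≠ k → k ≠ q → p ≠ q → ∀ φ ∈ y.tensors p k, ∀ θ ∈ y.tensors k q,
      φ * eps * θ ∈ x.tensors p q := by
    intro p q hpk hkq hpq φ hφ θ hθ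
    obtain ⟨T₁, -, T₂, -, s1, s2, h3⟩ := hJ p q hpk hkq hpq
    obtain ⟨c, rfl⟩ := s1 φ hφ
    obtain ⟨d, rfl⟩ := s2 θ hθ
    refine (h3 _).2 ⟨c * d, ?_⟩
    simp only [smul_mul_assoc, mul_smul_comm, smul_smul]
    simp [mul_comm]
  have hiii : ∀ p q : Fin n, p ≠ k → k ≠ q → p ≠ q → ∀ φ ∈ x.tensors p q,
      ∃ φ₁ ∈ y.tensors p q, ∃ T₁ ∈ y.tensors p k, ∃ T₂ ∈ y.tensors k q,
        φ = φ₁ + T₁ * eps * T₂ := by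
    intro p q hpk hkq hpq φ hφ
    obtain ⟨T₁, h1, T₂, h2, -, -, h3⟩ := hJ p q hpk hkq hpq
    obtain ⟨c, hc⟩ := (h3 φ).1 hφ
    exact ⟨_, hc, c • T₁, Submodule.smul_mem _ _ h1, T₂, h2, by simp⟩
  intro a b c hab hbc hac hbk φ hφ θ hθ
  by_cases hb : b = k
  · subst hb
    rw [h.tensors_eq hab (.inr rfl)] at hφ
    rw [h.tensors_eq hbc (.inl rfl)] at hθ
    exact hii a c hab hbc hac φ hφ θ hθ
  have hbk' : (b : ℕ) < k := lt_of_le_of_ne (Nat.lt_succ_iff.1 hbk) fun e => hb (Fin.ext e)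
  -- if an end is `k`, the composition leads from `k` to another qubit and back
  by_cases ha : a = k
  · subst ha
    rw [h.tensors_eq hab (.inl rfl)] at hφ
    obtain ⟨θ₁, h1, T₁, hT1, T₂, hT2, rfl⟩ := hiii b c hb hac hbc θ hθ
    obtain ⟨e, he⟩ := hy.mul_eps_mul hab hφ hT1
    rw [h.tensors_eq hac (.inl rfl), mul_add, ← mul_assoc, ← mul_assoc, he, smul_mul_assoc,
      eps_mul_eps, smul_neg, neg_mul, smul_mul_assoc, one_mul]
    exact Submodule.add_mem _ (hc a b c hab hbc hac hbk' _ hφ _ h1)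
      (Submodule.neg_mem _ (Submodule.smul_mem _ _ hT2))
  by_cases hk : c = k
  · subst hk
    rw [h.tensors_eq hbc (.inr rfl)] at hθ
    obtain ⟨φ₁, h1, T₁, hT1, T₂, hT2, rfl⟩ := hiii a b ha (Ne.symm hb) hab φ hφ
    obtain ⟨e, he⟩ := hy.mul_eps_mul hbc.symm hT2 hθ
    have e' : T₁ * eps * T₂ * eps * θ = -(e • T₁) := by
      rw [mul_assoc (T₁ * eps), mul_assoc (T₁ * eps), he, mul_smul_comm, mul_assoc,
        eps_mul_eps, mul_neg, mul_one, smul_neg]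
    rw [h.tensors_eq hac (.inr rfl), add_mul, add_mul, e']
    exact Submodule.add_mem _ (hc a b c hab hbc hac hbk' _ h1 _ hθ)
      (Submodule.neg_mem _ (Submodule.smul_mem _ _ hT1))
  -- expanding both factors gives compositions through `b`, and through `k` after `b`; in the last
  -- one, `k → b → k` collapses to a scalar
  obtain ⟨φ₁, hφ1, T₁, hT1, T₂, hT2, rfl⟩ := hiii a b ha (Ne.symm hb) hab φ hφ
  obtain ⟨θ₁, hθ1, U₁, hU1, U₂, hU2, rfl⟩ := hiii b c hb (Ne.symm hk) hbc θ hθ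
  have hck : k ≠ c := Ne.symm hk
  have hkb : k ≠ b := Ne.symm hb
  obtain ⟨e, he⟩ := hy.mul_eps_mul hkb hT2 hU1
  have e1 : (φ₁ + T₁ * eps * T₂) * eps * (θ₁ + U₁ * eps * U₂) =
      φ₁ * eps * θ₁ + (φ₁ * eps * U₁) * eps * U₂ + T₁ * eps * (T₂ * eps * θ₁) +
        T₁ * eps * (T₂ * eps * U₁) * eps * U₂ := by
    noncomm_ring
  have e2 : T₁ * eps * (T₂ * eps * U₁) * eps * U₂ = -(e • (T₁ * eps * U₂)) := by
    rw [he, mul_smul_comm, mul_assoc T₁, eps_mul_eps, mul_neg, mul_one, smul_neg, neg_mul, neg_mul,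
      smul_mul_assoc, smul_mul_assoc]
  rw [e1, e2]
  refine Submodule.add_mem _ (Submodule.add_mem _ (Submodule.add_mem _ ?_ ?_) ?_)
    (Submodule.neg_mem _ (Submodule.smul_mem _ _ (hii a c ha hck hac _ hT1 _ hU2)))
  · exact hi a c hac _ (hc a b c hab hbc hac hbk' _ hφ1 _ hθ1)
  · exact hii a c ha hck hac _ (hc a b k hab hb ha hbk' _ hφ1 _ hU1) _ hU2
  · exact hii a c ha hck hac _ hT1 _ (hc k b c hkb hbc hck hbk' _ hT2 _ hθ1)

/-! ### Product states of closed instances -/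

theorem slice_productVec (ψ : Fin n → Fin 2 → ℂ) {a b : Fin n} (hab : a ≠ b) (σ : Fin n → Fin 2)
    (τ : Fin 2 × Fin 2) : slice (productVec ψ) a b σ τ =
      ψ a τ.1 * ψ b τ.2 * ∏ j ∈ (Finset.univ.erase a).erase b, ψ j (σ j) := by
  unfold slice productVec
  rw [← Finset.mul_prod_erase _ _ (Finset.mem_univ a),
    ← Finset.mul_prod_erase _ _ (Finset.mem_erase.2 ⟨hab.symm, Finset.mem_univ b⟩)]
  rw [Function.update_of_ne hab, Function.update_self, Function.update_self, ← mul_assoc]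
  congr 1
  refine Finset.prod_congr rfl fun j hj => ?_
  rw [Finset.mem_erase, Finset.mem_erase] at hj
  rw [Function.update_of_ne hj.1, Function.update_of_ne hj.2.1]

theorem productVec_ne_zero {ψ : Fin n → Fin 2 → ℂ} (h : ∀ p, ψ p ≠ 0) : productVec ψ ≠ 0 := by
  choose σ hσ using fun p => Function.ne_iff.1 (h p)
  exact fun h0 => Finset.prod_ne_zero_iff.2 (fun p _ => hσ p) (congrFun h0 σ)

theorem flat_dotProduct_slice_productVec (ψ : Fin n → Fin 2 → ℂ) {a b : Fin n} (hab : a ≠ b)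
    {φ : Matrix (Fin 2) (Fin 2) ℂ} (h : (ψ a ᵥ* φ) ⬝ᵥ ψ b = 0) (σ : Fin n → Fin 2) :
    flat φ ⬝ᵥ slice (productVec ψ) a b σ = 0 := by
  have : flat φ ⬝ᵥ slice (productVec ψ) a b σ =
      ((ψ a ᵥ* φ) ⬝ᵥ ψ b) * ∏ j ∈ (Finset.univ.erase a).erase b, ψ j (σ j) := by
    simp only [dotProduct, Fintype.sum_prod_type, Fin.sum_univ_two, slice_productVec ψ hab, flat,
      vecMul]
    ring
  rw [this, h, zero_mul]

theorem vecMul_dotProduct_transpose (u v : Fin 2 → ℂ) (φ : Matrix (Fin 2) (Fin 2) ℂ) :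
    (u ᵥ* φᵀ) ⬝ᵥ v = (v ᵥ* φ) ⬝ᵥ u := by
  rw [vecMul_transpose, dotProduct_comm, dotProduct_mulVec]

/-- In a homogeneous instance that is closed under the rule, the qubits can be given states one
after the other: a state that is forced by one of the earlier qubits agrees with all of them, and if
none of them imposes anything, any state will do. -/
theorem isSA_productVec {x : Instance n} (hx : x.Homogeneous) (hc : x.ClosedBelow n)
    {ψ : Fin n → Fin 2 → ℂ} (h0 : ∀ p, ψ p ≠ 0)
    (h : ∀ p, (∀ q < p, ∀ φ ∈ x.tensors q p, ψ q ᵥ* φ = 0) ∨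
      ∃ q < p, ∃ φ ∈ x.tensors q p, ψ p = (ψ q ᵥ* φ) ᵥ* eps) :
    x.IsSA (productVec ψ) := by
  have key : ∀ p q : Fin n, q < p → ∀ φ ∈ x.tensors q p, (ψ q ᵥ* φ) ⬝ᵥ ψ p = 0 := by
    intro p
    induction p using WellFoundedLT.induction with | _ p ih
    intro q hqp φ hφ
    rcases h p with hp | ⟨a, hap, φ₀, hφ₀, hp⟩
    · rw [hp q hqp φ hφ, zero_dotProduct]
    -- the qubit that forces the state of `p`, or another one
    by_cases hqa : q = a
    · subst hqa
      have hn : φ₀ ≠ 0 := by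
        rintro rfl
        exact h0 p (by rw [hp, vecMul_zero, zero_vecMul])
      obtain ⟨c, rfl⟩ := hx.exists_smul hqp.ne hφ₀ hn hφ
      rw [hp]
      simp [vecMul, dotProduct, Fin.sum_univ_two, eps]
      ring
    -- `ψ q φ` is proportional to `ψ a φ₀` because the composition through `p` annihilates `ψ q ⊗ ψ a`
    · have hχ := hc q p a hqp.ne hap.ne' hqa p.isLt φ hφ φ₀ᵀ
        ((x.transpose_mem_tensors hap.ne).2 hφ₀)
      have e : (ψ q ᵥ* φ) ⬝ᵥ ψ p = -((ψ q ᵥ* (φ * eps * φ₀ᵀ)) ⬝ᵥ ψ a) := by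
        rw [hp]
        simp [vecMul, dotProduct, Fin.sum_univ_two, eps, mul_apply]
        ring
      rw [e, neg_eq_zero]
      rcases lt_or_gt_of_ne hqa with hl | hl
      · exact ih a hap q hl _ hχ
      · rw [← transpose_transpose (φ * eps * φ₀ᵀ), vecMul_dotProduct_transpose]
        exact ih q hqp a hl _ ((x.transpose_mem_tensors hqa).2 hχ)
  refine x.isSA_iff_tensors.2 ⟨productVec_ne_zero h0, fun a b hab φ hφ σ => ?_⟩
  refine flat_dotProduct_slice_productVec ψ hab ?_ σ
  rcases lt_or_gt_of_ne hab with hl | hl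
  · exact key b a hl φ hφ
  · rw [← transpose_transpose φ, vecMul_dotProduct_transpose]
    exact key a b hl _ ((x.transpose_mem_tensors hab).2 hφ)

end Instance

/-! ### Merging and eliminating qubits, on instances -/

section Reductions

variable {n m : ℕ}

theorem mulVec_sum_smul (P : TwoQubitOp) (k : Fin 2 → ℂ) (z : Fin 2 → Fin 2 × Fin 2 → ℂ) :
    P *ᵥ (fun τ => ∑ s, k s * z s τ) = fun r => ∑ s, k s * (P *ᵥ z s) r := by
  have : (fun τ => ∑ s, k s * z s τ) = ∑ s, k s • z s := by ext τ; simp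
  rw [this, mulVec_sum]
  ext r
  simp [mulVec_smul]

theorem update_update_comp {e : Fin m → Fin n} (he : Function.Injective e) (σ : Fin n → Fin 2)
    (p q : Fin m) (i j : Fin 2) :
    Function.update (Function.update σ (e p) i) (e q) j ∘ e =
      Function.update (Function.update (σ ∘ e) p i) q j := by
  rw [Function.update_comp_eq_of_injective _ he, Function.update_comp_eq_of_injective _ he]

namespace Instance

/-- The instance on the logical qubit `c` and the others whose constraints are those of `x`,
contracted with the embedding `V` of the logical qubit. The last part of `h2` charges `Π_{a,b}`
itself, which matters if the range of `V` is larger than its kernel, to the pairs of `c` and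
another qubit; `d` is one. -/
theorem mergesTo_of {x : Instance n} {y : Instance m} {a b : Fin n} (hab : a < b)
    {V : Matrix (Fin 2 × Fin 2) (Fin 2) ℂ} {c d : Fin m} {e : Fin m → Fin n} (hdc : d ≠ c)
    (hV : Function.Injective V.mulVec)
    (hker : ∀ v, x.cons a b *ᵥ v = 0 → ∃ u, V.mulVec u = v)
    (he : Function.Injective e) (hrange : Set.range e = {b}ᶜ) (hec : e c = a)
    (h1 : ∀ p q, p ≠ q → p ≠ c → q ≠ c → ∀ v,
      y.cons p q *ᵥ v = 0 ↔ x.cons (e p) (e q) *ᵥ v = 0)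
    (h2 : ∀ q, q ≠ c → ∀ v, y.cons c q *ᵥ v = 0 ↔
      (∀ i₂, x.cons a (e q) *ᵥ (fun τ => ∑ s, V (τ.1, i₂) s * v (s, τ.2)) = 0) ∧
      (∀ i₁, x.cons b (e q) *ᵥ (fun τ => ∑ s, V (i₁, τ.1) s * v (s, τ.2)) = 0) ∧
      ∀ j, x.cons a b *ᵥ (fun τ => ∑ s, V τ s * v (s, j)) = 0) :
    MergesTo x y a b := by
  refine ⟨V, c, e, hV, fun v hv => hker v (by rwa [x.cons_of_lt hab]), he, hrange, hec, ?_⟩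
  have hb : ∀ p, e p ≠ b := fun p hp => by
    have : e p ∈ ({b}ᶜ : Set (Fin n)) := hrange ▸ Set.mem_range_self p
    exact this hp
  have hbr : ∀ p, b ≠ e p := fun p => (hb p).symm
  have hbn : b ∉ Set.range e := by rintro ⟨p, hp⟩; exact hb p hp
  have hcov : ∀ g, g ≠ b → ∃ p, e p = g := fun g hg => by
    have : g ∈ Set.range e := by rw [hrange]; exact hg
    exact this
  have hlift : ∀ (ρ : Fin m → Fin 2) (τ : Fin 2 × Fin 2), ∃ σ : Fin n → Fin 2,
      σ a = τ.1 ∧ σ b = τ.2 ∧ σ ∘ e = Function.update ρ c τ.1 := by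
    intro ρ τ
    refine ⟨Function.extend e (Function.update ρ c τ.1) fun _ => τ.2, ?_, ?_, ?_⟩
    · rw [← hec, he.extend_apply, Function.update_self]
    · exact Function.extend_apply' _ _ _ fun ⟨p, hp⟩ => hb p hp
    · funext p; exact he.extend_apply _ _ p
  let W : QVec m → QVec n := fun Ψ' σ =>
    ∑ s : Fin 2, V (σ a, σ b) s * Ψ' (Function.update (σ ∘ e) c s)
  have hVz : ∀ z : Fin 2 → ℂ, (∀ τ, ∑ s, V τ s * z s = 0) → z = 0 := fun z hz =>
    hV (by rw [mulVec_zero]; exact funext hz)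
  -- the slices of `V_c Ψ'`
  have S1 : ∀ (Ψ' : QVec m) (σ : Fin n → Fin 2) (p q : Fin m), p ≠ q → p ≠ c → q ≠ c →
      slice (W Ψ') (e p) (e q) σ = fun τ => ∑ s, V (σ a, σ b) s *
        slice Ψ' p q (Function.update (σ ∘ e) c s) τ := by
    intro Ψ' σ p q hpq hp hq
    funext τ
    have ha : ∀ r, r ≠ c → a ≠ e r := fun r hr h => hr (he (h.symm.trans hec.symm))
    simp only [slice, W, update_update_comp he, Function.update_of_ne (ha p hp),
      Function.update_of_ne (ha q hq), Function.update_of_ne (hbr p),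
      Function.update_of_ne (hbr q)]
    refine Finset.sum_congr rfl fun s _ => ?_
    rw [Function.update_comm hp.symm, Function.update_comm hq.symm]
  have hac : ∀ q, q ≠ c → a ≠ e q := fun q hq h => hq (he (h.symm.trans hec.symm))
  have S2 : ∀ (Ψ' : QVec m) (σ : Fin n → Fin 2) (q : Fin m), q ≠ c →
      slice (W Ψ') a (e q) σ = fun τ => ∑ s, V (τ.1, σ b) s *
        slice Ψ' c q (σ ∘ e) (s, τ.2) := by
    intro Ψ' σ q hq
    funext τ
    have h3 := update_update_comp he σ c q τ.1 τ.2
    rw [hec] at h3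
    simp only [slice, W, h3, Function.update_of_ne (hac q hq), Function.update_self,
      Function.update_of_ne (hbr q), Function.update_of_ne hab.ne']
    refine Finset.sum_congr rfl fun s _ => ?_
    rw [Function.update_comm hq, Function.update_idem, Function.update_comm hq.symm]
  have S3 : ∀ (Ψ' : QVec m) (σ : Fin n → Fin 2) (q : Fin m), q ≠ c →
      slice (W Ψ') b (e q) σ = fun τ => ∑ s, V (σ a, τ.1) s *
        slice Ψ' c q (σ ∘ e) (s, τ.2) := by
    intro Ψ' σ q hq
    funext τ
    simp only [slice, W, Function.update_comp_eq_of_injective _ he,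
      Function.update_comp_eq_of_notMem_range _ _ hbn, Function.update_of_ne (hac q hq),
      Function.update_of_ne (hbr q), Function.update_of_ne hab.ne, Function.update_self]
    refine Finset.sum_congr rfl fun s _ => ?_
    rw [Function.update_comm hq]
  have S4 : ∀ (Ψ' : QVec m) (σ : Fin n → Fin 2), slice (W Ψ') a b σ =
      fun τ => ∑ s, V τ s * Ψ' (Function.update (σ ∘ e) c s) := by
    intro Ψ' σ
    funext τ
    simp only [slice, W, Function.update_of_ne hab.ne, Function.update_self,
      Function.update_comp_eq_of_notMem_range _ _ hbn]
    refine Finset.sum_congr rfl fun s _ => ?_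
    rw [← hec, Function.update_comp_eq_of_injective _ he, Function.update_idem]
  have hW0 : ∀ Ψ', W Ψ' = 0 ↔ Ψ' = 0 := by
    intro Ψ'
    constructor
    · intro h
      funext ρ
      have := hVz (fun s => Ψ' (Function.update ρ c s)) fun τ => by
        obtain ⟨σ, h3, h4, h5⟩ := hlift ρ τ
        have := congrFun h σ
        simpa only [W, h3, h4, h5, Function.update_idem, Prod.mk.eta, Pi.zero_apply] using this
      simpa using congrFun this (ρ c)
    · rintro rfl
      funext σ
      simp [W]
  have hcore : ∀ Ψ', (∀ g h, g ≠ h → ∀ σ, x.cons g h *ᵥ slice (W Ψ') g h σ = 0) ↔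
      ∀ p q, p ≠ q → ∀ ρ, y.cons p q *ᵥ slice Ψ' p q ρ = 0 := by
    intro Ψ'
    constructor
    · intro H
      have hc : ∀ q, q ≠ c → ∀ ρ, y.cons c q *ᵥ slice Ψ' c q ρ = 0 := by
        intro q hq ρ
        refine (h2 q hq _).2 ⟨fun i₂ => ?_, fun i₁ => ?_, fun j => ?_⟩
        · obtain ⟨σ, -, h4, h5⟩ := hlift ρ (ρ c, i₂)
          rw [Function.update_eq_self] at h5
          have := H a (e q) (hac q hq) σ
          rwa [S2 Ψ' σ q hq, h4, h5] at this
        · obtain ⟨σ, h3, -, h5⟩ := hlift (Function.update ρ c i₁) (i₁, 0)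
          have := H b (e q) (hbr q) σ
          rw [S3 Ψ' σ q hq, h3, h5] at this
          simpa [slice] using this
        · obtain ⟨σ, -, -, h5⟩ := hlift (Function.update ρ q j) (ρ c, 0)
          have := H a b hab.ne σ
          rw [S4 Ψ' σ, h5] at this
          simpa [slice, Function.update_comm hq] using this
      intro p q hpq ρ
      by_cases hp : p = c
      · subst hp; exact hc q hpq.symm ρ
      by_cases hq : q = c
      · subst hq
        rw [y.cons_mulVec_slice_swap hpq.symm]
        exact hc p hpq ρ
      rw [h1 p q hpq hp hq]
      funext r
      have := hVz (fun s => (x.cons (e p) (e q) *ᵥ slice Ψ' p q (Function.update ρ c s)) r)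
        fun τ => by
          obtain ⟨σ, h3, h4, h5⟩ := hlift ρ τ
          have := H (e p) (e q) (fun h => hpq (he h)) σ
          rw [S1 Ψ' σ p q hpq hp hq, mulVec_sum_smul, h3, h4, h5] at this
          simpa only [Function.update_idem, Prod.mk.eta, Pi.zero_apply] using congrFun this r
      simpa using congrFun this (ρ c)
    · intro H
      have hA : ∀ q, q ≠ c → ∀ σ, x.cons a (e q) *ᵥ slice (W Ψ') a (e q) σ = 0 := by
        intro q hq σ
        rw [S2 Ψ' σ q hq]
        exact ((h2 q hq _).1 (H c q hq.symm (σ ∘ e))).1 (σ b)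
      have hB : ∀ q, q ≠ c → ∀ σ, x.cons b (e q) *ᵥ slice (W Ψ') b (e q) σ = 0 := by
        intro q hq σ
        rw [S3 Ψ' σ q hq]
        exact ((h2 q hq _).1 (H c q hq.symm (σ ∘ e))).2.1 (σ a)
      have hAB : ∀ σ, x.cons a b *ᵥ slice (W Ψ') a b σ = 0 := by
        intro σ
        rw [S4 Ψ' σ]
        have := ((h2 d hdc _).1 (H c d hdc.symm (σ ∘ e))).2.2 ((σ ∘ e) d)
        simpa only [slice, Function.update_comm hdc.symm, Function.update_eq_self] using this
      have hE : ∀ p q, p ≠ q → ∀ σ, x.cons (e p) (e q) *ᵥ slice (W Ψ') (e p) (e q) σ = 0 := by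
        intro p q hpq σ
        by_cases hp : p = c
        · subst hp
          rw [hec]
          exact hA q hpq.symm σ
        by_cases hq : q = c
        · subst hq
          rw [x.cons_mulVec_slice_swap (fun h => hpq (he h).symm), hec]
          exact hA p hpq σ
        rw [S1 Ψ' σ p q hpq hp hq, mulVec_sum_smul]
        funext r
        simp [(h1 p q hpq hp hq _).1 (H p q hpq _)]
      have hBE : ∀ q σ, x.cons b (e q) *ᵥ slice (W Ψ') b (e q) σ = 0 := by
        intro q σ
        by_cases hq : q = c
        · subst hq
          rw [hec, x.cons_mulVec_slice_swap hab.ne]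
          exact hAB σ
        · exact hB q hq σ
      intro g h hgh σ
      by_cases hg : g = b
      · subst hg
        obtain ⟨q, rfl⟩ := hcov h hgh.symm
        exact hBE q σ
      obtain ⟨p, rfl⟩ := hcov g hg
      by_cases hh : h = b
      · subst hh
        rw [x.cons_mulVec_slice_swap (hbr p)]
        exact hBE p σ
      obtain ⟨q, rfl⟩ := hcov h hh
      exact hE p q (fun h => hgh (congrArg e h)) σ
  intro Ψ
  rw [x.isSA_iff]
  constructor
  · rintro ⟨hΨ0, hΨ⟩
    -- `Ψ'` is obtained from `Ψ` by a left inverse of `V` on the qubits `a`, `b`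
    obtain ⟨U, hU⟩ := LinearMap.exists_leftInverse_of_injective V.mulVecLin
      (LinearMap.ker_eq_bot.2 hV)
    have hVU : ∀ v, x.cons a b *ᵥ v = 0 → V.mulVec (U v) = v := by
      intro v hv
      obtain ⟨u, rfl⟩ := hker v hv
      exact congrArg V.mulVec (LinearMap.congr_fun hU u)
    choose ext h3 h4 h5 using fun ρ => hlift ρ (0, 0)
    let Ψ' : QVec m := fun ρ => U (slice Ψ a b (ext ρ)) (ρ c)
    have hs : ∀ σ s, slice Ψ a b (ext (Function.update (σ ∘ e) c s)) = slice Ψ a b σ := by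
      intro σ s
      funext τ
      unfold slice
      congr 1
      funext g
      by_cases hg : g = b
      · subst hg; simp
      rw [Function.update_of_ne hg, Function.update_of_ne hg]
      obtain ⟨p, rfl⟩ := hcov g hg
      by_cases hp : p = c
      · subst hp; rw [hec]; simp
      have hpa : e p ≠ a := (hac p hp).symm
      rw [Function.update_of_ne hpa, Function.update_of_ne hpa]
      have := congrFun (h5 (Function.update (σ ∘ e) c s)) p
      simpa [hp] using this
    have hW : Ψ = W Ψ' := by
      funext σ
      have := congrFun (hVU _ (hΨ a b hab.ne σ)) (σ a, σ b)
      rw [slice_apply_self] at this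
      rw [← this]
      simp only [W, Ψ', mulVec, dotProduct, hs, Function.update_self]
    refine ⟨Ψ', y.isSA_iff.2 ⟨?_, ?_⟩, hW⟩
    · rwa [hW, Ne, hW0] at hΨ0
    · rw [hW] at hΨ
      exact (hcore Ψ').1 hΨ
  · rintro ⟨Ψ', hΨ', hW⟩
    change Ψ = W Ψ' at hW
    rw [y.isSA_iff] at hΨ'
    subst hW
    exact ⟨by rw [Ne, hW0]; exact hΨ'.1, (hcore Ψ').2 hΨ'.2⟩

/-- The instance on the qubits other than `a`, `b` whose constraints are those of `x`, with those
that involve `a` or `b` contracted with the state `φ` of this pair. A contracted constraint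
concerns a single qubit, and is imposed at all the pairs this qubit belongs to; by `hm` there is
such a pair. -/
theorem eliminatesTo_of {x : Instance n} {y : Instance m} {a b : Fin n} (hab : a < b)
    {φ : Fin 2 × Fin 2 → ℂ} {e : Fin m → Fin n} (hm : ∀ p : Fin m, ∃ q, p ≠ q)
    (hφ : φ ≠ 0) (hφab : x.cons a b *ᵥ φ = 0)
    (hker : ∀ v, x.cons a b *ᵥ v = 0 → ∃ k : ℂ, v = k • φ)
    (he : Function.Injective e) (hrange : Set.range e = {a, b}ᶜ)
    (h : ∀ p q, p ≠ q → ∀ v, y.cons p q *ᵥ v = 0 ↔ x.cons (e p) (e q) *ᵥ v = 0 ∧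
      (∀ j, (∀ i₂, x.cons a (e p) *ᵥ (fun τ => φ (τ.1, i₂) * v (τ.2, j)) = 0) ∧
        ∀ i₁, x.cons b (e p) *ᵥ (fun τ => φ (i₁, τ.1) * v (τ.2, j)) = 0) ∧
      ∀ i, (∀ i₂, x.cons a (e q) *ᵥ (fun τ => φ (τ.1, i₂) * v (i, τ.2)) = 0) ∧
        ∀ i₁, x.cons b (e q) *ᵥ (fun τ => φ (i₁, τ.1) * v (i, τ.2)) = 0) :
    EliminatesTo x y a b := by
  refine ⟨φ, e, hφ, by rwa [x.cons_of_lt hab] at hφab, he, hrange, ?_⟩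
  have hnot : ∀ p, e p ≠ a ∧ e p ≠ b := fun p => by
    have : e p ∈ ({a, b}ᶜ : Set (Fin n)) := hrange ▸ Set.mem_range_self p
    simpa using this
  have ha : ∀ p, a ≠ e p := fun p => (hnot p).1.symm
  have hb : ∀ p, b ≠ e p := fun p => (hnot p).2.symm
  have han : a ∉ Set.range e := by rintro ⟨p, hp⟩; exact (hnot p).1 hp
  have hbn : b ∉ Set.range e := by rintro ⟨p, hp⟩; exact (hnot p).2 hp
  have hcov : ∀ g, g ≠ a → g ≠ b → ∃ p, e p = g := fun g hg hg' => by
    have : g ∈ Set.range e := by rw [hrange]; simp [hg, hg']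
    exact this
  have hlift : ∀ (ρ : Fin m → Fin 2) (τ : Fin 2 × Fin 2), ∃ σ : Fin n → Fin 2,
      σ a = τ.1 ∧ σ b = τ.2 ∧ σ ∘ e = ρ := by
    intro ρ τ
    refine ⟨Function.extend e ρ fun g => if g = a then τ.1 else τ.2, ?_, ?_, ?_⟩
    · rw [Function.extend_apply' _ _ _ fun ⟨p, hp⟩ => (hnot p).1 hp, if_pos rfl]
    · rw [Function.extend_apply' _ _ _ fun ⟨p, hp⟩ => (hnot p).2 hp, if_neg hab.ne']
    · funext p; exact he.extend_apply _ _ p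
  let W : QVec m → QVec n := fun Ψ' σ => φ (σ a, σ b) * Ψ' (σ ∘ e)
  obtain ⟨τ₀, hτ₀⟩ := Function.ne_iff.1 hφ
  have hτ₀' : φ τ₀ ≠ 0 := hτ₀
  -- the slices of `φ_{ab} ⊗ Ψ'`
  have S1 : ∀ (Ψ' : QVec m) (σ : Fin n → Fin 2) (p q : Fin m),
      slice (W Ψ') (e p) (e q) σ = φ (σ a, σ b) • slice Ψ' p q (σ ∘ e) := by
    intro Ψ' σ p q
    funext τ
    simp only [slice, W, update_update_comp he, Function.update_of_ne (ha _),
      Function.update_of_ne (hb _), Pi.smul_apply, smul_eq_mul]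
  have S2 : ∀ (Ψ' : QVec m) (σ : Fin n → Fin 2) (q : Fin m),
      slice (W Ψ') a (e q) σ = fun τ => φ (τ.1, σ b) * Ψ' (Function.update (σ ∘ e) q τ.2) := by
    intro Ψ' σ q
    funext τ
    simp only [slice, W, Function.update_comp_eq_of_injective _ he,
      Function.update_comp_eq_of_notMem_range _ _ han, Function.update_of_ne (ha _),
      Function.update_of_ne (hb _), Function.update_of_ne hab.ne', Function.update_self]
  have S3 : ∀ (Ψ' : QVec m) (σ : Fin n → Fin 2) (q : Fin m),
      slice (W Ψ') b (e q) σ = fun τ => φ (σ a, τ.1) * Ψ' (Function.update (σ ∘ e) q τ.2) := by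
    intro Ψ' σ q
    funext τ
    simp only [slice, W, Function.update_comp_eq_of_injective _ he,
      Function.update_comp_eq_of_notMem_range _ _ hbn, Function.update_of_ne (ha _),
      Function.update_of_ne (hb _), Function.update_of_ne hab.ne, Function.update_self]
  have S4 : ∀ (Ψ' : QVec m) (σ : Fin n → Fin 2), slice (W Ψ') a b σ = Ψ' (σ ∘ e) • φ := by
    intro Ψ' σ
    funext τ
    simp only [slice, W, Function.update_of_ne hab.ne, Function.update_self,
      Function.update_comp_eq_of_notMem_range _ _ hbn,
      Function.update_comp_eq_of_notMem_range _ _ han, Pi.smul_apply, smul_eq_mul]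
    exact mul_comm _ _
  have hW0 : ∀ Ψ', W Ψ' = 0 ↔ Ψ' = 0 := by
    intro Ψ'
    constructor
    · intro h
      funext ρ
      obtain ⟨σ, h3, h4, h5⟩ := hlift ρ τ₀
      have := congrFun h σ
      simp only [W, h3, h4, h5, Pi.zero_apply, mul_eq_zero] at this
      exact this.resolve_left hτ₀'
    · rintro rfl
      funext σ
      simp [W]
  have hcore : ∀ Ψ', (∀ g h, g ≠ h → ∀ σ, x.cons g h *ᵥ slice (W Ψ') g h σ = 0) ↔
      ∀ p q, p ≠ q → ∀ ρ, y.cons p q *ᵥ slice Ψ' p q ρ = 0 := by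
    intro Ψ'
    constructor
    · intro H p q hpq ρ
      have hC : ∀ r ρ, (∀ i₂, x.cons a (e r) *ᵥ
            (fun τ => φ (τ.1, i₂) * Ψ' (Function.update ρ r τ.2)) = 0) ∧
          ∀ i₁, x.cons b (e r) *ᵥ
            (fun τ => φ (i₁, τ.1) * Ψ' (Function.update ρ r τ.2)) = 0 := by
        intro r ρ
        refine ⟨fun i₂ => ?_, fun i₁ => ?_⟩
        · obtain ⟨σ, -, h4, h5⟩ := hlift ρ (0, i₂)
          have := H a (e r) (ha r) σ
          rwa [S2, h4, h5] at this
        · obtain ⟨σ, h3, -, h5⟩ := hlift ρ (i₁, 0)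
          have := H b (e r) (hb r) σ
          rwa [S3, h3, h5] at this
      refine (h p q hpq _).2 ⟨?_, fun j => ?_, fun i => ?_⟩
      · obtain ⟨σ, h3, h4, h5⟩ := hlift ρ τ₀
        have := H (e p) (e q) (fun h => hpq (he h)) σ
        rw [S1, h3, h4, h5, mulVec_smul] at this
        exact (smul_eq_zero.1 this).resolve_left hτ₀'
      · simpa only [slice, Function.update_comm hpq.symm] using hC p (Function.update ρ q j)
      · exact hC q (Function.update ρ p i)
    · intro H
      have hC : ∀ r ρ, (∀ i₂, x.cons a (e r) *ᵥ
            (fun τ => φ (τ.1, i₂) * Ψ' (Function.update ρ r τ.2)) = 0) ∧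
          ∀ i₁, x.cons b (e r) *ᵥ
            (fun τ => φ (i₁, τ.1) * Ψ' (Function.update ρ r τ.2)) = 0 := by
        intro r ρ
        obtain ⟨q, hq⟩ := hm r
        have := ((h r q hq _).1 (H r q hq ρ)).2.1 (ρ q)
        simpa only [slice, Function.update_comm hq, Function.update_eq_self] using this
      have hA : ∀ q σ, x.cons a (e q) *ᵥ slice (W Ψ') a (e q) σ = 0 := fun q σ => by
        rw [S2]; exact (hC q _).1 _
      have hB : ∀ q σ, x.cons b (e q) *ᵥ slice (W Ψ') b (e q) σ = 0 := fun q σ => by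
        rw [S3]; exact (hC q _).2 _
      have hAB : ∀ σ, x.cons a b *ᵥ slice (W Ψ') a b σ = 0 := fun σ => by
        rw [S4, mulVec_smul, hφab, smul_zero]
      intro g h' hgh σ
      by_cases hga : g = a
      · subst hga
        by_cases hhb : h' = b
        · subst hhb; exact hAB σ
        · obtain ⟨q, rfl⟩ := hcov h' hgh.symm hhb
          exact hA q σ
      by_cases hgb : g = b
      · subst hgb
        by_cases hha : h' = a
        · subst hha
          rw [x.cons_mulVec_slice_swap hab.ne]
          exact hAB σ
        · obtain ⟨q, rfl⟩ := hcov h' hha hgh.symm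
          exact hB q σ
      obtain ⟨p, rfl⟩ := hcov g hga hgb
      by_cases hha : h' = a
      · subst hha
        rw [x.cons_mulVec_slice_swap (ha p)]
        exact hA p σ
      by_cases hhb : h' = b
      · subst hhb
        rw [x.cons_mulVec_slice_swap (hb p)]
        exact hB p σ
      obtain ⟨q, rfl⟩ := hcov h' hha hhb
      have hpq : p ≠ q := fun h => hgh (congrArg e h)
      rw [S1, mulVec_smul, ((h p q hpq _).1 (H p q hpq _)).1, smul_zero]
  intro Ψ
  rw [x.isSA_iff]
  constructor
  · rintro ⟨hΨ0, hΨ⟩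
    choose ext h3 h4 h5 using fun ρ => hlift ρ τ₀
    -- `τ₀` is a component at which `φ` does not vanish
    let Ψ' : QVec m := fun ρ => Ψ (ext ρ) / φ τ₀
    have hs : ∀ σ, Ψ (ext (σ ∘ e)) = slice Ψ a b σ τ₀ := by
      intro σ
      unfold slice
      congr 1
      funext g
      by_cases hgb : g = b
      · subst hgb; simp [h4]
      rw [Function.update_of_ne hgb]
      by_cases hga : g = a
      · subst hga; simp [h3]
      rw [Function.update_of_ne hga]
      obtain ⟨p, rfl⟩ := hcov g hga hgb
      exact congrFun (h5 (σ ∘ e)) p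
    have hW : Ψ = W Ψ' := by
      funext σ
      obtain ⟨k, hk⟩ := hker _ (hΨ a b hab.ne σ)
      simp only [W, Ψ', hs, hk, Pi.smul_apply, smul_eq_mul]
      rw [← slice_apply_self Ψ a b σ, hk]
      simp only [Pi.smul_apply, smul_eq_mul]
      field_simp
    refine ⟨Ψ', y.isSA_iff.2 ⟨?_, ?_⟩, hW⟩
    · rwa [hW, Ne, hW0] at hΨ0
    · rw [hW] at hΨ
      exact (hcore Ψ').1 hΨ
  · rintro ⟨Ψ', hΨ', hW⟩
    change Ψ = W Ψ' at hW
    rw [y.isSA_iff] at hΨ'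
    subst hW
    exact ⟨by rw [Ne, hW0]; exact hΨ'.1, (hcore Ψ').2 hΨ'.2⟩

end Instance

end Reductions

/-! ### Program logic -/

namespace Program

/-- A bound on the running time under the assumption that no execution of a loop makes more than `N`
turns. For a branching the two branches are added up. -/
def bound (N : ℕ) : Program → ℕ
  | skip => 1
  | setInt _ i e => i.cost + e.cost + 1
  | setNum _ i e => i.cost + e.cost + 1
  | seq p q => p.bound N + q.bound N
  | ite t p q => t.cost + (p.bound N + q.bound N)
  | loop t p => N * (t.cost + p.bound N) + t.cost

/-- The nesting depth of the loops. -/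
def depth : Program → ℕ
  | skip => 0
  | setInt _ _ _ => 0
  | setNum _ _ _ => 0
  | seq p q => max p.depth q.depth
  | ite _ p q => max p.depth q.depth
  | loop _ p => p.depth + 1

theorem exists_bound_le (p : Program) : ∃ K, ∀ N, p.bound N ≤ K * (N + 1) ^ p.depth := by
  have two : ∀ {p q : Program} {K L : ℕ} (N : ℕ), p.bound N ≤ K * (N + 1) ^ p.depth →
      q.bound N ≤ L * (N + 1) ^ q.depth →
      p.bound N + q.bound N ≤ (K + L) * (N + 1) ^ max p.depth q.depth := by
    intro p q K L N hp hq
    rw [add_mul]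
    exact add_le_add
      (hp.trans (Nat.mul_le_mul_left _ (Nat.pow_le_pow_right N.succ_pos (le_max_left _ _))))
      (hq.trans (Nat.mul_le_mul_left _ (Nat.pow_le_pow_right N.succ_pos (le_max_right _ _))))
  induction p with
  | skip => exact ⟨1, fun N => by simp [bound, depth]⟩
  | setInt arr i e => exact ⟨i.cost + e.cost + 1, fun N => by simp [bound, depth]⟩
  | setNum arr i e => exact ⟨i.cost + e.cost + 1, fun N => by simp [bound, depth]⟩
  | seq p q hp hq =>
    obtain ⟨K, hK⟩ := hp
    obtain ⟨L, hL⟩ := hq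
    exact ⟨K + L, fun N => two N (hK N) (hL N)⟩
  | ite t p q hp hq =>
    obtain ⟨K, hK⟩ := hp
    obtain ⟨L, hL⟩ := hq
    refine ⟨t.cost + (K + L), fun N => ?_⟩
    rw [add_mul]
    exact add_le_add (Nat.le_mul_of_pos_right _ (by positivity)) (two N (hK N) (hL N))
  | loop t p hp =>
    obtain ⟨K, hK⟩ := hp
    refine ⟨2 * t.cost + K, fun N => ?_⟩
    have h1 : 1 ≤ (N + 1) ^ p.depth := Nat.one_le_pow _ _ N.succ_pos
    have h2 := hK N
    simp only [bound, depth, pow_succ]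
    nlinarith [Nat.mul_le_mul_left N h2, Nat.mul_le_mul_left (N * t.cost) h1,
      Nat.mul_le_mul_left t.cost h1, Nat.zero_le (K * (N + 1) ^ p.depth),
      Nat.zero_le (N * t.cost * (N + 1) ^ p.depth)]

end Program

/-- Total correctness with a time bound: started in `s`, the program `p` halts in a memory that
satisfies `Q`, after at most `p.bound N` steps and within the word bound `W`. -/
def Does (W N : ℕ) (p : Program) (s : Memory) (Q : Memory → Prop) : Prop :=
  ∃ t s', Runs W p s t s' ∧ t ≤ p.bound N ∧ Q s'

section Logic

variable {W N : ℕ} {s : Memory} {Q R : Memory → Prop} {p q : Program}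

theorem Does.mono (h : Does W N p s Q) (hQ : ∀ s', Q s' → R s') : Does W N p s R := by
  obtain ⟨t, s', h1, h2, h3⟩ := h
  exact ⟨t, s', h1, h2, hQ s' h3⟩

theorem does_skip (h : Q s) : Does W N .skip s Q := ⟨1, s, .skip s, le_rfl, h⟩

theorem does_setInt {arr : ℕ} {i e : IExp} (hi : i.fits W s) (he : e.fits W s)
    (h : Q (s.setInt arr (i.eval s) (e.eval s))) : Does W N (.setInt arr i e) s Q :=
  ⟨_, _, .setInt s arr i e hi he, le_rfl, h⟩

theorem does_setNum {arr : ℕ} {i : IExp} {e : NExp} (hi : i.fits W s) (he : e.fits W s)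
    (h : Q (s.setNum arr (i.eval s) (e.eval s))) : Does W N (.setNum arr i e) s Q :=
  ⟨_, _, .setNum s arr i e hi he, le_rfl, h⟩

theorem Does.seq (hp : Does W N p s Q) (hq : ∀ s', Q s' → Does W N q s' R) :
    Does W N (.seq p q) s R := by
  obtain ⟨t, s', h1, h2, h3⟩ := hp
  obtain ⟨t', s'', h4, h5, h6⟩ := hq s' h3
  exact ⟨_, _, .seq h1 h4, add_le_add h2 h5, h6⟩

theorem does_ite {c : Test} (hf : c.fits W s) (hp : c.holds s → Does W N p s Q)
    (hq : ¬ c.holds s → Does W N q s Q) : Does W N (.ite c p q) s Q := by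
  by_cases hc : c.holds s
  · obtain ⟨t, s', h1, h2, h3⟩ := hp hc
    exact ⟨_, _, .iteTrue hf hc h1, Nat.add_le_add_left (h2.trans (Nat.le_add_right _ _)) _, h3⟩
  · obtain ⟨t, s', h1, h2, h3⟩ := hq hc
    exact ⟨_, _, .iteFalse hf hc h1, Nat.add_le_add_left (h2.trans (Nat.le_add_left _ _)) _, h3⟩

end Logic

/-! ### Registers -/

namespace Memory

variable (s : Memory) (arr i v : ℕ) (z : ℂ)

@[simp] theorem setInt_nums : (s.setInt arr i v).nums = s.nums := rfl
@[simp] theorem setNum_ints : (s.setNum arr i z).ints = s.ints := rfl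
@[simp] theorem setInt_ints_self : (s.setInt arr i v).ints arr i = v := by simp [setInt]
@[simp] theorem setInt_ints_of_ne {k : ℕ} (h : k ≠ arr) :
    (s.setInt arr i v).ints k = s.ints k := by simp [setInt, h]
@[simp] theorem setNum_nums_self : (s.setNum arr i z).nums arr i = z := by simp [setNum]
@[simp] theorem setNum_nums_of_ne {k : ℕ} (h : k ≠ arr) :
    (s.setNum arr i z).nums k = s.nums k := by simp [setNum, h]
theorem setNum_nums_self_of_ne {j : ℕ} (h : j ≠ i) :
    (s.setNum arr i z).nums arr j = s.nums arr j := by simp [setNum, h]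

end Memory

/-- The register `r`: the first cell of the integer array `r`. The programs use the registers
* `0`: the number of qubits; `1`: the status;
* `2`: the rank of the pair that has been found, or `0`; `3`, `4`: this pair;
* `5`, `6`, `7`: loop counters;
* `8`, `9`, `10`, `16`, `17`: addresses of blocks to be read; `12`: address of the block to be
  written;
* `11`: the number of qubits of the new instance; `13`, `14`: old names of qubits of the new
  instance;
* `15`: the address `0`.

While product states are computed, `10` and `11` are the addresses of one-qubit vectors. The
arrays of complex numbers hold
* `0`: the instance; `1`: the one-qubit vectors of a product state;
* `2`: a copy of the instance in which the projectors are stored for both orders of the qubits;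
* `3`: the residual of a tensor and its square norm; `4`, `5`: two tensors to be composed;
* `6`, `7`: the columns of the embedding of a logical qubit, or in `6` the state of an eliminated
  pair;
* `8`: an auxiliary projector.
-/
abbrev reg (r : ℕ) : IExp := .get r (.lit 0)

abbrev setReg (r : ℕ) (e : IExp) : Program := .setInt r (.lit 0) e

theorem does_setReg {W N r : ℕ} {s : Memory} {e : IExp} {Q : Memory → Prop} (he : e.fits W s)
    (h : Q (s.setInt r 0 (e.eval s))) : Does W N (setReg r e) s Q :=
  does_setInt (Nat.zero_le _) he h

namespace Test

def lt (e f : IExp) : Test := .le (.add e (.lit 1)) f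

def eqI (e f : IExp) : Test := .and (.le e f) (.le f e)

variable {W : ℕ} {s : Memory} {e f : IExp}

@[simp] theorem lt_holds : (lt e f).holds s ↔ e.eval s < f.eval s := Iff.rfl
@[simp] theorem eqI_holds : (eqI e f).holds s ↔ e.eval s = f.eval s := le_antisymm_iff.symm
theorem lt_fits (he : e.fits W s) (hf : f.fits W s) (h : e.eval s + 1 ≤ W) :
    (lt e f).fits W s :=
  ⟨⟨he, (Nat.le_add_left _ _).trans h, h⟩, hf⟩
theorem eqI_fits (he : e.fits W s) (hf : f.fits W s) : (eqI e f).fits W s := ⟨⟨he, hf⟩, hf, he⟩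

end Test

/-! ### Counting loops -/

/-- `for (i = 0; i < r; i++) body`, for registers `i` and `r`. -/
def forLoop (i r : ℕ) (body : Program) : Program :=
  .seq (setReg i (.lit 0))
    (.loop (.lt (reg i) (reg r)) (.seq body (setReg i (.add (reg i) (.lit 1)))))

/-- The loop rule for an invariant `I` that does not depend on the loop counter `i`. -/
theorem does_forLoop {W N B i r : ℕ} {body : Program} {s : Memory} (I : ℕ → Memory → Prop)
    (hN : B ≤ N) (hW : B + 1 ≤ W) (hr : ∀ j s, I j s → s.ints r 0 = B)
    (hI : ∀ j s v, I j s → I j (s.setInt i 0 v))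
    (hb : ∀ j < B, ∀ s, I j s → s.ints i 0 = j →
      Does W N body s fun s' => I (j + 1) s' ∧ s'.ints i 0 = j)
    (h0 : I 0 s) : Does W N (forLoop i r body) s (I B) := by
  refine (does_setReg (Q := fun s => I 0 s ∧ s.ints i 0 = 0) (Nat.zero_le _)
    ⟨hI _ _ _ h0, by simp [IExp.eval]⟩).seq ?_
  rintro s ⟨h0, hi⟩
  have hfit : ∀ s j, I j s → j ≤ B → s.ints i 0 = j → (Test.lt (reg i) (reg r)).fits W s := by
    intro s j hj hjB hij
    have := hr j s hj
    refine Test.lt_fits ⟨Nat.zero_le _, ?_⟩ ⟨Nat.zero_le _, ?_⟩ ?_ <;>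
      simp only [IExp.eval] <;> omega
  have key : ∀ d j s, j + d = B → I j s → s.ints i 0 = j →
      ∃ t s', Runs W (.loop (.lt (reg i) (reg r)) (.seq body (setReg i (.add (reg i) (.lit 1))))) s
        t s' ∧ t ≤ d * ((Test.lt (reg i) (reg r)).cost +
          (Program.seq body (setReg i (.add (reg i) (.lit 1)))).bound N) +
          (Test.lt (reg i) (reg r)).cost ∧ I B s' := by
    intro d
    induction d with
    | zero =>
      intro j s hjB hj hij
      have hc : ¬ (Test.lt (reg i) (reg r)).holds s := by
        rw [Test.lt_holds]
        have := hr j s hj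
        simp only [IExp.eval]
        omega
      exact ⟨_, _, .loopFalse (hfit s j hj (by omega) hij) hc, by omega,
        by rwa [← hjB, add_zero]⟩
    | succ d ih =>
      intro j s hjB hj hij
      have hc : (Test.lt (reg i) (reg r)).holds s := by
        rw [Test.lt_holds]
        have := hr j s hj
        simp only [IExp.eval]
        omega
      obtain ⟨t, s', h1, h2, h3, h4⟩ := (hb j (by omega) s hj hij).seq (R := fun s' =>
        I (j + 1) s' ∧ s'.ints i 0 = j + 1) (q := setReg i (.add (reg i) (.lit 1))) (by
          rintro s' ⟨h3, h4⟩
          refine does_setReg ⟨⟨Nat.zero_le _, ?_⟩, ?_, ?_⟩ ⟨hI _ _ _ h3, ?_⟩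
          · simp only [IExp.eval]; omega
          · change 1 ≤ W; omega
          · simp only [IExp.eval]; omega
          · simp [IExp.eval, h4])
      obtain ⟨t', s'', h5, h6, h7⟩ := ih (j + 1) s' (by omega) h3 h4
      refine ⟨_, _, .loopTrue (hfit s j hj (by omega) hij) hc h1 h5, ?_, h7⟩
      rw [add_mul, one_mul]
      omega
  obtain ⟨t, s', h1, h2, h3⟩ := key B 0 s (by omega) h0 hi
  exact ⟨t, s', h1, h2.trans (Nat.add_le_add_right (Nat.mul_le_mul_right _ hN) _), h3⟩

/-- Runs through the pairs `p < q < m`, for `m` in the register `r`, with `p` in the register `6`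
and `q` in the register `7`. -/
def forPairs (r : ℕ) (body : Program) : Program := forLoop 7 r (forLoop 6 7 body)

/-- The invariant `J` refers to the set of the pairs already visited. -/
theorem does_forPairs {W N m r : ℕ} {body : Program} {s : Memory}
    (J : Set (ℕ × ℕ) → Memory → Prop) (hN : m ≤ N) (hW : m + 1 ≤ W)
    (hr : ∀ S s, J S s → s.ints r 0 = m)
    (hJ6 : ∀ S s v, J S s → J S (s.setInt 6 0 v)) (hJ7 : ∀ S s v, J S s → J S (s.setInt 7 0 v))
    (hb : ∀ S s p q, p < q → q < m → (p, q) ∉ S → J S s → s.ints 6 0 = p → s.ints 7 0 = q →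
      Does W N body s fun s' => J (insert (p, q) S) s' ∧ s'.ints 6 0 = p ∧ s'.ints 7 0 = q)
    (h0 : J ∅ s) :
    Does W N (forPairs r body) s (J {x | x.1 < x.2 ∧ x.2 < m}) := by
  refine (does_forLoop (B := m) (fun q s => J {x | x.1 < x.2 ∧ x.2 < q} s) hN hW
    (fun _ => hr _) (fun _ => hJ7 _) ?_ ?_)
  · intro q hq s hs h7
    have := does_forLoop (W := W) (N := N) (B := q) (i := 6) (r := 7) (body := body) (s := s)
      (fun p s => J {x | x.1 < x.2 ∧ (x.2 < q ∨ x.2 = q ∧ x.1 < p)} s ∧ s.ints 7 0 = q)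
      (by omega) (by omega) (fun _ _ h => h.2)
      (fun _ s v h => ⟨hJ6 _ _ _ h.1, by simpa using h.2⟩) ?_ ⟨by simpa using hs, h7⟩
    · refine this.mono fun s' hs' => ⟨?_, hs'.2⟩
      convert hs'.1 using 1
      ext ⟨a, b⟩
      simp only [Set.mem_ofPred_eq]
      omega
    · rintro p hp s ⟨hs, h7⟩ h6
      refine (hb _ s p q hp hq (by simp) hs h6 h7).mono ?_
      rintro s' ⟨h1, h2, h3⟩
      refine ⟨⟨?_, h3⟩, h2⟩
      convert h1 using 1
      ext ⟨a, b⟩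
      simp only [Set.mem_ofPred_eq, Set.mem_insert_iff, Prod.mk.injEq]
      omega
  · convert h0 using 1
    ext ⟨a, b⟩
    simp

/-! ### Bulk assignments -/

/-- Assigns `e o` to the cell `idx o` of array `D`, for all `o` in `L`. -/
def fill {α : Type} (D : ℕ) (L : List α) (idx : α → IExp) (e : α → NExp) : Program :=
  L.foldr (fun o p => .seq (.setNum D (idx o) (e o)) p) .skip

/-- The value assigned at `o` may be computed from the cell at `o`, which is not yet overwritten
at that time, and from the cells not assigned to at all. -/
theorem does_fill {α : Type} {W N D : ℕ} {L : List α} {idx : α → IExp} {e : α → NExp}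
    {s : Memory} (pos : α → ℕ) (val : α → ℂ) (hL : L.Nodup) (hpos : Function.Injective pos)
    (H : ∀ o ∈ L, ∀ s' : Memory, s'.ints = s.ints → (∀ k ≠ D, s'.nums k = s.nums k) →
      s'.nums D (pos o) = s.nums D (pos o) →
      (∀ c, (∀ o ∈ L, c ≠ pos o) → s'.nums D c = s.nums D c) →
      ((idx o).eval s' = pos o ∧ (idx o).fits W s') ∧ (e o).eval s' = val o ∧ (e o).fits W s') :
    Does W N (fill D L idx e) s fun s' => s'.ints = s.ints ∧ (∀ k ≠ D, s'.nums k = s.nums k) ∧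
      (∀ o ∈ L, s'.nums D (pos o) = val o) ∧
      ∀ c, (∀ o ∈ L, c ≠ pos o) → s'.nums D c = s.nums D c := by
  induction L generalizing s with
  | nil => exact does_skip ⟨rfl, fun _ _ => rfl, by simp, fun _ _ => rfl⟩
  | cons a L ih =>
    obtain ⟨⟨h1, h2⟩, h3, h4⟩ := H a (by simp) s rfl (fun _ _ => rfl) rfl fun _ _ => rfl
    obtain ⟨haL, hL⟩ := List.nodup_cons.1 hL
    refine (does_setNum h2 h4 (Q := fun s' => s' = s.setNum D (pos a) (val a))
      (by rw [h1, h3])).seq ?_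
    rintro _ rfl
    refine (ih hL ?_).mono ?_
    · intro o ho s' hi hk hp hc
      have hne : pos o ≠ pos a := fun h => haL (hpos h ▸ ho)
      refine H o (by simp [ho]) s' hi (fun k hk' => by simp [hk k hk', hk']) ?_ ?_
      · rw [hp, Memory.setNum_nums_self_of_ne _ _ _ _ hne]
      · intro c hc'
        rw [hc c fun o ho => hc' o (by simp [ho]),
          Memory.setNum_nums_self_of_ne _ _ _ _ (hc' a (by simp))]
    · rintro s' ⟨h5, h6, h7, h8⟩
      refine ⟨h5, fun k hk => by simp [h6 k hk, hk], ?_, ?_⟩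
      · intro o ho
        rcases List.mem_cons.1 ho with rfl | ho
        · rw [h8 _ fun o' ho' h => haL (by rw [hpos h]; exact ho'), Memory.setNum_nums_self]
        · exact h7 o ho
      · intro c hc
        rw [h8 c fun o ho => hc o (by simp [ho]),
          Memory.setNum_nums_self_of_ne _ _ _ _ (hc a (by simp))]

/-! ### Blocks of the projector arrays -/

/-- The position of the component `τ` of a two-qubit vector. -/
def vcell (τ : Fin 2 × Fin 2) : ℕ := 2 * τ.1 + τ.2

/-- The position of a matrix entry in a block. -/
def cell (o : (Fin 2 × Fin 2) × (Fin 2 × Fin 2)) : ℕ := 4 * vcell o.1 + vcell o.2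

theorem vcell_lt (τ : Fin 2 × Fin 2) : vcell τ < 4 := by unfold vcell; omega

theorem cell_lt (o : (Fin 2 × Fin 2) × (Fin 2 × Fin 2)) : cell o < 16 := by
  unfold cell
  have := vcell_lt o.1
  have := vcell_lt o.2
  omega

theorem vcell_injective : Function.Injective vcell := by
  rintro ⟨i, j⟩ ⟨k, l⟩ h
  simp only [vcell] at h
  rw [Prod.mk.injEq]
  omega

theorem cell_injective : Function.Injective cell := by
  rintro ⟨τ, ρ⟩ ⟨τ', ρ'⟩ h
  simp only [cell] at h
  have h1 := vcell_lt τ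
  have h2 := vcell_lt τ'
  have h3 := vcell_lt ρ
  have h4 := vcell_lt ρ'
  rw [Prod.mk.injEq]
  exact ⟨vcell_injective (by omega), vcell_injective (by omega)⟩

/-- The basis of two qubits. -/
def pairs : List (Fin 2 × Fin 2) := [(0, 0), (0, 1), (1, 0), (1, 1)]

theorem mem_pairs : ∀ τ, τ ∈ pairs := by decide

theorem nodup_pairs : pairs.Nodup := by decide

theorem mem_pairs2 (o : (Fin 2 × Fin 2) × (Fin 2 × Fin 2)) : o ∈ pairs ×ˢ pairs :=
  List.mem_product.2 ⟨mem_pairs _, mem_pairs _⟩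

theorem nodup_pairs2 : (pairs ×ˢ pairs).Nodup := nodup_pairs.product nodup_pairs

/-- The matrix that is stored in the block `B` of an array, which consists of sixteen cells. -/
def blk (f : ℕ → ℂ) (B : ℕ) : TwoQubitOp := fun τ ρ => f (16 * B + cell (τ, ρ))

/-- The vector stored in the first four cells of an array. -/
def vec (f : ℕ → ℂ) : Fin 2 × Fin 2 → ℂ := fun τ => f (vcell τ)

/-- The cell of array `D` at distance `o` from the address in the register `R`. -/
def rd (D R o : ℕ) : NExp := .get D (.add (reg R) (.lit o))

/-- The component `τ` of the vector in array `D`. -/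
def vc (D : ℕ) (τ : Fin 2 × Fin 2) : NExp := .get D (.lit (vcell τ))

def sum2 (f : Fin 2 → NExp) : NExp := .add (f 0) (f 1)

def sum4 (f : Fin 2 × Fin 2 → NExp) : NExp :=
  .add (.add (f (0, 0)) (f (0, 1))) (.add (f (1, 0)) (f (1, 1)))

section Expressions

variable {W : ℕ} {s : Memory}

theorem eval_rd (D R o : ℕ) : (rd D R o).eval s = s.nums D (s.ints R 0 + o) := rfl

theorem fits_rd (D R o : ℕ) : (rd D R o).fits W s ↔ s.ints R 0 + o ≤ W := by
  simp only [rd, NExp.fits, IExp.fits, IExp.eval]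
  omega

theorem eval_vc (D : ℕ) (τ : Fin 2 × Fin 2) : (vc D τ).eval s = vec (s.nums D) τ := rfl

theorem fits_vc (hW : 3 ≤ W) (D : ℕ) (τ : Fin 2 × Fin 2) : (vc D τ).fits W s :=
  (Nat.lt_succ_iff.1 (vcell_lt τ)).trans hW

theorem eval_sum2 (f : Fin 2 → NExp) : (sum2 f).eval s = ∑ i, (f i).eval s := by
  simp [sum2, NExp.eval, Fin.sum_univ_two]

theorem fits_sum2 {f : Fin 2 → NExp} (h : ∀ i, (f i).fits W s) : (sum2 f).fits W s :=
  ⟨h 0, h 1⟩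

theorem eval_sum4 (f : Fin 2 × Fin 2 → NExp) : (sum4 f).eval s = ∑ τ, (f τ).eval s := by
  simp [sum4, NExp.eval, Fintype.sum_prod_type, Fin.sum_univ_two]

theorem fits_sum4 {f : Fin 2 × Fin 2 → NExp} (h : ∀ τ, (f τ).fits W s) : (sum4 f).fits W s :=
  ⟨⟨h _, h _⟩, h _, h _⟩

end Expressions

/-- Assigns the matrix with entries `e` to the block at `R` of array `D`. -/
def setBlk (D R : ℕ) (e : Fin 2 × Fin 2 → Fin 2 × Fin 2 → NExp) : Program :=
  fill D (pairs ×ˢ pairs) (fun o => .add (reg R) (.lit (cell o))) fun o => e o.1 o.2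

theorem does_setBlk {W N D R B : ℕ} {e : Fin 2 × Fin 2 → Fin 2 × Fin 2 → NExp} {s : Memory}
    (P : TwoQubitOp) (hR : s.ints R 0 = 16 * B) (hW : 16 * B + 15 ≤ W)
    (H : ∀ s' : Memory, s'.ints = s.ints → (∀ k ≠ D, s'.nums k = s.nums k) →
      (∀ B' ≠ B, blk (s'.nums D) B' = blk (s.nums D) B') →
      ∀ τ ρ, s'.nums D (16 * B + cell (τ, ρ)) = s.nums D (16 * B + cell (τ, ρ)) →
      (e τ ρ).eval s' = P τ ρ ∧ (e τ ρ).fits W s') :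
    Does W N (setBlk D R e) s fun s' => s'.ints = s.ints ∧ (∀ k ≠ D, s'.nums k = s.nums k) ∧
      blk (s'.nums D) B = P ∧ ∀ B' ≠ B, blk (s'.nums D) B' = blk (s.nums D) B' := by
  refine (does_fill (fun o => 16 * B + cell o) (fun o => P o.1 o.2) nodup_pairs2
    (fun o o' h => cell_injective (by simpa using h)) ?_).mono ?_
  · rintro o - s' h1 h2 h3 h4
    have := cell_lt o
    refine ⟨⟨?_, ⟨Nat.zero_le _, ?_⟩, ?_, ?_⟩, H s' h1 h2 (fun B' hB => ?_) o.1 o.2 h3⟩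
    · simp only [IExp.eval, h1, hR]
    · simp only [IExp.eval, h1, hR]; omega
    · change cell o ≤ W; omega
    · simp only [IExp.eval, h1, hR]; omega
    · ext τ ρ
      refine h4 _ fun o _ => ?_
      have := cell_lt o
      have := cell_lt (τ, ρ)
      omega
  · rintro s' ⟨h1, h2, h3, h4⟩
    refine ⟨h1, h2, ?_, fun B' hB => ?_⟩
    · ext τ ρ
      exact h3 (τ, ρ) (mem_pairs2 _)
    · ext τ ρ
      refine h4 _ fun o _ => ?_
      have := cell_lt o
      have := cell_lt (τ, ρ)
      omega

/-- Adds the tensor `w` to the projector in array `D` whose first cell is in the register `R`. -/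
def addTensorProg (D R : ℕ) (w : Fin 2 × Fin 2 → NExp) : Program :=
  .seq (fill 3 pairs (fun τ => .lit (vcell τ)) fun τ =>
      .sub (w τ) (sum4 fun ρ => .mul (w ρ) (rd D R (cell (ρ, τ)))))
    (.seq (.setNum 3 (.lit 4) (sum4 fun τ => .mul (vc 3 τ) (.conj (vc 3 τ))))
      (.ite (.eq (.get 3 (.lit 4)) (.lit 0)) .skip
        (setBlk D R fun τ ρ => .add (rd D R (cell (τ, ρ)))
          (.div (.mul (.conj (vc 3 τ)) (vc 3 ρ)) (.get 3 (.lit 4))))))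

theorem does_addTensorProg {W N D R B : ℕ} {w : Fin 2 × Fin 2 → NExp} {s : Memory}
    (v : Fin 2 × Fin 2 → ℂ) (hD : D ≠ 3) (hR : s.ints R 0 = 16 * B) (hW : 16 * B + 15 ≤ W)
    (H : ∀ s' : Memory, s'.ints = s.ints → (∀ k ≠ 3, s'.nums k = s.nums k) →
      ∀ τ, (w τ).eval s' = v τ ∧ (w τ).fits W s') :
    Does W N (addTensorProg D R w) s fun s' => s'.ints = s.ints ∧
      (∀ k, k ≠ 3 → k ≠ D → s'.nums k = s.nums k) ∧
      blk (s'.nums D) B = addTensor (blk (s.nums D) B) v ∧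
      ∀ B' ≠ B, blk (s'.nums D) B' = blk (s.nums D) B' := by
  set P := blk (s.nums D) B with hP
  set r := v - v ᵥ* P with hr
  refine (does_fill vcell r nodup_pairs vcell_injective ?_).seq ?_
  · rintro τ - s' h1 h2 - -
    have h4 := vcell_lt τ
    refine ⟨⟨rfl, ?_⟩, ?_, (H s' h1 h2 τ).2, fits_sum4 fun ρ => ⟨(H s' h1 h2 ρ).2, ?_⟩⟩
    · change vcell τ ≤ W; omega
    · simp only [NExp.eval, eval_sum4, (H s' h1 h2 _).1, eval_rd, h1, h2 D hD, hR]
      rfl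
    · have := cell_lt (ρ, τ)
      rw [fits_rd, h1, hR]; omega
  rintro s1 ⟨h1, h2, h3, -⟩
  have h3' : vec (s1.nums 3) = r := funext fun τ => h3 τ (mem_pairs τ)
  have hf : (sum4 fun τ => .mul (vc 3 τ) (.conj (vc 3 τ))).fits W s1 :=
    fits_sum4 fun τ => ⟨fits_vc (by omega) 3 τ, fits_vc (by omega) 3 τ⟩
  refine (does_setNum (Q := fun s' => s' = s1.setNum 3 4 (r ⬝ᵥ star r)) (by change 4 ≤ W; omega)
    hf ?_).seq ?_
  · rw [eval_sum4]
    simp only [NExp.eval, eval_vc, h3', IExp.eval]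
    rfl
  rintro s2 rfl
  have h5 : vec ((s1.setNum 3 4 (r ⬝ᵥ star r)).nums 3) = r := by
    rw [← h3']
    funext τ
    have := vcell_lt τ
    exact Memory.setNum_nums_self_of_ne _ _ _ _ (by omega)
  have h6 : ∀ k ≠ 3, (s1.setNum 3 4 (r ⬝ᵥ star r)).nums k = s.nums k := fun k hk => by
    rw [Memory.setNum_nums_of_ne _ _ _ _ hk, h2 k hk]
  have h4W : 4 ≤ W := by omega
  refine does_ite ⟨h4W, trivial⟩ ?_ ?_
  · intro hc
    have hc : r ⬝ᵥ star r = 0 := by simpa [Test.holds, NExp.eval, IExp.eval] using hc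
    have hr0 : v - v ᵥ* P = 0 := dotProduct_self_star_eq_zero.1 hc
    refine does_skip ⟨h1, fun k hk _ => h6 k hk, ?_, fun B' _ => ?_⟩
    · rw [h6 D hD, addTensor_of_residual_eq_zero hr0]
    · rw [h6 D hD]
  · intro hc
    have hc : r ⬝ᵥ star r ≠ 0 := by simpa [Test.holds, NExp.eval, IExp.eval] using hc
    refine (does_setBlk (B := B) (addTensor P v) (by simp [h1, hR]) hW ?_).mono ?_
    · rintro s' h7 h8 - τ ρ h9
      have e4 : s'.nums 3 4 = r ⬝ᵥ star r := by rw [h8 3 hD.symm, Memory.setNum_nums_self]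
      have ev : vec (s'.nums 3) = r := by rw [h8 3 hD.symm, h5]
      have hR' : s'.ints R 0 = 16 * B := by rw [h7]; simp [h1, hR]
      have hcl := cell_lt (τ, ρ)
      refine ⟨?_, ?_, ⟨fits_vc (by omega) 3 τ, fits_vc (by omega) 3 ρ⟩, h4W, ?_⟩
      · simp only [NExp.eval, eval_rd, eval_vc, ev, IExp.eval, e4, hR', h9, h6 D hD]
        simp only [addTensor, Matrix.add_apply, Matrix.smul_apply, vecMulVec_apply, smul_eq_mul,
          ← hr, Pi.star_apply]
        rw [div_eq_inv_mul]
        rfl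
      · rw [fits_rd, hR']; omega
      · simpa only [NExp.eval, IExp.eval, e4] using hc
    · rintro s' ⟨h7, h8, h9, h10⟩
      exact ⟨h7.trans h1, fun k hk hkD => by rw [h8 k hkD, h6 k hk], h9, fun B' hB => by
        rw [h10 B' hB, h6 D hD]⟩

/-- Adds all tensors `w x` with `x` in `L` to the projector at `R` in array `D`. -/
def addAll {α : Type} (D R : ℕ) (L : List α) (w : α → Fin 2 × Fin 2 → NExp) : Program :=
  L.foldr (fun x p => .seq (addTensorProg D R (w x)) p) .skip

theorem does_addAll {α : Type} {W N D R B : ℕ} {L : List α} {w : α → Fin 2 × Fin 2 → NExp}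
    {s : Memory} (v : α → Fin 2 × Fin 2 → ℂ) (hD : D ≠ 3) (hR : s.ints R 0 = 16 * B)
    (hW : 16 * B + 15 ≤ W)
    (H : ∀ s' : Memory, s'.ints = s.ints → (∀ k, k ≠ 3 → k ≠ D → s'.nums k = s.nums k) →
      ∀ x ∈ L, ∀ τ, (w x τ).eval s' = v x τ ∧ (w x τ).fits W s') :
    Does W N (addAll D R L w) s fun s' => s'.ints = s.ints ∧
      (∀ k, k ≠ 3 → k ≠ D → s'.nums k = s.nums k) ∧
      blk (s'.nums D) B = L.foldl (fun P x => addTensor P (v x)) (blk (s.nums D) B) ∧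
      ∀ B' ≠ B, blk (s'.nums D) B' = blk (s.nums D) B' := by
  induction L generalizing s with
  | nil => exact does_skip ⟨rfl, fun _ _ _ => rfl, rfl, fun _ _ => rfl⟩
  | cons a L ih =>
    refine (does_addTensorProg (v a) hD hR hW fun s' h1 h2 τ =>
      H s' h1 (fun k hk _ => h2 k hk) a (by simp) τ).seq ?_
    rintro s1 ⟨h1, h2, h3, h4⟩
    refine (ih (by rw [h1, hR]) fun s' h5 h6 x hx τ => H s' (h5.trans h1)
      (fun k hk hkD => by rw [h6 k hk hkD, h2 k hk hkD]) x (by simp [hx]) τ).mono ?_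
    rintro s' ⟨h5, h6, h7, h8⟩
    refine ⟨h5.trans h1, fun k hk hkD => by rw [h6 k hk hkD, h2 k hk hkD], ?_, fun B' hB => by
      rw [h8 B' hB, h4 B' hB]⟩
    rw [h7, h3, List.foldl_cons]

/-! ### Selection of a nonzero vector -/

/-- All `f k` with `k` in `K` are zero. -/
def zeroTest {κ : Type} (K : List κ) (f : κ → NExp) : Test :=
  K.foldr (fun k t => .and (.eq (f k) (.lit 0)) t) (.le (.lit 0) (.lit 0))

theorem zeroTest_holds {κ : Type} (K : List κ) (f : κ → NExp) (s : Memory) :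
    (zeroTest K f).holds s ↔ ∀ k ∈ K, (f k).eval s = 0 := by
  induction K with
  | nil => simp [zeroTest, Test.holds]
  | cons k K ih =>
    rw [List.forall_mem_cons, ← ih]
    simp [zeroTest, Test.holds, NExp.eval]

theorem zeroTest_fits {κ : Type} {W : ℕ} (K : List κ) {f : κ → NExp} {s : Memory}
    (h : ∀ k ∈ K, (f k).fits W s) : (zeroTest K f).fits W s := by
  induction K with
  | nil => simp [zeroTest, Test.fits, IExp.fits]
  | cons k K ih =>
    exact ⟨⟨h k (by simp), trivial⟩, ih fun k hk => h k (by simp [hk])⟩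

/-- Overwrites the vector at the cells `idx` of array `D` by the last nonzero one of the vectors
`f x`, if there is any. -/
def pick {α κ : Type} (D : ℕ) (K : List κ) (idx : κ → IExp) (L : List α) (f : α → κ → NExp) :
    Program :=
  L.foldr (fun x p => .seq (.ite (zeroTest K (f x)) .skip (fill D K idx (f x))) p) .skip

theorem does_pick {α κ : Type} {W N D : ℕ} {K : List κ} {idx : κ → IExp} {L : List α}
    {f : α → κ → NExp} {s : Memory} (pos : κ → ℕ) (v : α → κ → ℂ) (hK : ∀ k, k ∈ K)
    (hKn : K.Nodup) (hpos : Function.Injective pos)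
    (H : ∀ s' : Memory, s'.ints = s.ints → (∀ k ≠ D, s'.nums k = s.nums k) →
      (∀ c, (∀ k, c ≠ pos k) → s'.nums D c = s.nums D c) →
      ∀ x ∈ L, ∀ k, ((idx k).eval s' = pos k ∧ (idx k).fits W s') ∧
        (f x k).eval s' = v x k ∧ (f x k).fits W s') :
    Does W N (pick D K idx L f) s fun s' => s'.ints = s.ints ∧ (∀ k ≠ D, s'.nums k = s.nums k) ∧
      (∀ c, (∀ k, c ≠ pos k) → s'.nums D c = s.nums D c) ∧
      ((∃ x ∈ L, v x ≠ 0 ∧ ∀ k, s'.nums D (pos k) = v x k) ∨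
        (∀ x ∈ L, v x = 0) ∧ ∀ k, s'.nums D (pos k) = s.nums D (pos k)) := by
  induction L generalizing s with
  | nil => exact does_skip ⟨rfl, fun _ _ => rfl, fun _ _ => rfl, .inr ⟨by simp, fun _ => rfl⟩⟩
  | cons a L ih =>
    have h0 := H s rfl (fun _ _ => rfl) (fun _ _ => rfl) a (by simp)
    refine Does.seq (Q := fun s' => s'.ints = s.ints ∧ (∀ k ≠ D, s'.nums k = s.nums k) ∧
      (∀ c, (∀ k, c ≠ pos k) → s'.nums D c = s.nums D c) ∧
      ((v a ≠ 0 ∧ ∀ k, s'.nums D (pos k) = v a k) ∨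
        v a = 0 ∧ ∀ k, s'.nums D (pos k) = s.nums D (pos k))) ?_ ?_
    · refine does_ite (zeroTest_fits K fun k _ => (h0 k).2.2) ?_ ?_
      · intro hz
        rw [zeroTest_holds] at hz
        refine does_skip ⟨rfl, fun _ _ => rfl, fun _ _ => rfl, .inr ⟨funext fun k => ?_,
          fun _ => rfl⟩⟩
        rw [← (h0 k).2.1]
        exact hz k (hK k)
      · intro hz
        rw [zeroTest_holds] at hz
        refine (does_fill pos (v a) hKn hpos ?_).mono ?_
        · intro k _ s' h1 h2 _ h3
          exact H s' h1 h2 (fun c hc => h3 c fun o _ => hc o) a (by simp) k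
        · rintro s' ⟨h1, h2, h3, h4⟩
          refine ⟨h1, h2, fun c hc => h4 c fun o _ => hc o, .inl ⟨fun hv => hz fun k _ => ?_,
            fun k => h3 k (hK k)⟩⟩
          rw [(h0 k).2.1, hv]; rfl
    · rintro s1 ⟨h1, h2, h3, h4⟩
      refine (ih fun s' h5 h6 h7 x hx k => H s' (h5.trans h1)
        (fun k hk => by rw [h6 k hk, h2 k hk]) (fun c hc => by rw [h7 c hc, h3 c hc]) x
        (by simp [hx]) k).mono ?_
      rintro s' ⟨h5, h6, h7, h8⟩
      refine ⟨h5.trans h1, fun k hk => by rw [h6 k hk, h2 k hk],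
        fun c hc => by rw [h7 c hc, h3 c hc], ?_⟩
      rcases h8 with ⟨x, hx, hv, h8⟩ | ⟨hL, h8⟩
      · exact .inl ⟨x, by simp [hx], hv, h8⟩
      · rcases h4 with ⟨hv, h4⟩ | ⟨hv, h4⟩
        · exact .inl ⟨a, by simp, hv, fun k => by rw [h8, h4]⟩
        · exact .inr ⟨by simpa [hv] using hL, fun k => by rw [h8, h4]⟩

/-! ### The symmetric copy of the instance -/

theorem block_index_lt {m p q : ℕ} (hp : p < m) (hq : q < m) : m * p + q + 1 ≤ m * m := by
  nlinarith [Nat.mul_le_mul_left m (Nat.succ_le_of_lt hp)]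

theorem block_index_inj {m p q p' q' : ℕ} (hq : q < m) (hq' : q' < m)
    (h : m * p + q = m * p' + q') : p = p' ∧ q = q' := by
  have hm : 0 < m := by omega
  have h1 : (m * p + q) / m = p := by
    rw [Nat.mul_add_div hm, Nat.div_eq_of_lt hq, add_zero]
  have h2 : (m * p' + q') / m = p' := by
    rw [Nat.mul_add_div hm, Nat.div_eq_of_lt hq', add_zero]
  have h3 : p = p' := by rw [← h1, h, h2]
  subst h3
  exact ⟨rfl, by omega⟩

/-- The word bound suffices for all index computations on instances with up to `n` qubits. -/
def Roomy (W n : ℕ) : Prop := 16 * (n * n) + 3 * n + 40 ≤ W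

theorem Roomy.block {W n m p q : ℕ} (hW : Roomy W n) (hm : m ≤ n) (hp : p < m) (hq : q < m) :
    16 * (m * p + q) + 15 ≤ W := by
  have h1 := block_index_lt hp hq
  have h2 := Nat.mul_le_mul hm hm
  unfold Roomy at hW
  omega

theorem Roomy.le {W n : ℕ} (hW : Roomy W n) : 3 * n + 40 ≤ W := by unfold Roomy at hW; omega

theorem fits_reg {W k : ℕ} {s : Memory} (h : s.ints k 0 ≤ W) : (reg k).fits W s :=
  ⟨Nat.zero_le _, h⟩

/-- `R := 16 * (r * u + v)`, the first cell of the block of the pair `u`, `v` in an array with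
stride `r`; all of these are registers. -/
def setBase (R r u v : ℕ) : Program :=
  setReg R (.mul (.lit 16) (.add (.mul (reg r) (reg u)) (reg v)))

theorem does_setBase {W N R r u v n m p q : ℕ} {s : Memory}
    (hW : Roomy W n) (hm : m ≤ n) (hr : s.ints r 0 = m) (hu : s.ints u 0 = p)
    (hv : s.ints v 0 = q) (hp : p < m) (hq : q < m) :
    Does W N (setBase R r u v) s fun s' => s' = s.setInt R 0 (16 * (m * p + q)) := by
  have h1 := hW.block hm hp hq
  have h2 := hW.le
  refine does_setReg ⟨?_, ⟨⟨fits_reg (by omega), fits_reg (by omega), ?_⟩, fits_reg (by omega), ?_⟩,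
    ?_⟩ ?_
  · change 16 ≤ W; omega
  all_goals simp only [IExp.eval, hr, hu, hv]
  all_goals omega

/-- The array holds the projectors of `x` in both orders of the qubits. -/
def Full {n : ℕ} (f : ℕ → ℂ) (x : Instance n) : Prop :=
  ∀ p q : Fin n, p ≠ q → blk f (n * p + q) = x.cons p q

theorem Holds.blk_eq {n : ℕ} {s : Memory} {x : Instance n} (h : Holds s x) {p q : Fin n}
    (hpq : p < q) : blk (s.nums 0) (n * p + q) = x.proj p q := by
  ext ⟨i, j⟩ ⟨k, l⟩
  rw [← h.2 p q hpq]
  simp only [blk, cell, vcell]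
  congr 1
  ring

theorem holds_of_blk {n : ℕ} {s : Memory} {x : Instance n} (h0 : s.ints 0 0 = n)
    (h : ∀ p q : Fin n, p < q → blk (s.nums 0) (n * p + q) = x.proj p q) : Holds s x := by
  refine ⟨h0, fun p q hpq i j k l => ?_⟩
  rw [← h p q hpq]
  simp only [blk, cell, vcell]
  congr 1
  ring

/-- Fills array `2` with the projectors of the instance in array `0`, in both orders of the
qubits. -/
def loadFull : Program :=
  forPairs 0 (.seq (setBase 8 0 6 7) (.seq (setBase 9 0 7 6)
    (.seq (setBlk 2 8 fun τ ρ => rd 0 8 (cell (τ, ρ)))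
      (setBlk 2 9 fun τ ρ => rd 0 8 (cell (τ.swap, ρ.swap))))))

theorem does_loadFull {W n : ℕ} {s : Memory} {x : Instance n} (hW : Roomy W n)
    (hs : Holds s x) :
    Does W n loadFull s fun s' => s'.ints 0 0 = n ∧ Full (s'.nums 2) x := by
  have hWn := hW.le
  refine (does_forPairs (m := n) (fun S s' => s'.ints 0 0 = n ∧ s'.nums 0 = s.nums 0 ∧
    ∀ p q : Fin n, p < q → ((p : ℕ), (q : ℕ)) ∈ S →
      blk (s'.nums 2) (n * p + q) = x.cons p q ∧ blk (s'.nums 2) (n * q + p) = x.cons q p)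
    le_rfl (by omega) (fun _ _ h => h.1) (fun _ s' v h => by simpa using h)
    (fun _ s' v h => by simpa using h) ?_ ⟨hs.1, rfl, by simp⟩).mono ?_
  · rintro S s1 p q hpq hq - ⟨h0, hn0, hJ⟩ h6 h7
    have hp : p < n := hpq.trans hq
    refine (does_setBase hW le_rfl h0 h6 h7 hp hq).seq ?_
    rintro _ rfl
    refine (does_setBase hW le_rfl (by simpa using h0) (by simpa using h7) (by simpa using h6) hq
      hp).seq ?_
    rintro _ rfl
    have hb1 := hW.block le_rfl hp hq
    have hb2 := hW.block le_rfl hq hp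
    set p' : Fin n := ⟨p, hp⟩
    set q' : Fin n := ⟨q, hq⟩
    have hpq' : p' < q' := hpq
    have hblk : blk (s.nums 0) (n * p + q) = x.proj p' q' := hs.blk_eq hpq'
    refine (does_setBlk (B := n * p + q) (x.proj p' q') (by simp) hb1 ?_).seq ?_
    · rintro s' h1 h2 - τ ρ -
      have hc := cell_lt (τ, ρ)
      rw [eval_rd, fits_rd, h1, h2 0 (by simp)]
      refine ⟨?_, by simp; omega⟩
      rw [← hblk]
      simp [blk, hn0]
    rintro s2 ⟨h1, h2, h3, h4⟩
    refine (does_setBlk (B := n * q + p) ((x.proj p' q').submatrix Prod.swap Prod.swap)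
      (by rw [h1]; simp) hb2 ?_).mono ?_
    · rintro s' h1' h2' - τ ρ -
      have hc := cell_lt (τ.swap, ρ.swap)
      rw [eval_rd, fits_rd, h1', h1, h2' 0 (by simp), h2 0 (by simp)]
      refine ⟨?_, by simp; omega⟩
      rw [← hblk]
      simp [blk, hn0]
    rintro s3 ⟨h5, h6', h7', h8⟩
    rw [h5, h1, h6' 0 (by simp), h2 0 (by simp)]
    refine ⟨⟨by simpa using h0, hn0, ?_⟩, by simpa using h6, by simpa using h7⟩
    intro a b hab hS
    have hne : n * p + q ≠ n * q + p := fun h => by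
      have := (block_index_inj hq hp h).1
      omega
    rcases hS with hS | hS
    · rw [Prod.mk.injEq] at hS
      obtain rfl : a = p' := Fin.ext hS.1
      obtain rfl : b = q' := Fin.ext hS.2
      rw [x.cons_swap hab.ne, x.cons_of_lt hab]
      exact ⟨(h8 _ hne).trans h3, h7'⟩
    · by_cases hab' : a = p' ∧ b = q'
      · obtain ⟨rfl, rfl⟩ := hab'
        rw [x.cons_swap hab.ne, x.cons_of_lt hab]
        exact ⟨(h8 _ hne).trans h3, h7'⟩
      have hJ' := hJ a b hab hS
      have hne1 : n * (a : ℕ) + b ≠ n * p + q := fun h => hab' <| by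
        obtain ⟨e1, e2⟩ := block_index_inj b.isLt hq h
        exact ⟨Fin.ext e1, Fin.ext e2⟩
      have hne2 : n * (b : ℕ) + a ≠ n * q + p := fun h => hab' <| by
        obtain ⟨e1, e2⟩ := block_index_inj a.isLt hp h
        exact ⟨Fin.ext e2, Fin.ext e1⟩
      have hne3 : n * (a : ℕ) + b ≠ n * q + p := fun h => by
        obtain ⟨e1, e2⟩ := block_index_inj b.isLt hp h
        have : (a : ℕ) < b := hab
        omega
      have hne4 : n * (b : ℕ) + a ≠ n * p + q := fun h => by
        obtain ⟨e1, e2⟩ := block_index_inj a.isLt hq h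
        have : (a : ℕ) < b := hab
        omega
      exact ⟨by rw [h8 _ hne3, h4 _ hne1, ← hJ'.1]; rfl,
        by rw [h8 _ hne2, h4 _ hne4, ← hJ'.2]; rfl⟩
  · rintro s' ⟨h0, -, h⟩
    refine ⟨h0, fun p q hpq => ?_⟩
    rcases lt_or_gt_of_ne hpq with hl | hl
    · exact (h p q hl ⟨hl, q.isLt⟩).1
    · exact (h q p hl ⟨hl, p.isLt⟩).2

/-! ### The search for a pair of high rank -/

/-- The trace of the block at `R` of array `2`. -/
def traceExp (R : ℕ) : NExp := sum4 fun τ => rd 2 R (cell (τ, τ))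

theorem eval_traceExp {R B : ℕ} {s : Memory} (hR : s.ints R 0 = 16 * B) :
    (traceExp R).eval s = (blk (s.nums 2) B).trace := by
  rw [traceExp, eval_sum4]
  simp only [eval_rd, hR]
  rfl

theorem fits_traceExp {W R B : ℕ} {s : Memory} (hR : s.ints R 0 = 16 * B)
    (hW : 16 * B + 15 ≤ W) : (traceExp R).fits W s :=
  fits_sum4 fun τ => (fits_rd _ _ _).2 (by have := cell_lt (τ, τ); omega)

/-- Records the pair in the registers `6`, `7`, together with its rank `k`. -/
def mark (k : ℕ) : Program :=
  .seq (setReg 2 (.lit k)) (.seq (setReg 3 (reg 6)) (setReg 4 (reg 7)))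

theorem does_mark {W N k p q : ℕ} {s : Memory} (hk : k ≤ W) (hp : p ≤ W) (hq : q ≤ W)
    (h6 : s.ints 6 0 = p) (h7 : s.ints 7 0 = q) :
    Does W N (mark k) s fun s' => s' = ((s.setInt 2 0 k).setInt 3 0 p).setInt 4 0 q := by
  refine (does_setReg (Q := fun s' => s' = s.setInt 2 0 k) (e := .lit k) hk rfl).seq ?_
  rintro _ rfl
  refine (does_setReg (Q := fun s' => s' = (s.setInt 2 0 k).setInt 3 0 p)
    (fits_reg (by simp; omega)) (by simp [IExp.eval, h6])).seq ?_
  rintro _ rfl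
  exact does_setReg (fits_reg (by simp; omega)) (by simp [IExp.eval, h7])

/-- A pair of rank at least two, and its rank, have been recorded. -/
def Found {n : ℕ} (f : ℕ → ℕ → ℕ) (x : Instance n) : Prop :=
  ∃ a b : Fin n, a < b ∧ f 3 0 = a ∧ f 4 0 = b ∧ f 2 0 = (x.proj a b).rank ∧
    2 ≤ (x.proj a b).rank

/-- Looks for a pair of rank at least two; the last one is recorded, and register `2` stays `0` if
there is none. The rank is compared with constants as a trace, since complex numbers cannot be
converted to indices. -/
def scan : Program :=
  .seq (setReg 2 (.lit 0)) (forPairs 0 (.seq (setBase 8 0 6 7)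
    (.ite (.eq (traceExp 8) (.lit 2)) (mark 2)
      (.ite (.eq (traceExp 8) (.lit 3)) (mark 3)
        (.ite (.eq (traceExp 8) (.lit 4)) (mark 4) .skip)))))

theorem does_scan {W n : ℕ} {s : Memory} {x : Instance n} (hW : Roomy W n)
    (h0 : s.ints 0 0 = n) (hx : Full (s.nums 2) x) :
    Does W n scan s fun s' => s'.ints 0 0 = n ∧ s'.nums = s.nums ∧
      (s'.ints 2 0 = 0 ∧ x.Homogeneous ∨ Found s'.ints x) := by
  have hWn := hW.le
  refine (does_setReg (Q := fun s' => s' = s.setInt 2 0 0) (Nat.zero_le _) rfl).seq ?_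
  rintro _ rfl
  refine (does_forPairs (m := n) (fun S s' => s'.ints 0 0 = n ∧ s'.nums = s.nums ∧
    ((s'.ints 2 0 = 0 ∧ ∀ p q : Fin n, p < q → ((p : ℕ), (q : ℕ)) ∈ S →
      (x.proj p q).rank ≤ 1) ∨ Found s'.ints x))
    le_rfl (by omega) (fun _ _ h => h.1) (fun _ s' v h => by simpa [Found] using h)
    (fun _ s' v h => by simpa [Found] using h) ?_ (by simp [h0])).mono ?_
  · rintro S s1 p q hpq hq - ⟨h0, hn, hJ⟩ h6 h7
    have hp : p < n := hpq.trans hq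
    refine (does_setBase hW le_rfl h0 h6 h7 hp hq).seq ?_
    rintro _ rfl
    set s2 := s1.setInt 8 0 (16 * (n * p + q)) with hs2
    have hb := hW.block le_rfl hp hq
    set p' : Fin n := ⟨p, hp⟩ with hp'
    set q' : Fin n := ⟨q, hq⟩ with hq'
    have hpq' : p' < q' := hpq
    have hR : s2.ints 8 0 = 16 * (n * p + q) := by simp [hs2]
    have hblk : blk (s2.nums 2) (n * p + q) = x.proj p' q' := by
      rw [← x.cons_of_lt hpq', ← hx p' q' hpq'.ne]
      simp [hs2, hn, hp', hq']
    have htr : (traceExp 8).eval s2 = ((x.proj p' q').rank : ℂ) := by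
      rw [eval_traceExp hR, hblk, rank_eq_trace (x.isProj _ _ hpq')]
    have hfit := fits_traceExp hR hb
    have htest : ∀ k : ℕ, (Test.eq (traceExp 8) (.lit k)).holds s2 ↔ (x.proj p' q').rank = k := by
      intro k
      simp only [Test.holds, NExp.eval, htr]
      exact Nat.cast_inj
    have hmark : ∀ k, 2 ≤ k → k ≤ 4 → (x.proj p' q').rank = k →
        Does W n (mark k) s2 fun s' => (s'.ints 0 0 = n ∧ s'.nums = s.nums ∧
          ((s'.ints 2 0 = 0 ∧ ∀ a b : Fin n, a < b → ((a : ℕ), (b : ℕ)) ∈ insert (p, q) S →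
            (x.proj a b).rank ≤ 1) ∨ Found s'.ints x)) ∧ s'.ints 6 0 = p ∧ s'.ints 7 0 = q := by
      intro k hk2 hk4 hr
      refine (does_mark (p := p) (q := q) (by omega) (by omega) (by omega) (by simpa [hs2] using h6)
        (by simpa [hs2] using h7)).mono ?_
      rintro _ rfl
      refine ⟨⟨by simpa [hs2] using h0, hn, .inr ⟨p', q', hpq', by simp [hp'], by simp [hq'], ?_,
        ?_⟩⟩, by simpa [hs2] using h6, by simpa [hs2] using h7⟩
      · simp [hr]
      · omega
    refine does_ite ⟨hfit, trivial⟩ (fun h => hmark 2 (by omega) (by omega) ((htest 2).1 h))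
      fun hn2 => does_ite ⟨hfit, trivial⟩
        (fun h => hmark 3 (by omega) (by omega) ((htest 3).1 h))
      fun hn3 => does_ite ⟨hfit, trivial⟩
        (fun h => hmark 4 (by omega) (by omega) ((htest 4).1 h))
      fun hn4 => does_skip ?_
    rw [htest] at hn2 hn3 hn4
    refine ⟨⟨by simpa [hs2] using h0, hn, ?_⟩, by simpa [hs2] using h6, by simpa [hs2] using h7⟩
    rcases hJ with ⟨h2, hJ⟩ | hJ
    · refine .inl ⟨by simpa [hs2] using h2, fun a b hab hS => ?_⟩
      rcases hS with hS | hS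
      · rw [Prod.mk.injEq] at hS
        rw [show a = p' from Fin.ext hS.1, show b = q' from Fin.ext hS.2]
        have h4 : (x.proj p' q').rank ≤ 4 := by
          simpa using rank_le_card_width (x.proj p' q')
        omega
      · exact hJ a b hab hS
    · exact .inr (by simpa [Found, hs2] using hJ)
  · rintro s' ⟨h0, hn, h⟩
    exact ⟨h0, hn, h.imp_left fun h => ⟨h.1, fun p q hpq => h.2 p q hpq ⟨hpq, q.isLt⟩⟩⟩

/-! ### Closing a homogeneous instance under the rule -/

/-- Stores a nonzero row of the block at `R` of array `2`, or zero if there is none. -/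
def pickRow (D R : ℕ) : Program :=
  .seq (fill D pairs (fun τ => .lit (vcell τ)) fun _ => .lit 0)
    (pick D pairs (fun τ => .lit (vcell τ)) pairs fun τ ρ => rd 2 R (cell (τ, ρ)))

theorem does_pickRow {W N D R B : ℕ} {s : Memory} {P : TwoQubitOp} (hD : D ≠ 2)
    (hR : s.ints R 0 = 16 * B) (hW : 16 * B + 15 ≤ W) (hP : blk (s.nums 2) B = P) :
    Does W N (pickRow D R) s fun s' => s'.ints = s.ints ∧ (∀ k ≠ D, s'.nums k = s.nums k) ∧
      ((∃ τ, P τ ≠ 0 ∧ vec (s'.nums D) = P τ) ∨ P = 0 ∧ vec (s'.nums D) = 0) := by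
  have hv : ∀ (τ : Fin 2 × Fin 2) (s : Memory), (IExp.lit (vcell τ)).fits W s := fun τ s => by
    have := vcell_lt τ
    change vcell τ ≤ W
    omega
  refine (does_fill vcell 0 nodup_pairs vcell_injective ?_).seq ?_
  · rintro τ - s' - - - -
    exact ⟨⟨rfl, hv τ s'⟩, by simp [NExp.eval], trivial⟩
  rintro s1 ⟨h1, h2, h3, -⟩
  refine (does_pick vcell (fun τ => P τ) mem_pairs nodup_pairs vcell_injective ?_).mono ?_
  · rintro s' h4 h5 - τ - ρ
    have := cell_lt (τ, ρ)
    refine ⟨⟨rfl, hv ρ s'⟩, ?_, ?_⟩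
    · rw [eval_rd, h4, h1, hR, h5 2 hD.symm, h2 2 hD.symm, ← hP]; rfl
    · rw [fits_rd, h4, h1, hR]; omega
  · rintro s' ⟨h4, h5, -, h6⟩
    refine ⟨h4.trans h1, fun k hk => by rw [h5 k hk, h2 k hk], ?_⟩
    rcases h6 with ⟨τ, -, h7, h8⟩ | ⟨h7, h8⟩
    · exact .inl ⟨τ, h7, funext h8⟩
    · exact .inr ⟨funext fun τ => h7 τ (mem_pairs τ), funext fun τ =>
        (h8 τ).trans (h3 τ (mem_pairs τ))⟩

/-- A covector on two qubits as a two-tensor. -/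
def unflat (v : Fin 2 × Fin 2 → ℂ) : Matrix (Fin 2) (Fin 2) ℂ := Matrix.of fun i j => v (i, j)

/-- In a homogeneous instance a nonzero row of a projector spans the constraint tensors. -/
theorem Instance.Homogeneous.unflat_row {n : ℕ} {x : Instance n} (hx : x.Homogeneous)
    {a b : Fin n} (h : a ≠ b) {T : Fin 2 × Fin 2 → ℂ}
    (hT : (∃ τ, x.cons a b τ ≠ 0 ∧ T = x.cons a b τ) ∨ x.cons a b = 0 ∧ T = 0) :
    unflat T ∈ x.tensors a b ∧ ∀ φ ∈ x.tensors a b, ∃ c : ℂ, φ = c • unflat T := by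
  rcases hT with ⟨τ, h0, rfl⟩ | ⟨h0, rfl⟩
  · have h1 : unflat (x.cons a b τ) ∈ x.tensors a b := x.row_mem_tensors h τ
    refine ⟨h1, fun φ hφ => hx.exists_smul h h1 (fun he => h0 ?_) hφ⟩
    ext ⟨i, j⟩
    exact congrFun (congrFun he i) j
  · refine ⟨Submodule.zero_mem _, fun φ hφ => ⟨0, ?_⟩⟩
    rw [x.mem_tensors_iff h, h0, vecMul_zero] at hφ
    rw [zero_smul]
    exact flat_injective hφ.symm

/-- The entries of `φ ε θ`, for `φ` in array `4` and `θ` in array `5`. -/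
def composeExp (τ : Fin 2 × Fin 2) : NExp :=
  .sub (.mul (vc 4 (τ.1, 0)) (vc 5 (1, τ.2))) (.mul (vc 4 (τ.1, 1)) (vc 5 (0, τ.2)))

theorem eval_composeExp (τ : Fin 2 × Fin 2) (s : Memory) : (composeExp τ).eval s =
    flat (unflat (vec (s.nums 4)) * eps * unflat (vec (s.nums 5))) τ := by
  simp only [composeExp, NExp.eval, eval_vc, flat, unflat, eps, mul_apply, Fin.sum_univ_two,
    Matrix.of_apply, cons_val', cons_val_zero, cons_val_one, cons_val_fin_one]
  ring

/-- Adds the composition through the qubit in register `5` to the constraints of the pair in the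
registers `6`, `7`, and records the pair if its rank becomes two. Nothing is done if the three
qubits are not distinct, or if some pair has been recorded. -/
def closeBody : Program :=
  .ite (.and (.le (reg 2) (.lit 0))
      (.and (.not (.eqI (reg 6) (reg 5))) (.not (.eqI (reg 5) (reg 7)))))
    (.seq (setBase 8 0 6 5) (.seq (pickRow 4 8) (.seq (setBase 8 0 5 7) (.seq (pickRow 5 8)
      (.seq (setBase 8 0 6 7) (.seq (setBase 9 0 7 6) (.seq (addTensorProg 2 8 composeExp)
        (.seq (setBlk 2 9 fun τ ρ => rd 2 8 (cell (τ.swap, ρ.swap)))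
          (.ite (.eq (traceExp 8) (.lit 2)) (mark 2) .skip)))))))))
    .skip

/-- The instance has been extended to `z`, and either a pair of rank two has been recorded, or `z`
is homogeneous and satisfies `P`. -/
def Closing {n : ℕ} (x : Instance n) (s : Memory) (P : Instance n → Prop) : Prop :=
  s.ints 0 0 = n ∧ ∃ z : Instance n, Relation.ReflTransGen RuleStep x z ∧ Full (s.nums 2) z ∧
    (s.ints 2 0 = 0 ∧ z.Homogeneous ∧ P z ∨ s.ints 2 0 = 2 ∧ Found s.ints z)

theorem Closing.mono {n : ℕ} {x : Instance n} {s : Memory} {P Q : Instance n → Prop}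
    (h : Closing x s P) (hPQ : ∀ z, z.Homogeneous → P z → Q z) : Closing x s Q := by
  obtain ⟨h0, z, h1, h2, h3⟩ := h
  exact ⟨h0, z, h1, h2, h3.imp_left fun h => ⟨h.1, h.2.1, hPQ z h.2.1 h.2.2⟩⟩

theorem Closing.setInt {n : ℕ} {x : Instance n} {s : Memory} {P : Instance n → Prop}
    (h : Closing x s P) {k v : ℕ} (hk : 5 ≤ k) : Closing x (s.setInt k 0 v) P := by
  have h0 : (0 : ℕ) ≠ k := by omega
  have h2 : (2 : ℕ) ≠ k := by omega
  have h3 : (3 : ℕ) ≠ k := by omega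
  have h4 : (4 : ℕ) ≠ k := by omega
  simpa [Closing, Found, h0, h2, h3, h4] using h

theorem Full.addAt {n : ℕ} {f g : ℕ → ℂ} {x : Instance n} (hf : Full f x) {p q : Fin n}
    (hpq : p < q) {w : Fin 2 × Fin 2 → ℂ}
    (h1 : blk g (n * p + q) = addTensor (x.proj p q) w)
    (h2 : blk g (n * q + p) = (addTensor (x.proj p q) w).submatrix Prod.swap Prod.swap)
    (h3 : ∀ B, B ≠ n * p + q → B ≠ n * q + p → blk g B = blk f B) : Full g (x.addAt p q w) := by
  have h4 : (x.addAt p q w).cons p q = addTensor (x.proj p q) w := by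
    rw [Instance.cons_of_lt _ hpq, Instance.addAt_proj_self]
  intro a b hab
  by_cases hs : s(a, b) = s(p, q)
  · rcases Sym2.eq_iff.1 hs with ⟨rfl, rfl⟩ | ⟨rfl, rfl⟩
    · rw [h1, h4]
    · rw [h2, Instance.cons_swap _ hpq.ne, h4]
  · rw [Instance.addAt_cons_of_ne x hs, ← hf a b hab]
    refine h3 _ (fun h => hs ?_) fun h => hs ?_
    · obtain ⟨e1, e2⟩ := block_index_inj b.isLt q.isLt h
      rw [Fin.ext e1, Fin.ext e2]
    · obtain ⟨e1, e2⟩ := block_index_inj b.isLt p.isLt h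
      rw [Fin.ext e1, Fin.ext e2, Sym2.eq_swap]

/-- The invariant of the stage `k`: `z` arises from an instance `y` that is closed under
compositions through the qubits before `k`. -/
def Staged {n : ℕ} (k : Fin n) (S : Set (ℕ × ℕ)) (z : Instance n) : Prop :=
  ∃ y : Instance n, y.Homogeneous ∧ y.ClosedBelow k ∧ y.Stage z k S

theorem does_closeBody {W n : ℕ} {x : Instance n} {k p q : Fin n} {S : Set (ℕ × ℕ)}
    {s : Memory} (hW : Roomy W n) (hpq : p < q) (hS : ((p : ℕ), (q : ℕ)) ∉ S)
    (h5 : s.ints 5 0 = k) (h6 : s.ints 6 0 = p) (h7 : s.ints 7 0 = q)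
    (hJ : Closing x s (Staged k S)) :
    Does W n closeBody s fun s' => Closing x s' (Staged k (insert (↑p, ↑q) S)) ∧
      s'.ints 5 0 = k ∧ s'.ints 6 0 = p ∧ s'.ints 7 0 = q := by
  have hWn := hW.le
  have hk := k.isLt
  have hp := p.isLt
  have hq := q.isLt
  obtain ⟨h0, z, hz, hf, hc⟩ := hJ
  have h2W : s.ints 2 0 ≤ W := by rcases hc with h | h <;> omega
  refine does_ite ⟨⟨fits_reg h2W, Nat.zero_le _⟩,
    Test.eqI_fits (fits_reg (by omega)) (fits_reg (by omega)),
    Test.eqI_fits (fits_reg (by omega)) (fits_reg (by omega))⟩ ?_ ?_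
  · intro hc'
    simp only [Test.holds, Test.eqI_holds, IExp.eval, h5, h6, h7] at hc'
    obtain ⟨hc1, hc2, hc3⟩ := hc'
    have hpk : p ≠ k := fun h => hc2 (congrArg Fin.val h)
    have hkq : k ≠ q := fun h => hc3 (congrArg Fin.val h)
    obtain ⟨h2, hzh, y, hyh, hyc, hst⟩ : s.ints 2 0 = 0 ∧ z.Homogeneous ∧ Staged k S z := by
      rcases hc with h | h
      · exact h
      · omega
    refine (does_setBase hW le_rfl h0 h6 h5 hp hk).seq ?_
    rintro _ rfl
    refine (does_pickRow (P := z.cons p k) (by simp) (by simp) (hW.block le_rfl hp hk)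
      (by simpa using hf p k hpk)).seq ?_
    rintro s1 ⟨i1, n1, t1⟩
    obtain ⟨m1, u1⟩ := hzh.unflat_row hpk t1
    refine (does_setBase hW le_rfl (by simpa [i1] using h0) (by simpa [i1] using h5)
      (by simpa [i1] using h7) hk hq).seq ?_
    rintro _ rfl
    refine (does_pickRow (P := z.cons k q) (by simp) (by simp) (hW.block le_rfl hk hq)
      (by simpa [n1] using hf k q hkq)).seq ?_
    rintro s2 ⟨i2, n2, t2⟩
    obtain ⟨m2, u2⟩ := hzh.unflat_row hkq t2
    refine (does_setBase hW le_rfl (by simpa [i1, i2] using h0) (by simpa [i1, i2] using h6)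
      (by simpa [i1, i2] using h7) hp hq).seq ?_
    rintro _ rfl
    refine (does_setBase hW le_rfl (by simpa [i1, i2] using h0) (by simpa [i1, i2] using h7)
      (by simpa [i1, i2] using h6) hq hp).seq ?_
    rintro _ rfl
    have e4 : vec (s2.nums 4) = vec (s1.nums 4) := by rw [n2 4 (by simp)]; rfl
    set T₁ := unflat (vec (s1.nums 4))
    set T₂ := unflat (vec (s2.nums 5))
    set w := flat (T₁ * eps * T₂) with hw
    have hb1 := hW.block le_rfl hp hq
    have hb2 := hW.block le_rfl hq hp
    have hne : n * (p : ℕ) + q ≠ n * q + p := fun h => by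
      have := (block_index_inj hq hp h).1
      have : (p : ℕ) < q := hpq
      omega
    have hz2 : s2.nums 2 = s.nums 2 := by rw [n2 2 (by simp)]; exact n1 2 (by simp)
    refine (does_addTensorProg (B := n * p + q) w (by simp) (by simp) hb1 ?_).seq ?_
    · intro s' j1 j2 τ
      refine ⟨?_, ⟨fits_vc (by omega) _ _, fits_vc (by omega) _ _⟩, fits_vc (by omega) _ _,
        fits_vc (by omega) _ _⟩
      rw [eval_composeExp, j2 4 (by simp), j2 5 (by simp)]
      simp only [Memory.setInt_nums, e4, hw, T₁, T₂]
    rintro s3 ⟨i3, -, b3, c3⟩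
    have hzpq : blk (s2.nums 2) (n * p + q) = z.proj p q := by
      rw [hz2, hf p q hpq.ne, z.cons_of_lt hpq]
    simp only [Memory.setInt_nums, hzpq] at b3 c3
    refine (does_setBlk (B := n * q + p)
      ((addTensor (z.proj p q) w).submatrix Prod.swap Prod.swap) (by simp [i3]) hb2 ?_).seq ?_
    · rintro s' j1 - j3 τ ρ -
      have hcl := cell_lt (τ.swap, ρ.swap)
      have hR : s'.ints 8 0 = 16 * (n * p + q) := by rw [j1, i3]; simp
      rw [fits_rd, eval_rd, hR]
      refine ⟨?_, by omega⟩
      rw [submatrix_apply, ← b3, ← j3 _ hne]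
      rfl
    rintro s4 ⟨i4, -, b4, c4⟩
    have i4' : s4.ints = _ := i4.trans i3
    have hfull : Full (s4.nums 2) (z.addAt p q w) :=
      hf.addAt hpq ((c4 _ hne).trans b3) b4 fun B hB1 hB2 => by
        rw [c4 B hB2, c3 B hB1, hz2]
    have hrule : Relation.ReflTransGen RuleStep x (z.addAt p q w) :=
      hz.tail (z.ruleStep_addAt hzh hpq hpk hkq m1 m2)
    have hstage := hst.insert_addAt hpq hpk hkq hS m1 m2 u1 u2
    have hproj : (z.addAt p q w).proj p q = addTensor (z.proj p q) w := z.addAt_proj_self p q w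
    have hR8 : s4.ints 8 0 = 16 * (n * p + q) := by simp [i4']
    have hblk4 : blk (s4.nums 2) (n * p + q) = (z.addAt p q w).proj p q := by
      rw [c4 _ hne, b3, hproj]
    have htest : (Test.eq (traceExp 8) (.lit 2)).holds s4 ↔
        ((z.addAt p q w).proj p q).rank = 2 := by
      simp only [Test.holds, NExp.eval]
      rw [eval_traceExp hR8, hblk4, ← rank_eq_trace ((z.addAt p q w).isProj _ _ hpq)]
      exact Nat.cast_inj
    have g0 : s4.ints 0 0 = n := by simpa [i4', i2, i1] using h0
    have g2 : s4.ints 2 0 = 0 := by simpa [i4', i2, i1] using h2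
    have g5 : s4.ints 5 0 = k := by simpa [i4', i2, i1] using h5
    have g6 : s4.ints 6 0 = p := by simpa [i4', i2, i1] using h6
    have g7 : s4.ints 7 0 = q := by simpa [i4', i2, i1] using h7
    refine does_ite ⟨fits_traceExp hR8 hb1, trivial⟩ (fun ht => ?_) fun ht => ?_
    · rw [htest] at ht
      refine (does_mark (p := p) (q := q) (by omega) (by omega) (by omega) g6 g7).mono ?_
      rintro _ rfl
      refine ⟨⟨by simpa using g0, _, hrule, by simpa using hfull, .inr ⟨by simp, p, q, hpq,
        by simp, by simp, by simp [ht], ht.ge⟩⟩, by simpa using g5, by simpa using g6,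
        by simpa using g7⟩
    · rw [htest] at ht
      refine does_skip ⟨⟨g0, _, hrule, hfull, .inl ⟨g2, ?_, y, hyh, hyc, hstage⟩⟩, g5, g6, g7⟩
      intro a b hab
      by_cases he : a = p ∧ b = q
      · obtain ⟨rfl, rfl⟩ := he
        have h1 := rank_addTensor_le (z.proj a b) w
        have h2 := hzh a b hab
        rw [← hproj] at h1
        omega
      · rw [z.addAt_proj_of_ne he]
        exact hzh a b hab
  · intro hc'
    simp only [Test.holds, Test.eqI_holds, IExp.eval, h5, h6, h7] at hc'
    refine does_skip ⟨⟨h0, z, hz, hf, ?_⟩, h5, h6, h7⟩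
    refine hc.imp_left ?_
    rintro ⟨h2, hzh, y, hyh, hyc, hst⟩
    refine ⟨h2, hzh, y, hyh, hyc, hst.insert_of_eq ?_⟩
    by_contra hcon
    push Not at hcon
    exact hc' ⟨by omega, fun h => hcon.1 (Fin.ext h), fun h => hcon.2 (Fin.ext h)⟩

/-- Closes a homogeneous instance under the rule, or stops at the first pair of rank two. -/
def closeProg : Program := forLoop 5 0 (forPairs 0 closeBody)

theorem does_closeProg {W n : ℕ} {x : Instance n} {s : Memory} (hW : Roomy W n)
    (hx : x.Homogeneous) (h0 : s.ints 0 0 = n) (h2 : s.ints 2 0 = 0) (hf : Full (s.nums 2) x) :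
    Does W n closeProg s fun s' => Closing x s' fun z => z.ClosedBelow n := by
  have hWn := hW.le
  refine does_forLoop (fun k s' => Closing x s' fun z => z.ClosedBelow k) le_rfl (by omega)
    (fun _ _ h => h.1) (fun _ s' v h => h.setInt le_rfl) ?_
    ⟨h0, x, .refl, hf, .inl ⟨h2, hx, fun _ _ _ _ _ _ h => absurd h (Nat.not_lt_zero _)⟩⟩
  intro k hk s1 hs1 h5
  set k' : Fin n := ⟨k, hk⟩ with hk'
  have hJ : Closing x s1 (Staged k' ∅) := hs1.mono fun z hz hc => ⟨z, hz, hc, z.stage_empty k'⟩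
  refine (does_forPairs (m := n) (fun S s' => Closing x s' (Staged k' S) ∧
    s'.ints 5 0 = k) le_rfl (by omega) (fun _ _ h => h.1.1)
    (fun _ s' v h => ⟨h.1.setInt (by omega), by simpa using h.2⟩)
    (fun _ s' v h => ⟨h.1.setInt (by omega), by simpa using h.2⟩) ?_ ⟨hJ, h5⟩).mono ?_
  · rintro S s2 p q hpq hq hS ⟨hJ, h5⟩ h6 h7
    exact (does_closeBody (p := ⟨p, hpq.trans hq⟩) (q := ⟨q, hq⟩) hW hpq hS h5 h6 h7 hJ).mono
      fun s' h => ⟨⟨h.1, h.2.1⟩, h.2.2⟩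
  · rintro s' ⟨h, h5⟩
    exact ⟨h.mono fun z _ ⟨y, hy, hyc, hst⟩ =>
      hst.closedBelow_succ (fun p q hpq => ⟨hpq, q.isLt⟩) hy hyc, h5⟩

/-! ### Product states -/

theorem vecMul_eps (v : Fin 2 → ℂ) : v ᵥ* eps = ![-v 1, v 0] := by
  ext i
  fin_cases i <;> simp [vecMul, dotProduct, Fin.sum_univ_two, eps]

theorem eq_zero_of_vecMul_eps {v : Fin 2 → ℂ} (h : v ᵥ* eps = 0) : v = 0 := by
  rw [vecMul_eps] at h
  have h0 := congrFun h 0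
  have h1 := congrFun h 1
  ext i
  fin_cases i
  · simpa using h1
  · simpa using h0

theorem Instance.vecMul_eq_zero_of_rows {n : ℕ} {x : Instance n} {a b : Fin n} (h : a ≠ b)
    {u : Fin 2 → ℂ} (hu : ∀ τ, u ᵥ* unflat (x.cons a b τ) = 0)
    {φ : Matrix (Fin 2) (Fin 2) ℂ} (hφ : φ ∈ x.tensors a b) : u ᵥ* φ = 0 := by
  have h1 : ∀ i j, φ i j = ∑ τ, flat φ τ * x.cons a b τ (i, j) := fun i j =>
    (congrFun ((x.mem_tensors_iff h).1 hφ) (i, j)).symm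
  ext j
  have h2 : ∀ τ, ∑ i, u i * x.cons a b τ (i, j) = 0 := fun τ => congrFun (hu τ) j
  change ∑ i, u i * φ i j = 0
  simp only [h1, Finset.mul_sum]
  rw [Finset.sum_comm]
  refine Finset.sum_eq_zero fun τ _ => ?_
  rw [← mul_zero (flat φ τ), ← h2 τ, Finset.mul_sum]
  exact Finset.sum_congr rfl fun i _ => mul_left_comm _ _ _

/-- Component `j` of the contraction of the one-qubit vector at `2 * q` (register `11`) with the row
`τ` of the block at the register `8`. -/
def contractExp (τ : Fin 2 × Fin 2) (j : Fin 2) : NExp :=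
  sum2 fun i => .mul (rd 1 11 i) (rd 2 8 (cell (τ, (i, j))))

/-- The state of a qubit that is forced by the row `τ`. -/
def forceExp (τ : Fin 2 × Fin 2) (i : Fin 2) : NExp :=
  if i = 0 then .sub (.lit 0) (contractExp τ 1) else contractExp τ 0

/-- `R := 2 * u`, the address of the one-qubit vector of the qubit `u`. -/
def setDouble (R u : ℕ) : Program := setReg R (.mul (.lit 2) (reg u))

theorem does_setDouble {W N R u p : ℕ} {s : Memory} (hW : 2 * p + 2 ≤ W) (hu : s.ints u 0 = p) :
    Does W N (setDouble R u) s fun s' => s' = s.setInt R 0 (2 * p) := by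
  refine does_setReg ⟨?_, fits_reg (by omega), ?_⟩ ?_
  · change 2 ≤ W; omega
  · simp only [IExp.eval, hu]; omega
  · simp [IExp.eval, hu]

@[simp] theorem Memory.setInt_vectors (s : Memory) (arr i v n : ℕ) :
    (s.setInt arr i v).vectors n = s.vectors n := rfl

/-- Computes the one-qubit states of a product solution. Each qubit is put in the state `|0⟩` first,
which is then overwritten by any nonzero state that a row of the projector with an earlier qubit
forces. -/
def productProg : Program :=
  forLoop 6 0 (.seq (setDouble 10 6)
    (.seq (fill 1 [(0 : Fin 2), 1] (fun i => .add (reg 10) (.lit i))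
        fun i => .lit (if i = 0 then 1 else 0))
      (forLoop 7 6 (.seq (setDouble 11 7) (.seq (setBase 8 0 7 6)
        (pick 1 [(0 : Fin 2), 1] (fun i => .add (reg 10) (.lit i)) pairs forceExp))))))

theorem does_productProg {W n : ℕ} {x : Instance n} {s : Memory} (hW : Roomy W n)
    (hx : x.Homogeneous) (hc : x.ClosedBelow n) (h0 : s.ints 0 0 = n) (hf : Full (s.nums 2) x) :
    Does W n productProg s fun s' => s'.ints 0 0 = n ∧ x.IsSA (productVec (s'.vectors n)) := by
  have hWn := hW.le
  have hpos : ∀ p : ℕ, Function.Injective fun i : Fin 2 => 2 * p + (i : ℕ) := fun p i j h => by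
    simp only at h
    omega
  have hmem : ∀ k : Fin 2, k ∈ [(0 : Fin 2), 1] := by decide
  have hnd : [(0 : Fin 2), 1].Nodup := by decide
  have hidx : ∀ {s : Memory} {p : ℕ}, p < n → s.ints 10 0 = 2 * p → ∀ i : Fin 2,
      (IExp.add (reg 10) (.lit i)).eval s = 2 * p + i ∧
        (IExp.add (reg 10) (.lit i)).fits W s := by
    intro s p hp h10 i
    refine ⟨by simp [IExp.eval, h10], fits_reg (by omega), ?_, ?_⟩
    · change (i : ℕ) ≤ W; omega
    · simp only [IExp.eval, h10]; omega
  let Good : (Fin n → Fin 2 → ℂ) → Fin n → Prop := fun ψ p => ψ p ≠ 0 ∧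
    ((∀ q < p, ∀ φ ∈ x.tensors q p, ψ q ᵥ* φ = 0) ∨
      ∃ q < p, ∃ φ ∈ x.tensors q p, ψ p = (ψ q ᵥ* φ) ᵥ* eps)
  refine (does_forLoop (B := n) (fun j s' => s'.ints 0 0 = n ∧ s'.nums 2 = s.nums 2 ∧
    ∀ p : Fin n, (p : ℕ) < j → Good (s'.vectors n) p) le_rfl (by omega) (fun _ _ h => h.1)
    (fun _ s' v h => by simpa using h) ?_ ⟨h0, rfl, by simp⟩).mono ?_
  · rintro p hp s1 ⟨h0, hn, hG⟩ h6
    set p' : Fin n := ⟨p, hp⟩ with hp'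
    refine (does_setDouble (by omega) h6).seq ?_
    rintro _ rfl
    refine (does_fill (fun i : Fin 2 => 2 * p + (i : ℕ)) (fun i => if i = 0 then 1 else 0) hnd
      (hpos p) ?_).seq ?_
    · rintro i - s' j1 - - -
      refine ⟨hidx hp (by simp [j1]) i, ?_, trivial⟩
      simp only [NExp.eval]
      split_ifs <;> simp
    rintro s2 ⟨i2, n2, v2, c2⟩
    set ψ := s2.vectors n with hψ
    have hold : ∀ (s' : Memory), (∀ c, (∀ i : Fin 2, c ≠ 2 * p + i) → s'.nums 1 c = s2.nums 1 c) →
        ∀ q : Fin n, (q : ℕ) ≠ p → s'.vectors n q = ψ q := by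
      intro s' h q hq
      funext i
      refine h _ fun i' => ?_
      omega
    refine (does_forLoop (B := p) (fun j s' => s'.ints 0 0 = n ∧ s'.ints 6 0 = p ∧
      s'.ints 10 0 = 2 * p ∧ s'.nums 2 = s.nums 2 ∧
      (∀ c, (∀ i : Fin 2, c ≠ 2 * p + i) → s'.nums 1 c = s2.nums 1 c) ∧
      s'.vectors n p' ≠ 0 ∧
      ((∀ q : Fin n, (q : ℕ) < j → ∀ τ, ψ q ᵥ* unflat (x.cons q p' τ) = 0) ∨
        ∃ q < p', ∃ φ ∈ x.tensors q p', s'.vectors n p' = (ψ q ᵥ* φ) ᵥ* eps)) hp.le (by omega)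
      (fun _ _ h => h.2.1) (fun _ s' v h => by simpa using h) ?_ ?_).mono ?_
    · rintro q hq s3 ⟨h0, h6, h10, hn, hcell, hne, hF⟩ h7
      have hqn : q < n := hq.trans hp
      set q' : Fin n := ⟨q, hqn⟩ with hq'
      refine (does_setDouble (by omega) h7).seq ?_
      rintro _ rfl
      refine (does_setBase hW le_rfl (by simpa using h0) (by simpa using h7) (by simpa using h6)
        hqn hp).seq ?_
      rintro _ rfl
      have hb := hW.block le_rfl hqn hp
      have hqp : q' ≠ p' := fun h => hq.ne (congrArg Fin.val h)
      have hblk : blk (s.nums 2) (n * q + p) = x.cons q' p' := hf q' p' hqp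
      refine (does_pick (fun i : Fin 2 => 2 * p + (i : ℕ))
        (fun τ => (ψ q' ᵥ* unflat (x.cons q' p' τ)) ᵥ* eps) hmem hnd (hpos p) ?_).mono ?_
      · rintro s' j1 j2 j3 τ - i
        refine ⟨hidx hp (by simp [j1, h10]) i, ?_⟩
        have hR8 : s'.ints 8 0 = 16 * (n * q + p) := by simp [j1]
        have hR11 : s'.ints 11 0 = 2 * q := by simp [j1]
        have hold' : s'.vectors n q' = ψ q' := hold s' (fun c hc => by
          rw [j3 c hc]; exact hcell c hc) q' hq.ne
        have hcon : ∀ j, (contractExp τ j).eval s' = (ψ q' ᵥ* unflat (x.cons q' p' τ)) j ∧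
            (contractExp τ j).fits W s' := by
          intro j
          constructor
          · rw [contractExp, eval_sum2]
            simp only [NExp.eval, eval_rd, hR8, hR11, j2 2 (by simp), Memory.setInt_nums, hn]
            rw [← hblk, ← hold']
            rfl
          · refine fits_sum2 fun i => ⟨?_, ?_⟩
            · rw [fits_rd, hR11]; omega
            · have := cell_lt (τ, (i, j))
              rw [fits_rd, hR8]; omega
        rw [vecMul_eps]
        unfold forceExp
        fin_cases i
        · exact ⟨by simp [NExp.eval, (hcon 1).1], trivial, (hcon 1).2⟩
        · exact ⟨by simpa using (hcon 0).1, by simpa using (hcon 0).2⟩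
      · rintro s' ⟨j1, j2, j3, j4⟩
        refine ⟨⟨by simpa [j1] using h0, by simpa [j1] using h6, by simpa [j1] using h10,
          by rw [j2 2 (by simp)]; exact hn, fun c hc => by rw [j3 c hc]; exact hcell c hc, ?_⟩,
          by simpa [j1] using h7⟩
        rcases j4 with ⟨τ, -, hv, hval⟩ | ⟨hz, hval⟩
        · have e : s'.vectors n p' = (ψ q' ᵥ* unflat (x.cons q' p' τ)) ᵥ* eps := funext hval
          rw [e]
          exact ⟨hv, .inr ⟨q', hq, _, x.row_mem_tensors hqp τ, rfl⟩⟩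
        · have e : s'.vectors n p' = s3.vectors n p' := funext hval
          rw [e]
          refine ⟨hne, hF.imp_left fun hF r hr τ => ?_⟩
          rcases Nat.lt_succ_iff_lt_or_eq.1 hr with hr | hr
          · exact hF r hr τ
          · rw [show r = q' from Fin.ext hr]
            exact eq_zero_of_vecMul_eps (hz τ (mem_pairs τ))
    · refine ⟨by simpa [i2] using h0, by simpa [i2] using h6, by simp [i2],
        by rw [n2 2 (by simp)]; exact hn, fun _ _ => rfl, fun h => ?_, .inl (by simp)⟩
      have h1 := v2 0 (by simp)
      have h2 := congrFun h 0
      simp only [Memory.vectors, hp', Fin.val_zero, if_true, Pi.zero_apply] at h1 h2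
      rw [h1] at h2
      exact one_ne_zero h2
    · rintro s' ⟨h0, h6, -, hn, hcell, hne, hF⟩
      refine ⟨⟨h0, hn, fun r hr => ?_⟩, h6⟩
      rcases Nat.lt_succ_iff_lt_or_eq.1 hr with hr | hr
      · have hr1 : ∀ t : Fin n, (t : ℕ) < p → s'.vectors n t = s1.vectors n t := by
          intro t ht
          rw [hold s' hcell t ht.ne]
          funext i
          refine (c2 _ fun i' _ => ?_).trans rfl
          omega
        obtain ⟨g1, g2⟩ := hG r hr
        refine ⟨by rwa [hr1 r hr], ?_⟩
        rw [hr1 r hr]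
        refine g2.imp (fun g q hq φ hφ => ?_) ?_
        · rw [hr1 q (lt_trans hq hr)]
          exact g q hq φ hφ
        · rintro ⟨q, hq, φ, hφ, g⟩
          exact ⟨q, hq, φ, hφ, by rw [hr1 q (lt_trans hq hr), g]⟩
      · obtain rfl : r = p' := Fin.ext hr
        refine ⟨hne, hF.imp (fun g q hq φ hφ => ?_) ?_⟩
        · have hq' : (q : ℕ) < p := hr ▸ hq
          rw [hold s' hcell q hq'.ne]
          exact Instance.vecMul_eq_zero_of_rows hq.ne (g q hq') hφ
        · rintro ⟨q, hq, φ, hφ, g⟩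
          have hq' : (q : ℕ) < p := hr ▸ hq
          exact ⟨q, hq, φ, hφ, by rw [hold s' hcell q hq'.ne, g]⟩
  · rintro s' ⟨h0, -, hG⟩
    exact ⟨h0, Instance.isSA_productVec hx hc (fun p => (hG p p.isLt).1)
      fun p => (hG p p.isLt).2⟩

/-! ### Zero vectors of a projector -/

/-- Stores a nonzero column of the complement of the projector at `R` in array `D`, if there is
any. -/
def pickKer (E D R : ℕ) : Program :=
  pick E pairs (fun τ => .lit (vcell τ)) pairs fun ρ τ =>
    .sub (.lit (if τ = ρ then 1 else 0)) (rd D R (cell (τ, ρ)))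

theorem does_pickKer {W N E D R B : ℕ} {s : Memory} {P : TwoQubitOp} (hD : D ≠ E)
    (hR : s.ints R 0 = 16 * B) (hW : 16 * B + 15 ≤ W) (hP : blk (s.nums D) B = P)
    (hproj : IsStarProjection P) :
    Does W N (pickKer E D R) s fun s' => s'.ints = s.ints ∧ (∀ k ≠ E, s'.nums k = s.nums k) ∧
      ((vec (s'.nums E) ≠ 0 ∧ P *ᵥ vec (s'.nums E) = 0) ∨
        (∀ v, P *ᵥ v = 0 → v = 0) ∧ vec (s'.nums E) = vec (s.nums E)) := by
  refine (does_pick vcell (fun ρ τ => (1 - P) τ ρ) mem_pairs nodup_pairs vcell_injective ?_).mono ?_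
  · rintro s' h1 h2 - ρ - τ
    have hc := cell_lt (τ, ρ)
    have hv := vcell_lt τ
    refine ⟨⟨rfl, ?_⟩, ?_, trivial, ?_⟩
    · change vcell τ ≤ W; omega
    · simp only [NExp.eval, eval_rd, h1, hR, h2 D hD, Matrix.sub_apply, Matrix.one_apply, ← hP]
      congr 1
      split_ifs <;> simp
    · rw [fits_rd, h1, hR]; omega
  · rintro s' ⟨h1, h2, -, h3⟩
    refine ⟨h1, h2, ?_⟩
    rcases h3 with ⟨ρ, -, hne, hval⟩ | ⟨hz, hval⟩
    · have e : vec (s'.nums E) = fun τ => (1 - P) τ ρ := funext hval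
      rw [e]
      exact .inl ⟨hne, mulVec_col_one_sub hproj ρ⟩
    · exact .inr ⟨eq_zero_of_mulVec_eq_zero_of_cols fun ρ => hz ρ (mem_pairs ρ), funext hval⟩

/-- Computes a zero vector of the recorded pair, in array `6`. -/
def kerProg : Program := .seq (setBase 10 0 3 4) (pickKer 6 2 10)

theorem does_kerProg {W n : ℕ} {s : Memory} {x : Instance n} {a b : Fin n} (hW : Roomy W n)
    (h0 : s.ints 0 0 = n) (hf : Full (s.nums 2) x) (hab : a < b) (h3 : s.ints 3 0 = a)
    (h4 : s.ints 4 0 = b) (hr : (x.cons a b).rank < 4) :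
    Does W n kerProg s fun s' => s'.ints = (s.setInt 10 0 (16 * (n * a + b))).ints ∧
      (∀ k ≠ 6, s'.nums k = s.nums k) ∧ vec (s'.nums 6) ≠ 0 ∧
      x.cons a b *ᵥ vec (s'.nums 6) = 0 := by
  refine (does_setBase hW le_rfl h0 h3 h4 a.isLt b.isLt).seq ?_
  rintro _ rfl
  refine (does_pickKer (P := x.cons a b) (by simp) (by simp) (hW.block le_rfl a.isLt b.isLt)
    (by simpa using hf a b hab.ne) (x.isStarProjection_cons hab.ne)).mono ?_
  rintro s' ⟨h1, h2, h3⟩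
  refine ⟨h1, h2, ?_⟩
  rcases h3 with h3 | ⟨h3, -⟩
  · exact h3
  · obtain ⟨v, hv, hPv⟩ := (exists_mulVec_eq_zero_iff_rank_lt (P := x.cons a b)).2
      (by simpa using hr)
    exact absurd (h3 v hPv) hv

/-- Overwrites array `7` by a zero vector of the projector `e` that is orthogonal to the vector in
array `6`, if there is any but zero. -/
def orthProg (e : Fin 2 × Fin 2 → Fin 2 × Fin 2 → NExp) : Program :=
  .seq (setBlk 8 15 e) (.seq (addTensorProg 8 15 fun τ => .conj (vc 6 τ)) (pickKer 7 8 15))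

theorem does_orthProg {W N : ℕ} {e : Fin 2 × Fin 2 → Fin 2 × Fin 2 → NExp} {s : Memory}
    {P : TwoQubitOp} (hW : 40 ≤ W) (h15 : s.ints 15 0 = 0) (hP : IsStarProjection P)
    (H : ∀ s' : Memory, s'.ints = s.ints → (∀ k ≠ 8, s'.nums k = s.nums k) →
      ∀ τ ρ, (e τ ρ).eval s' = P τ ρ ∧ (e τ ρ).fits W s') :
    Does W N (orthProg e) s fun s' => s'.ints = s.ints ∧
      (∀ k, k ≠ 3 → k ≠ 7 → k ≠ 8 → s'.nums k = s.nums k) ∧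
      ((vec (s'.nums 7) ≠ 0 ∧ P *ᵥ vec (s'.nums 7) = 0 ∧
          star (vec (s.nums 6)) ⬝ᵥ vec (s'.nums 7) = 0) ∨
        (∀ v, P *ᵥ v = 0 → star (vec (s.nums 6)) ⬝ᵥ v = 0 → v = 0) ∧
          vec (s'.nums 7) = vec (s.nums 7)) := by
  refine (does_setBlk (B := 0) P (by simpa using h15) (by omega)
    fun s' h1 h2 _ τ ρ _ => H s' h1 h2 τ ρ).seq ?_
  rintro s1 ⟨i1, n1, b1, -⟩
  refine (does_addTensorProg (B := 0) (star (vec (s.nums 6))) (by simp) (by simpa [i1] using h15)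
    (by omega) ?_).seq ?_
  · intro s' j1 j2 τ
    refine ⟨?_, fits_vc (by omega) 6 τ⟩
    simp only [NExp.eval, eval_vc]
    rw [j2 6 (by simp), n1 6 (by simp)]
    rfl
  rintro s2 ⟨i2, n2, b2, -⟩
  rw [b1] at b2
  refine (does_pickKer (B := 0) (P := addTensor P (star (vec (s.nums 6)))) (by simp)
    (by simpa [i1, i2] using h15) (by omega) b2 (isStarProjection_addTensor hP _)).mono ?_
  rintro s3 ⟨i3, n3, h3⟩
  simp only [addTensor_mulVec_eq_zero_iff hP] at h3
  refine ⟨by rw [i3, i2, i1], fun k h h' h'' => by rw [n3 k h', n2 k h h'', n1 k h''], ?_⟩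
  refine h3.imp_right ?_
  rintro ⟨h4, h5⟩
  exact ⟨fun v h h' => h4 v ⟨h, h'⟩, by rw [h5, n2 7 (by simp) (by simp), n1 7 (by simp)]⟩

/-- Computes the two columns of the embedding of a logical qubit. The second one is orthogonal to
the first one, and a zero vector of the projector if possible. -/
def embedProg : Program :=
  .seq kerProg (.seq (setReg 15 (.lit 0)) (.seq (orthProg fun _ _ => .lit 0)
    (orthProg fun τ ρ => rd 2 10 (cell (τ, ρ)))))

/-- The matrix with columns `v₀`, `v₁`. -/
def colsMatrix (v₀ v₁ : Fin 2 × Fin 2 → ℂ) : Matrix (Fin 2 × Fin 2) (Fin 2) ℂ :=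
  Matrix.of fun τ s => if s = 0 then v₀ τ else v₁ τ

theorem does_embedProg {W n : ℕ} {s : Memory} {x : Instance n} {a b : Fin n} (hW : Roomy W n)
    (h0 : s.ints 0 0 = n) (hf : Full (s.nums 2) x) (hab : a < b) (h3 : s.ints 3 0 = a)
    (h4 : s.ints 4 0 = b) (hr2 : 2 ≤ (x.cons a b).rank) (hr : (x.cons a b).rank < 4) :
    Does W n embedProg s fun s' =>
      (∀ k, k ≠ 10 → k ≠ 15 → s'.ints k = s.ints k) ∧ s'.ints 10 0 = 16 * (n * a + b) ∧
      s'.nums 2 = s.nums 2 ∧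
      Function.Injective (colsMatrix (vec (s'.nums 6)) (vec (s'.nums 7))).mulVec ∧
      ∀ v, x.cons a b *ᵥ v = 0 →
        ∃ u, (colsMatrix (vec (s'.nums 6)) (vec (s'.nums 7))).mulVec u = v := by
  have hWn := hW.le
  refine (does_kerProg hW h0 hf hab h3 h4 hr).seq ?_
  rintro s1 ⟨i1, n1, hv0, hPv0⟩
  refine (does_setReg (Q := fun s' => s' = s1.setInt 15 0 0) (Nat.zero_le _) rfl).seq ?_
  rintro _ rfl
  refine (does_orthProg (P := 0) (by omega) (by simp) (.zero _)
    fun s' _ _ τ ρ => by simp [NExp.eval, NExp.fits]).seq ?_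
  rintro s2 ⟨i2, n2, h2⟩
  simp only [Memory.setInt_nums] at n2 h2
  have hb := hW.block le_rfl a.isLt b.isLt
  have e10 : s2.ints 10 0 = 16 * (n * a + b) := by simp [i2, i1]
  have e6 : s2.nums 6 = s1.nums 6 := n2 6 (by simp) (by simp) (by simp)
  have e2 : s2.nums 2 = s.nums 2 := by
    rw [n2 2 (by simp) (by simp) (by simp), n1 2 (by simp)]
  have h7 : vec (s2.nums 7) ≠ 0 ∧ star (vec (s1.nums 6)) ⬝ᵥ vec (s2.nums 7) = 0 := by
    rcases h2 with ⟨g1, -, g2⟩ | ⟨g, -⟩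
    · exact ⟨g1, g2⟩
    · have g' := rank_addTensor_le (0 : TwoQubitOp) (star (vec (s1.nums 6)))
      rw [rank_zero] at g'
      obtain ⟨v, hv, hPv⟩ := (exists_mulVec_eq_zero_iff_rank_lt
        (P := addTensor (0 : TwoQubitOp) (star (vec (s1.nums 6))))).2 (by simp; omega)
      exact absurd (g v (zero_mulVec v) ((addTensor_mulVec_eq_zero_iff (.zero _) _ _).1 hPv).2) hv
  refine (does_orthProg (P := x.cons a b) (by omega) (by simp [i2])
    (x.isStarProjection_cons hab.ne) ?_).mono ?_
  · intro s' j1 j2 τ ρ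
    have := cell_lt (τ, ρ)
    rw [eval_rd, fits_rd, j1, e10, j2 2 (by simp), e2, ← hf a b hab.ne]
    exact ⟨rfl, by omega⟩
  · rintro s3 ⟨i3, n3, h3⟩
    refine ⟨fun k hk hk' => by simp [i3, i2, i1, hk, hk'], by rw [i3, e10],
      by rw [n3 2 (by simp) (by simp) (by simp), e2], ?_⟩
    have e6' : vec (s3.nums 6) = vec (s1.nums 6) := by
      rw [n3 6 (by simp) (by simp) (by simp), e6]
    rw [e6] at h3
    rw [e6']
    refine exists_mulVec_eq_of_finrank_le hv0 ?_ ?_ hPv0 (by simpa using hr2) ?_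
    · rcases h3 with h3 | ⟨-, h3⟩
      · exact h3.1
      · rw [h3]; exact h7.1
    · rcases h3 with h3 | ⟨-, h3⟩
      · exact h3.2.2
      · rw [h3]; exact h7.2
    · exact h3.imp (fun h => h.2.1) fun h => h.1

/-! ### Projectors from lists of tensors -/

/-- Sets the block at `R` of array `0` to the projector onto the span of the tensors `w x`. -/
def newBlk {α : Type} (R : ℕ) (L : List α) (w : α → Fin 2 × Fin 2 → NExp) : Program :=
  .seq (setBlk 0 R fun _ _ => .lit 0) (addAll 0 R L w)

theorem does_newBlk {α : Type} {W N R B : ℕ} {L : List α} {w : α → Fin 2 × Fin 2 → NExp}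
    {s : Memory} (v : α → Fin 2 × Fin 2 → ℂ) (hR : s.ints R 0 = 16 * B) (hW : 16 * B + 15 ≤ W)
    (H : ∀ s' : Memory, s'.ints = s.ints → (∀ k, k ≠ 3 → k ≠ 0 → s'.nums k = s.nums k) →
      ∀ x ∈ L, ∀ τ, (w x τ).eval s' = v x τ ∧ (w x τ).fits W s') :
    Does W N (newBlk R L w) s fun s' => s'.ints = s.ints ∧
      (∀ k, k ≠ 3 → k ≠ 0 → s'.nums k = s.nums k) ∧
      IsStarProjection (blk (s'.nums 0) B) ∧
      (∀ u, blk (s'.nums 0) B *ᵥ u = 0 ↔ ∀ x ∈ L, v x ⬝ᵥ u = 0) ∧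
      ∀ B' ≠ B, blk (s'.nums 0) B' = blk (s.nums 0) B' := by
  refine (does_setBlk (B := B) 0 hR hW fun s' _ _ _ τ ρ _ => by
    simp [NExp.eval, NExp.fits]).seq ?_
  rintro s1 ⟨i1, n1, b1, c1⟩
  refine (does_addAll (B := B) v (by simp) (by rw [i1, hR]) hW fun s' j1 j2 x hx τ =>
    H s' (j1.trans i1) (fun k h h' => by rw [j2 k h h', n1 k h']) x hx τ).mono ?_
  rintro s2 ⟨i2, n2, b2, c2⟩
  obtain ⟨g1, g2⟩ := foldl_addTensor v L (IsStarProjection.zero TwoQubitOp)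
  rw [b1] at b2
  refine ⟨i2.trans i1, fun k h h' => by rw [n2 k h h', n1 k h'], by rw [b2]; exact g1, fun u => ?_,
    fun B' hB => by rw [c2 B' hB, c1 B' hB]⟩
  rw [b2, g2]
  simp

/-! ### Merging two qubits -/

/-- The tensors imposed on the logical qubit and a third qubit: the rows of `P₀` (at the first
merged qubit and the third one), of `P₁` (at the second merged qubit and the third one) and of
`P₂` (at the merged qubits), contracted with the embedding `V`. -/
def mergeTensor (P₀ P₁ P₂ : TwoQubitOp) (V : Matrix (Fin 2 × Fin 2) (Fin 2) ℂ) :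
    Fin 3 × (Fin 2 × Fin 2) × Fin 2 → Fin 2 × Fin 2 → ℂ
  | (0, τ, i₂), κ => ∑ i, P₀ τ (i, κ.2) * V (i, i₂) κ.1
  | (1, τ, i₁), κ => ∑ i, P₁ τ (i, κ.2) * V (i₁, i) κ.1
  | (2, τ, j), κ => if κ.2 = j then ∑ ρ, P₂ τ ρ * V ρ κ.1 else 0

theorem mergeTensor_dotProduct_eq_zero_iff (P₀ P₁ P₂ : TwoQubitOp)
    (V : Matrix (Fin 2 × Fin 2) (Fin 2) ℂ) (v : Fin 2 × Fin 2 → ℂ) :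
    (∀ x, mergeTensor P₀ P₁ P₂ V x ⬝ᵥ v = 0) ↔
      (∀ i₂, P₀ *ᵥ (fun τ => ∑ s, V (τ.1, i₂) s * v (s, τ.2)) = 0) ∧
      (∀ i₁, P₁ *ᵥ (fun τ => ∑ s, V (i₁, τ.1) s * v (s, τ.2)) = 0) ∧
      ∀ j, P₂ *ᵥ (fun τ => ∑ s, V τ s * v (s, j)) = 0 := by
  have h0 : ∀ τ i₂, mergeTensor P₀ P₁ P₂ V (0, τ, i₂) ⬝ᵥ v =
      P₀ τ ⬝ᵥ fun τ => ∑ s, V (τ.1, i₂) s * v (s, τ.2) := by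
    intro τ i₂
    simp only [mergeTensor, dotProduct, Fintype.sum_prod_type, Fin.sum_univ_two]
    ring
  have h1 : ∀ τ i₁, mergeTensor P₀ P₁ P₂ V (1, τ, i₁) ⬝ᵥ v =
      P₁ τ ⬝ᵥ fun τ => ∑ s, V (i₁, τ.1) s * v (s, τ.2) := by
    intro τ i₁
    simp only [mergeTensor, dotProduct, Fintype.sum_prod_type, Fin.sum_univ_two]
    ring
  have h2 : ∀ τ j, mergeTensor P₀ P₁ P₂ V (2, τ, j) ⬝ᵥ v =
      P₂ τ ⬝ᵥ fun τ => ∑ s, V τ s * v (s, j) := by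
    intro τ j
    fin_cases j <;>
    · simp only [mergeTensor, dotProduct, Fintype.sum_prod_type, Fin.sum_univ_two]
      simp
      ring
  simp only [mulVec_eq_zero_iff_row, ← h0, ← h1, ← h2]
  constructor
  · intro h
    exact ⟨fun i τ => h (0, τ, i), fun i τ => h (1, τ, i), fun j τ => h (2, τ, j)⟩
  · rintro ⟨g0, g1, g2⟩ ⟨k, τ, i⟩
    fin_cases k
    · exact g0 i τ
    · exact g1 i τ
    · exact g2 i τ

/-- An entry of the embedding of the logical qubit. -/
def embedExp (τ : Fin 2 × Fin 2) (s : Fin 2) : NExp := vc (if s = 0 then 6 else 7) τ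

/-- Computes the entries of `mergeTensor`; the blocks of `P₀`, `P₁`, `P₂` are given by the
registers `8`, `9`, `10`. -/
def mergeExp : Fin 3 × (Fin 2 × Fin 2) × Fin 2 → Fin 2 × Fin 2 → NExp
  | (0, τ, i₂), κ => sum2 fun i => .mul (rd 2 8 (cell (τ, (i, κ.2)))) (embedExp (i, i₂) κ.1)
  | (1, τ, i₁), κ => sum2 fun i => .mul (rd 2 9 (cell (τ, (i, κ.2)))) (embedExp (i₁, i) κ.1)
  | (2, τ, j), κ =>
    if κ.2 = j then sum4 fun ρ => .mul (rd 2 10 (cell (τ, ρ))) (embedExp ρ κ.1) else .lit 0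

theorem eval_embedExp (τ : Fin 2 × Fin 2) (t : Fin 2) (s : Memory) :
    (embedExp τ t).eval s = colsMatrix (vec (s.nums 6)) (vec (s.nums 7)) τ t := by
  unfold embedExp colsMatrix
  rw [eval_vc, Matrix.of_apply]
  split_ifs <;> rfl

theorem eval_rd_block {D R B : ℕ} {s : Memory} (hR : s.ints R 0 = 16 * B) (τ ρ : Fin 2 × Fin 2) :
    (rd D R (cell (τ, ρ))).eval s = blk (s.nums D) B τ ρ := by
  rw [eval_rd, hR]
  rfl

theorem fits_rd_block {W D R B : ℕ} {s : Memory} (hR : s.ints R 0 = 16 * B)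
    (hW : 16 * B + 15 ≤ W) (o : (Fin 2 × Fin 2) × (Fin 2 × Fin 2)) :
    (rd D R (cell o)).fits W s := by
  have := cell_lt o
  rw [fits_rd, hR]
  omega

theorem eval_mergeExp {W B₀ B₁ B₂ : ℕ} {s : Memory} (h0 : s.ints 8 0 = 16 * B₀)
    (h1 : s.ints 9 0 = 16 * B₁) (h2 : s.ints 10 0 = 16 * B₂) (hW0 : 16 * B₀ + 15 ≤ W)
    (hW1 : 16 * B₁ + 15 ≤ W) (hW2 : 16 * B₂ + 15 ≤ W)
    (x : Fin 3 × (Fin 2 × Fin 2) × Fin 2) (κ : Fin 2 × Fin 2) :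
    (mergeExp x κ).eval s = mergeTensor (blk (s.nums 2) B₀) (blk (s.nums 2) B₁)
      (blk (s.nums 2) B₂) (colsMatrix (vec (s.nums 6)) (vec (s.nums 7))) x κ ∧
      (mergeExp x κ).fits W s := by
  have hv : ∀ τ t, (embedExp τ t).fits W s := fun τ t => fits_vc (by omega) _ τ
  obtain ⟨k, τ, i⟩ := x
  fin_cases k
  · refine ⟨?_, fits_sum2 (f := fun i => .mul (rd 2 8 (cell (τ, (i, κ.2)))) (embedExp (i, _) κ.1))
      fun i => ⟨fits_rd_block h0 hW0 _, hv _ _⟩⟩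
    simp only [mergeExp, mergeTensor, eval_sum2, NExp.eval, eval_rd_block h0, eval_embedExp]
  · refine ⟨?_, fits_sum2 (f := fun i => .mul (rd 2 9 (cell (τ, (i, κ.2)))) (embedExp (_, i) κ.1))
      fun i => ⟨fits_rd_block h1 hW1 _, hv _ _⟩⟩
    simp only [mergeExp, mergeTensor, eval_sum2, NExp.eval, eval_rd_block h1, eval_embedExp]
  · simp only [mergeExp, mergeTensor]
    split_ifs
    · refine ⟨?_, fits_sum4 fun i => ⟨fits_rd_block h2 hW2 _, hv _ _⟩⟩
      simp only [eval_sum4, NExp.eval, eval_rd_block h2, eval_embedExp]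
    · exact ⟨by simp [NExp.eval], trivial⟩

/-- The old name of the qubit `p` after a merger of `a` and `b`: the logical qubit is `0`, the old
qubit `0` takes the place of `a`, and the last one takes the place of `b`. -/
def mergeMap (a b m p : ℕ) : ℕ := if p = 0 then a else if p = b then m else if p = a then 0 else p

/-- `R := mergeMap a b m u`, for `a`, `b`, `m` in the registers `3`, `4`, `11`. -/
def mapReg (R u : ℕ) : Program :=
  .ite (.eqI (reg u) (.lit 0)) (setReg R (reg 3))
    (.ite (.eqI (reg u) (reg 4)) (setReg R (reg 11))
      (.ite (.eqI (reg u) (reg 3)) (setReg R (.lit 0)) (setReg R (reg u))))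

theorem does_mapReg {W N R u a b m p : ℕ} {s : Memory} (h3 : s.ints 3 0 = a) (h4 : s.ints 4 0 = b)
    (h11 : s.ints 11 0 = m) (hu : s.ints u 0 = p) (ha : a ≤ W) (hb : b ≤ W) (hm : m ≤ W)
    (hp : p ≤ W) :
    Does W N (mapReg R u) s fun s' => s' = s.setInt R 0 (mergeMap a b m p) := by
  have f : ∀ {k v : ℕ}, s.ints k 0 = v → v ≤ W → (reg k).fits W s := fun h h' =>
    fits_reg (h.trans_le h')
  unfold mergeMap
  refine does_ite (Test.eqI_fits (f hu hp) (Nat.zero_le _)) (fun h => ?_) fun h => ?_ <;>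
    simp only [Test.eqI_holds, IExp.eval, hu] at h
  · exact does_setReg (f h3 ha) (by simp [IExp.eval, h, h3])
  refine does_ite (Test.eqI_fits (f hu hp) (f h4 hb)) (fun h' => ?_) fun h' => ?_ <;>
    simp only [Test.eqI_holds, IExp.eval, hu, h4] at h'
  · exact does_setReg (f h11 hm) (by simp only [IExp.eval, h11, if_neg h, if_pos h'])
  refine does_ite (Test.eqI_fits (f hu hp) (f h3 ha)) (fun h'' => ?_) fun h'' => ?_ <;>
    simp only [Test.eqI_holds, IExp.eval, hu, h3] at h''
  · exact does_setReg (Nat.zero_le _) (by simp only [IExp.eval, if_neg h, if_neg h', if_pos h''])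
  · exact does_setReg (f hu hp) (by simp only [IExp.eval, hu, if_neg h, if_neg h', if_neg h''])

/-- Computes the projector of the pair in the registers `6`, `7` of the merged instance. -/
def mergeBody : Program :=
  .seq (setBase 12 11 6 7) (.seq (mapReg 13 7)
    (.ite (.eqI (reg 6) (.lit 0))
      (.seq (setBase 8 0 3 13) (.seq (setBase 9 0 4 13)
        (newBlk 12 ([(0 : Fin 3), 1, 2] ×ˢ (pairs ×ˢ [(0 : Fin 2), 1])) mergeExp)))
      (.seq (mapReg 14 6) (.seq (setBase 8 0 14 13)
        (newBlk 12 pairs fun τ κ => rd 2 8 (cell (τ, κ)))))))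

section MergeMap

variable {a b n m p q : ℕ}

theorem mergeMap_lt (hab : a < b) (hb : b < m + 1) (hp : p < m) :
    mergeMap a b m p < m + 1 := by
  unfold mergeMap
  split_ifs <;> omega

theorem mergeMap_ne (hab : a < b) (hp : p < m) :
    mergeMap a b m p ≠ b := by
  unfold mergeMap
  split_ifs <;> omega

theorem mergeMap_inj (hab : a < b) (hp : p < m) (hq : q < m)
    (h : mergeMap a b m p = mergeMap a b m q) : p = q := by
  unfold mergeMap at h
  split_ifs at h <;> omega

theorem exists_mergeMap_eq (hab : a < b) (hb : b < n) (hm : m + 1 = n) (hp : p < n) (hpb : p ≠ b) :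
    ∃ r < m, mergeMap a b m r = p := by
  unfold mergeMap
  by_cases h1 : p = a
  · exact ⟨0, by omega, by simp [h1]⟩
  by_cases h2 : p = m
  · exact ⟨b, by omega, by rw [if_neg (by omega), if_pos rfl, h2]⟩
  by_cases h3 : p = 0
  · exact ⟨a, by omega, by rw [if_neg (by omega), if_neg (by omega), if_pos rfl, h3]⟩
  · exact ⟨p, by omega, by rw [if_neg h3, if_neg hpb, if_neg h1]⟩

end MergeMap

/-- Merges the recorded pair. -/
def mergeProg : Program :=
  .seq embedProg (.seq (setReg 11 (.sub (reg 0) (.lit 1)))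
    (.seq (forPairs 11 mergeBody) (.seq (setReg 0 (reg 11)) (setReg 1 (.lit 3)))))

theorem does_mergeProg {W n : ℕ} {s : Memory} {x : Instance n} {a b : Fin n} (hW : Roomy W n)
    (hn : 3 ≤ n) (h0 : s.ints 0 0 = n) (hf : Full (s.nums 2) x) (hab : a < b)
    (h3 : s.ints 3 0 = a) (h4 : s.ints 4 0 = b) (hr2 : 2 ≤ (x.proj a b).rank)
    (hr : (x.proj a b).rank < 4) :
    Does W n mergeProg s fun s' => s'.ints 0 0 < n ∧ s'.ints 1 0 = 3 ∧
      ∃ m, m < n ∧ ∃ y : Instance m, Holds s' y ∧ MergesTo x y a b := by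
  have hWn := hW.le
  obtain ⟨m, rfl⟩ : ∃ m, n = m + 1 := ⟨n - 1, by omega⟩
  have ha := a.isLt
  have hb := b.isLt
  have hab' : (a : ℕ) < b := hab
  rw [← x.cons_of_lt hab] at hr2 hr
  refine (does_embedProg hW h0 hf hab h3 h4 hr2 hr).seq ?_
  rintro s1 ⟨i1, e10, n1, hVinj, hVker⟩
  refine (does_setReg (e := .sub (reg 0) (.lit 1)) (Q := fun s' => s' = s1.setInt 11 0 m)
    ⟨fits_reg ?_, ?_⟩ ?_).seq ?_
  · rw [i1 0 (by simp) (by simp)]; omega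
  · change 1 ≤ W; omega
  · simp [IExp.eval, i1 0, h0]
  rintro _ rfl
  set V := colsMatrix (vec (s1.nums 6)) (vec (s1.nums 7)) with hV
  let e : Fin m → Fin (m + 1) := fun p => ⟨mergeMap a b m p, mergeMap_lt hab hb p.isLt⟩
  -- the correct blocks: the logical qubit is `0`, so it can only be the first one of a pair
  let Ker : Fin m → Fin m → TwoQubitOp → Prop := fun p q P => IsStarProjection P ∧ ∀ v,
    P *ᵥ v = 0 ↔ ((p : ℕ) = 0 → ∀ t, mergeTensor (x.cons a (e q)) (x.cons b (e q)) (x.cons a b) V t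
      ⬝ᵥ v = 0) ∧ ((p : ℕ) ≠ 0 → x.cons (e p) (e q) *ᵥ v = 0)
  refine (does_forPairs (W := W) (N := m + 1) (m := m)
    (fun S s' => s'.ints 11 0 = m ∧ s'.ints 0 0 = m + 1 ∧ s'.ints 3 0 = a ∧ s'.ints 4 0 = b ∧
    s'.ints 10 0 = 16 * ((m + 1) * a + b) ∧
    s'.nums 2 = s.nums 2 ∧ s'.nums 6 = s1.nums 6 ∧ s'.nums 7 = s1.nums 7 ∧
    ∀ p q : Fin m, p < q → ((p : ℕ), (q : ℕ)) ∈ S → Ker p q (blk (s'.nums 0) (m * p + q)))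
    (by omega) (by omega) (fun _ _ h => h.1) (fun _ s' v h => by simpa using h)
    (fun _ s' v h => by simpa using h) ?_
    ⟨s1.setInt_ints_self 11 0 m, by simp [i1 0, h0], by simp [i1 3, h3], by simp [i1 4, h4],
      by simp [e10], n1, rfl, rfl, by simp⟩).seq ?_
  · rintro S s2 p q hpq hq - ⟨g11, g0, g3, g4, g10, gn2, gn6, gn7, hJ⟩ h6 h7
    have hp : p < m := hpq.trans hq
    have hbm := hW.block (Nat.le_succ m) hp hq
    set p' : Fin m := ⟨p, hp⟩ with hp'
    set q' : Fin m := ⟨q, hq⟩ with hq'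
    have heq : mergeMap a b m q < m + 1 := mergeMap_lt hab hb hq
    have hep : mergeMap a b m p < m + 1 := mergeMap_lt hab hb hp
    have hea : a ≠ e q' := fun h => by
      have h' : mergeMap a b m 0 = mergeMap a b m q :=
        (congrArg Fin.val h : (a : ℕ) = mergeMap a b m q)
      have := mergeMap_inj hab (by omega) hq h'
      omega
    have heb : b ≠ e q' := fun h => mergeMap_ne hab hq (congrArg Fin.val h).symm
    have hfin : ∀ s' : Memory, s'.ints 11 0 = m → s'.ints 0 0 = m + 1 → s'.ints 3 0 = a →
        s'.ints 4 0 = b → s'.ints 10 0 = 16 * ((m + 1) * a + b) → s'.ints 6 0 = p →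
        s'.ints 7 0 = q →
        (∀ k, k ≠ 3 → k ≠ 0 → s'.nums k = s2.nums k) →
        Ker p' q' (blk (s'.nums 0) (m * p + q)) →
        (∀ B' ≠ m * p + q, blk (s'.nums 0) B' = blk (s2.nums 0) B') →
        (s'.ints 11 0 = m ∧ s'.ints 0 0 = m + 1 ∧ s'.ints 3 0 = a ∧ s'.ints 4 0 = b ∧
          s'.ints 10 0 = 16 * ((m + 1) * a + b) ∧
          s'.nums 2 = s.nums 2 ∧ s'.nums 6 = s1.nums 6 ∧ s'.nums 7 = s1.nums 7 ∧
          ∀ c d : Fin m, c < d → ((c : ℕ), (d : ℕ)) ∈ insert (p, q) S →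
            Ker c d (blk (s'.nums 0) (m * c + d))) ∧ s'.ints 6 0 = p ∧ s'.ints 7 0 = q := by
      intro s' k11 k0 k3 k4 k10 k6 k7 kn hK hB
      refine ⟨⟨k11, k0, k3, k4, k10, by rw [kn 2 (by simp) (by simp), gn2],
        by rw [kn 6 (by simp) (by simp), gn6], by rw [kn 7 (by simp) (by simp), gn7], ?_⟩, k6, k7⟩
      intro c d hcd hS
      by_cases he : c = p' ∧ d = q'
      · rw [he.1, he.2]; exact hK
      · have hne : m * (c : ℕ) + d ≠ m * p + q := fun h => he <| by
          obtain ⟨e1, e2⟩ := block_index_inj d.isLt hq h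
          exact ⟨Fin.ext e1, Fin.ext e2⟩
        rw [hB _ hne]
        refine hJ c d hcd (hS.resolve_left fun h => he ?_)
        rw [Prod.mk.injEq] at h
        exact ⟨Fin.ext h.1, Fin.ext h.2⟩
    refine (does_setBase hW (Nat.le_succ m) g11 h6 h7 hp hq).seq ?_
    rintro _ rfl
    refine (does_mapReg (a := a) (b := b) (m := m) (p := q) (by simpa using g3) (by simpa using g4)
      (by simpa using g11) (by simpa using h7) (by omega) (by omega) (by omega) (by omega)).seq ?_
    rintro _ rfl
    refine does_ite (Test.eqI_fits (fits_reg (by simp; omega)) (Nat.zero_le _)) (fun ht => ?_)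
      fun ht => ?_
    · have hp0 : p = 0 := by simpa [IExp.eval, h6] using ht
      refine (does_setBase hW le_rfl (by simpa using g0) (by simpa using g3) (by simp) ha heq).seq ?_
      rintro _ rfl
      refine (does_setBase hW le_rfl (by simpa using g0) (by simpa using g4) (by simp) hb heq).seq ?_
      rintro _ rfl
      refine (does_newBlk (B := m * p + q)
        (mergeTensor (x.cons a (e q')) (x.cons b (e q')) (x.cons a b) V) (by simp) hbm ?_).mono ?_
      · rintro s' j1 j2 t - κ
        have := eval_mergeExp (W := W) (s := s') (B₀ := (m + 1) * a + mergeMap a b m q)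
          (B₁ := (m + 1) * b + mergeMap a b m q) (B₂ := (m + 1) * a + b) (by rw [j1]; simp)
          (by rw [j1]; simp) (by rw [j1]; simpa using g10) (hW.block le_rfl ha heq)
          (hW.block le_rfl hb heq) (hW.block le_rfl ha hb) t κ
        rw [j2 2 (by simp) (by simp), j2 6 (by simp) (by simp), j2 7 (by simp) (by simp)] at this
        simp only [Memory.setInt_nums, gn2, gn6, gn7] at this
        have e1 : blk (s.nums 2) ((m + 1) * a + mergeMap a b m q) = x.cons a (e q') := hf _ _ hea
        have e2 : blk (s.nums 2) ((m + 1) * b + mergeMap a b m q) = x.cons b (e q') := hf _ _ heb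
        rwa [e1, e2, hf a b hab.ne, ← hV] at this
      · rintro s' ⟨j1, j2, j3, j4, j5⟩
        refine hfin s' ?_ ?_ ?_ ?_ ?_ ?_ ?_ j2 ⟨j3, fun v => ?_⟩ j5
        iterate 7 first | (rw [j1]; simp; assumption)
        rw [j4]
        constructor
        · intro h
          refine ⟨fun _ t => h t ?_, fun h => absurd hp0 h⟩
          obtain ⟨k, τ, i⟩ := t
          refine List.mem_product.2 ⟨?_, List.mem_product.2 ⟨mem_pairs τ, ?_⟩⟩
          · fin_cases k <;> simp
          · fin_cases i <;> simp
        · exact fun h t _ => h.1 hp0 t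
    · have hp0 : p ≠ 0 := by simpa [IExp.eval, h6] using ht
      refine (does_mapReg (a := a) (b := b) (m := m) (p := p) (by simpa using g3)
        (by simpa using g4) (by simpa using g11) (by simpa using h6) (by omega) (by omega)
        (by omega) (by omega)).seq ?_
      rintro _ rfl
      refine (does_setBase hW le_rfl (by simpa using g0) (by simp) (by simp) hep heq).seq ?_
      rintro _ rfl
      have hpq' : e p' ≠ e q' := fun h => by
        have := mergeMap_inj hab hp hq (congrArg Fin.val h)
        omega
      refine (does_newBlk (B := m * p + q) (fun τ => x.cons (e p') (e q') τ) (by simp) hbm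
        ?_).mono ?_
      · rintro s' j1 j2 τ - κ
        have hR : s'.ints 8 0 = 16 * ((m + 1) * mergeMap a b m p + mergeMap a b m q) := by
          rw [j1]; simp
        refine ⟨?_, fits_rd_block hR (hW.block le_rfl hep heq) _⟩
        rw [eval_rd_block hR, j2 2 (by simp) (by simp)]
        simp only [Memory.setInt_nums, gn2]
        rw [← hf _ _ hpq']
      · rintro s' ⟨j1, j2, j3, j4, j5⟩
        refine hfin s' ?_ ?_ ?_ ?_ ?_ ?_ ?_ j2 ⟨j3, fun v => ?_⟩ j5
        iterate 7 first | (rw [j1]; simp; assumption)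
        rw [j4]
        constructor
        · intro h
          exact ⟨fun h => absurd h hp0, fun _ =>
            (mulVec_eq_zero_iff_row _ _).2 fun τ => h τ (mem_pairs τ)⟩
        · exact fun h τ _ => (mulVec_eq_zero_iff_row _ _).1 (h.2 hp0) τ
  · rintro s2 ⟨g11, g0, -, -, -, -, -, -, hJ⟩
    refine (does_setReg (Q := fun s' => s' = s2.setInt 0 0 m) (fits_reg (by omega))
      (by simp [IExp.eval, g11])).seq ?_
    rintro _ rfl
    refine does_setReg (show 3 ≤ W by omega) ⟨by simp, by simp [IExp.eval], m, by omega, ?_⟩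
    have hJ' : ∀ p q : Fin m, p < q → Ker p q (blk (s2.nums 0) (m * p + q)) :=
      fun p q hpq => hJ p q hpq ⟨hpq, q.isLt⟩
    let y : Instance m := ⟨fun p q => blk (s2.nums 0) (m * p + q), fun p q hpq => (hJ' p q hpq).1⟩
    refine ⟨y, holds_of_blk (by simp) fun p q _ => rfl, ?_⟩
    have hm0 : 0 < m := by omega
    have hlt : ∀ q : Fin m, q ≠ ⟨0, hm0⟩ → (⟨0, hm0⟩ : Fin m) < q := fun q hq =>
      Fin.lt_def.2 (Nat.pos_of_ne_zero fun h => hq (Fin.ext h))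
    have hne0 : ∀ q : Fin m, q ≠ ⟨0, hm0⟩ → (q : ℕ) ≠ 0 := fun q hq h => hq (Fin.ext h)
    have hinj : Function.Injective e := fun p q h =>
      Fin.ext (mergeMap_inj hab p.isLt q.isLt (congrArg Fin.val h))
    refine Instance.mergesTo_of (V := V) (c := ⟨0, hm0⟩) (d := ⟨1, by omega⟩) (e := e) hab
      (by simp) hVinj hVker hinj ?_ (Fin.ext (by simp [e, mergeMap])) ?_ ?_
    · ext g
      simp only [Set.mem_range, Set.mem_compl_iff, Set.mem_singleton_iff]
      constructor
      · rintro ⟨p, rfl⟩ h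
        exact mergeMap_ne hab p.isLt (congrArg Fin.val h)
      · intro hg
        obtain ⟨r, hr, hrg⟩ := exists_mergeMap_eq hab hb rfl g.isLt fun h => hg (Fin.ext h)
        exact ⟨⟨r, hr⟩, Fin.ext hrg⟩
    · have key : ∀ p q : Fin m, p < q → p ≠ ⟨0, hm0⟩ → ∀ v,
          y.cons p q *ᵥ v = 0 ↔ x.cons (e p) (e q) *ᵥ v = 0 := by
        intro p q hpq hp v
        rw [y.cons_of_lt hpq]
        refine ((hJ' p q hpq).2 v).trans ⟨fun h => h.2 (hne0 p hp), fun h => ⟨fun h0 =>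
          absurd h0 (hne0 p hp), fun _ => h⟩⟩
      intro p q hpq hp hq v
      rcases lt_or_gt_of_ne hpq with hl | hl
      · exact key p q hl hp v
      · rw [y.cons_swap hpq.symm, x.cons_swap fun h => hpq (hinj h).symm,
          submatrix_swap_mulVec_eq_zero_iff, submatrix_swap_mulVec_eq_zero_iff]
        exact key q p hl hq _
    · intro q hq v
      rw [y.cons_of_lt (hlt q hq), ← mergeTensor_dotProduct_eq_zero_iff]
      exact ((hJ' _ q (hlt q hq)).2 v).trans ⟨fun h => h.1 rfl, fun h => ⟨fun _ => h, fun h0 =>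
        absurd rfl h0⟩⟩

/-! ### Eliminating two qubits -/

/-- The tensors imposed on two qubits `p`, `q` after two others are put in the state `φ`: the rows
of the projector `P` of `p` and `q`, and those of the projectors `Ap`, `Bp`, `Aq`, `Bq` that link
them to the eliminated qubits, contracted with `φ`. -/
def elimTensor (P Ap Bp Aq Bq : TwoQubitOp) (φ : Fin 2 × Fin 2 → ℂ) :
    Fin 5 × (Fin 2 × Fin 2) × Fin 2 × Fin 2 → Fin 2 × Fin 2 → ℂ
  | (0, τ, _, _), κ => P τ κ
  | (1, τ, i₂, j), κ => if κ.2 = j then ∑ i, Ap τ (i, κ.1) * φ (i, i₂) else 0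
  | (2, τ, i₁, j), κ => if κ.2 = j then ∑ i, Bp τ (i, κ.1) * φ (i₁, i) else 0
  | (3, τ, i₂, j), κ => if κ.1 = j then ∑ i, Aq τ (i, κ.2) * φ (i, i₂) else 0
  | (4, τ, i₁, j), κ => if κ.1 = j then ∑ i, Bq τ (i, κ.2) * φ (i₁, i) else 0

theorem elimTensor_dotProduct_eq_zero_iff (P Ap Bp Aq Bq : TwoQubitOp)
    (φ v : Fin 2 × Fin 2 → ℂ) :
    (∀ x, elimTensor P Ap Bp Aq Bq φ x ⬝ᵥ v = 0) ↔ P *ᵥ v = 0 ∧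
      (∀ j, (∀ i₂, Ap *ᵥ (fun τ => φ (τ.1, i₂) * v (τ.2, j)) = 0) ∧
        ∀ i₁, Bp *ᵥ (fun τ => φ (i₁, τ.1) * v (τ.2, j)) = 0) ∧
      ∀ j, (∀ i₂, Aq *ᵥ (fun τ => φ (τ.1, i₂) * v (j, τ.2)) = 0) ∧
        ∀ i₁, Bq *ᵥ (fun τ => φ (i₁, τ.1) * v (j, τ.2)) = 0 := by
  have h1 : ∀ τ i j, elimTensor P Ap Bp Aq Bq φ (1, τ, i, j) ⬝ᵥ v =
      Ap τ ⬝ᵥ fun τ => φ (τ.1, i) * v (τ.2, j) := by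
    intro τ i j
    fin_cases j <;>
    · simp [elimTensor, dotProduct, Fintype.sum_prod_type, Fin.sum_univ_two]
      ring
  have h2 : ∀ τ i j, elimTensor P Ap Bp Aq Bq φ (2, τ, i, j) ⬝ᵥ v =
      Bp τ ⬝ᵥ fun τ => φ (i, τ.1) * v (τ.2, j) := by
    intro τ i j
    fin_cases j <;>
    · simp [elimTensor, dotProduct, Fintype.sum_prod_type, Fin.sum_univ_two]
      ring
  have h3 : ∀ τ i j, elimTensor P Ap Bp Aq Bq φ (3, τ, i, j) ⬝ᵥ v =
      Aq τ ⬝ᵥ fun τ => φ (τ.1, i) * v (j, τ.2) := by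
    intro τ i j
    fin_cases j <;>
    · simp [elimTensor, dotProduct, Fintype.sum_prod_type, Fin.sum_univ_two]
      ring
  have h4 : ∀ τ i j, elimTensor P Ap Bp Aq Bq φ (4, τ, i, j) ⬝ᵥ v =
      Bq τ ⬝ᵥ fun τ => φ (i, τ.1) * v (j, τ.2) := by
    intro τ i j
    fin_cases j <;>
    · simp [elimTensor, dotProduct, Fintype.sum_prod_type, Fin.sum_univ_two]
      ring
  simp only [mulVec_eq_zero_iff_row, ← h1, ← h2, ← h3, ← h4]
  constructor
  · intro h
    exact ⟨fun τ => h (0, τ, 0, 0), fun j => ⟨fun i τ => h (1, τ, i, j), fun i τ => h (2, τ, i, j)⟩,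
      fun j => ⟨fun i τ => h (3, τ, i, j), fun i τ => h (4, τ, i, j)⟩⟩
  · rintro ⟨g0, g1, g2⟩ ⟨k, τ, i, j⟩
    fin_cases k
    · exact g0 τ
    · exact (g1 j).1 i τ
    · exact (g1 j).2 i τ
    · exact (g2 j).1 i τ
    · exact (g2 j).2 i τ

/-- Computes the entries of `elimTensor`; the blocks of `P`, `Ap`, `Bp`, `Aq`, `Bq` are given by the
registers `8`, `9`, `10`, `16`, `17`. -/
def elimExp : Fin 5 × (Fin 2 × Fin 2) × Fin 2 × Fin 2 → Fin 2 × Fin 2 → NExp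
  | (0, τ, _, _), κ => rd 2 8 (cell (τ, κ))
  | (1, τ, i₂, j), κ =>
    if κ.2 = j then sum2 fun i => .mul (rd 2 9 (cell (τ, (i, κ.1)))) (vc 6 (i, i₂)) else .lit 0
  | (2, τ, i₁, j), κ =>
    if κ.2 = j then sum2 fun i => .mul (rd 2 10 (cell (τ, (i, κ.1)))) (vc 6 (i₁, i)) else .lit 0
  | (3, τ, i₂, j), κ =>
    if κ.1 = j then sum2 fun i => .mul (rd 2 16 (cell (τ, (i, κ.2)))) (vc 6 (i, i₂)) else .lit 0
  | (4, τ, i₁, j), κ =>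
    if κ.1 = j then sum2 fun i => .mul (rd 2 17 (cell (τ, (i, κ.2)))) (vc 6 (i₁, i)) else .lit 0

theorem eval_contraction {W R B : ℕ} {s : Memory} (hR : s.ints R 0 = 16 * B)
    (hW : 16 * B + 15 ≤ W) (c : Prop) [Decidable c] (f : Fin 2 → (Fin 2 × Fin 2) × (Fin 2 × Fin 2))
    (g : Fin 2 → Fin 2 × Fin 2) :
    (if c then sum2 fun i => .mul (rd 2 R (cell (f i))) (vc 6 (g i)) else .lit 0 : NExp).eval s =
      (if c then ∑ i, blk (s.nums 2) B (f i).1 (f i).2 * vec (s.nums 6) (g i) else 0) ∧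
    (if c then sum2 fun i => .mul (rd 2 R (cell (f i))) (vc 6 (g i)) else .lit 0 : NExp).fits
      W s := by
  split_ifs
  · refine ⟨?_, fits_sum2 (f := fun i => .mul (rd 2 R (cell (f i))) (vc 6 (g i)))
      fun i => ⟨fits_rd_block hR hW _, fits_vc (by omega) _ _⟩⟩
    rw [eval_sum2]
    refine Finset.sum_congr rfl fun i _ => ?_
    simp only [NExp.eval]
    rw [← eval_rd_block hR, eval_vc]
  · exact ⟨by simp [NExp.eval], trivial⟩

theorem eval_elimExp {W B₀ B₁ B₂ B₃ B₄ : ℕ} {s : Memory} (h0 : s.ints 8 0 = 16 * B₀)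
    (h1 : s.ints 9 0 = 16 * B₁) (h2 : s.ints 10 0 = 16 * B₂) (h3 : s.ints 16 0 = 16 * B₃)
    (h4 : s.ints 17 0 = 16 * B₄) (hW0 : 16 * B₀ + 15 ≤ W)
    (hW1 : 16 * B₁ + 15 ≤ W) (hW2 : 16 * B₂ + 15 ≤ W) (hW3 : 16 * B₃ + 15 ≤ W)
    (hW4 : 16 * B₄ + 15 ≤ W)
    (x : Fin 5 × (Fin 2 × Fin 2) × Fin 2 × Fin 2) (κ : Fin 2 × Fin 2) :
    (elimExp x κ).eval s = elimTensor (blk (s.nums 2) B₀) (blk (s.nums 2) B₁) (blk (s.nums 2) B₂)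
      (blk (s.nums 2) B₃) (blk (s.nums 2) B₄) (vec (s.nums 6)) x κ ∧ (elimExp x κ).fits W s := by
  obtain ⟨k, τ, i, j⟩ := x
  fin_cases k
  · exact ⟨eval_rd_block h0 _ _, fits_rd_block h0 hW0 _⟩
  · exact eval_contraction h1 hW1 (κ.2 = j) (fun i => (τ, (i, κ.1))) fun i' => (i', i)
  · exact eval_contraction h2 hW2 (κ.2 = j) (fun i => (τ, (i, κ.1))) fun i' => (i, i')
  · exact eval_contraction h3 hW3 (κ.1 = j) (fun i => (τ, (i, κ.2))) fun i' => (i', i)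
  · exact eval_contraction h4 hW4 (κ.1 = j) (fun i => (τ, (i, κ.2))) fun i' => (i, i')

/-- The old name of the qubit `p` after `a < b` are removed: the increasing enumeration of the other
qubits. -/
def elimMap (a b p : ℕ) : ℕ := if p < a then p else if p + 1 < b then p + 1 else p + 2

section ElimMap

variable {a b m p q : ℕ}

theorem elimMap_lt (hp : p < m) : elimMap a b p < m + 2 := by
  unfold elimMap
  split_ifs <;> omega

theorem elimMap_ne_left : elimMap a b p ≠ a := by
  unfold elimMap
  split_ifs <;> omega

theorem elimMap_ne_right (hab : a < b) : elimMap a b p ≠ b := by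
  unfold elimMap
  split_ifs <;> omega

theorem elimMap_inj (h : elimMap a b p = elimMap a b q) : p = q := by
  unfold elimMap at h
  split_ifs at h <;> omega

theorem exists_elimMap_eq (hab : a < b) (hb : b < m + 2) (hp : p < m + 2) (hpa : p ≠ a)
    (hpb : p ≠ b) : ∃ r < m, elimMap a b r = p := by
  unfold elimMap
  by_cases h1 : p < a
  · exact ⟨p, by omega, by rw [if_pos h1]⟩
  by_cases h2 : p < b
  · exact ⟨p - 1, by omega, by rw [if_neg (by omega), if_pos (by omega)]; omega⟩
  · exact ⟨p - 2, by omega, by rw [if_neg (by omega), if_neg (by omega)]; omega⟩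

end ElimMap

/-- `R := elimMap a b u`, for `a`, `b` in the registers `3`, `4`. -/
def elimReg (R u : ℕ) : Program :=
  .ite (.lt (reg u) (reg 3)) (setReg R (reg u))
    (.ite (.lt (.add (reg u) (.lit 1)) (reg 4)) (setReg R (.add (reg u) (.lit 1)))
      (setReg R (.add (reg u) (.lit 2))))

theorem does_elimReg {W N R u a b p : ℕ} {s : Memory} (h3 : s.ints 3 0 = a) (h4 : s.ints 4 0 = b)
    (hu : s.ints u 0 = p) (ha : a ≤ W) (hb : b ≤ W) (hp : p + 2 ≤ W) :
    Does W N (elimReg R u) s fun s' => s' = s.setInt R 0 (elimMap a b p) := by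
  have fu : (reg u).fits W s := fits_reg (by omega)
  have fa : ∀ k ≤ 2, (IExp.add (reg u) (.lit k)).fits W s := fun k hk =>
    ⟨fu, by change k ≤ W; omega, by simp only [IExp.eval]; omega⟩
  unfold elimMap
  refine does_ite (Test.lt_fits fu (fits_reg (by omega)) (by simp only [IExp.eval]; omega))
    (fun h => ?_) fun h => ?_ <;> simp only [Test.lt_holds, IExp.eval, hu, h3] at h
  · exact does_setReg fu (by simp only [IExp.eval, hu, if_pos h])
  refine does_ite (Test.lt_fits (fa 1 (by omega)) (fits_reg (by omega))
    (by simp only [IExp.eval]; omega)) (fun h' => ?_) fun h' => ?_ <;>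
    simp only [Test.lt_holds, IExp.eval, hu, h4] at h'
  · exact does_setReg (fa 1 (by omega)) (by simp only [IExp.eval, hu, if_neg h, if_pos h'])
  · exact does_setReg (fa 2 (by omega)) (by simp only [IExp.eval, hu, if_neg h, if_neg h'])

/-- Computes the projector of the pair in the registers `6`, `7` of the reduced instance. -/
def elimBody : Program :=
  .seq (setBase 12 11 6 7) (.seq (elimReg 13 7) (.seq (elimReg 14 6)
    (.seq (setBase 8 0 14 13) (.seq (setBase 9 0 3 14) (.seq (setBase 10 0 4 14)
    (.seq (setBase 16 0 3 13) (.seq (setBase 17 0 4 13)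
    (newBlk 12 ([(0 : Fin 5), 1, 2, 3, 4] ×ˢ (pairs ×ˢ pairs)) elimExp))))))))

/-- Replaces an instance with a pair of rank three, given by the registers `3`, `4`, by the one
without this pair. -/
def elimProg : Program :=
  .seq kerProg (.seq (setReg 11 (.sub (reg 0) (.lit 2)))
    (.seq (forPairs 11 elimBody) (.seq (setReg 0 (reg 11)) (setReg 1 (.lit 3)))))

theorem exists_smul_of_rank_eq_three {P : TwoQubitOp} (hP : P.rank = 3) {φ v : Fin 2 × Fin 2 → ℂ}
    (hφ : φ ≠ 0) (hPφ : P *ᵥ φ = 0) (hv : P *ᵥ v = 0) : ∃ k : ℂ, v = k • φ := by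
  have h1 : Module.finrank ℂ (LinearMap.ker P.mulVecLin) = 1 := by
    have := finrank_ker_add_rank P
    simp only [Fintype.card_prod, Fintype.card_fin] at this
    omega
  obtain ⟨k, hk⟩ := (finrank_eq_one_iff_of_nonzero' (⟨φ, hPφ⟩ : LinearMap.ker P.mulVecLin)
    fun h => hφ (congrArg Subtype.val h)).1 h1 ⟨v, hv⟩
  exact ⟨k, (congrArg Subtype.val hk).symm⟩

theorem does_elimProg {W n : ℕ} {s : Memory} {x : Instance n} {a b : Fin n} (hW : Roomy W n)
    (hn : 4 ≤ n) (h0 : s.ints 0 0 = n) (hf : Full (s.nums 2) x) (hab : a < b)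
    (h3 : s.ints 3 0 = a) (h4 : s.ints 4 0 = b) (hr : (x.proj a b).rank = 3) :
    Does W n elimProg s fun s' => s'.ints 0 0 < n ∧ s'.ints 1 0 = 3 ∧
      ∃ m, m < n ∧ ∃ y : Instance m, Holds s' y ∧ EliminatesTo x y a b := by
  have hWn := hW.le
  obtain ⟨m, rfl⟩ : ∃ m, n = m + 2 := ⟨n - 2, by omega⟩
  have ha := a.isLt
  have hb := b.isLt
  have hab' : (a : ℕ) < b := hab
  rw [← x.cons_of_lt hab] at hr
  refine (does_kerProg hW h0 hf hab h3 h4 (by omega)).seq ?_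
  rintro s1 ⟨i1, n1, hφ, hφab⟩
  refine (does_setReg (e := .sub (reg 0) (.lit 2)) (Q := fun s' => s' = s1.setInt 11 0 m)
    ⟨fits_reg ?_, ?_⟩ ?_).seq ?_
  · rw [i1]; simp; omega
  · change 2 ≤ W; omega
  · simp [IExp.eval, i1, h0]
  rintro _ rfl
  set φ := vec (s1.nums 6) with hφ'
  let e : Fin m → Fin (m + 2) := fun p => ⟨elimMap a b p, elimMap_lt p.isLt⟩
  have hea : ∀ p, a ≠ e p := fun p h => elimMap_ne_left (congrArg Fin.val h).symm
  have heb : ∀ p, b ≠ e p := fun p h => elimMap_ne_right hab' (congrArg Fin.val h).symm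
  have hinj : Function.Injective e := fun p q h => Fin.ext (elimMap_inj (congrArg Fin.val h))
  let Ker : Fin m → Fin m → TwoQubitOp → Prop := fun p q P => IsStarProjection P ∧ ∀ v,
    P *ᵥ v = 0 ↔ ∀ t, elimTensor (x.cons (e p) (e q)) (x.cons a (e p)) (x.cons b (e p))
      (x.cons a (e q)) (x.cons b (e q)) φ t ⬝ᵥ v = 0
  refine (does_forPairs (W := W) (N := m + 2) (m := m)
    (fun S s' => s'.ints 11 0 = m ∧ s'.ints 0 0 = m + 2 ∧ s'.ints 3 0 = a ∧ s'.ints 4 0 = b ∧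
    s'.nums 2 = s.nums 2 ∧ s'.nums 6 = s1.nums 6 ∧
    ∀ p q : Fin m, p < q → ((p : ℕ), (q : ℕ)) ∈ S → Ker p q (blk (s'.nums 0) (m * p + q)))
    (by omega) (by omega) (fun _ _ h => h.1) (fun _ s' v h => by simpa using h)
    (fun _ s' v h => by simpa using h) ?_
    ⟨s1.setInt_ints_self 11 0 m, by simp [i1, h0], by simp [i1, h3], by simp [i1, h4],
      n1 2 (by simp), rfl, by simp⟩).seq ?_
  · rintro S s2 p q hpq hq - ⟨g11, g0, g3, g4, gn2, gn6, hJ⟩ h6 h7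
    have hp : p < m := hpq.trans hq
    have hbm := hW.block (Nat.le_add_right m 2) hp hq
    set p' : Fin m := ⟨p, hp⟩ with hp'
    set q' : Fin m := ⟨q, hq⟩ with hq'
    have heq : elimMap a b q < m + 2 := elimMap_lt hq
    have hep : elimMap a b p < m + 2 := elimMap_lt hp
    refine (does_setBase hW (Nat.le_add_right m 2) g11 h6 h7 hp hq).seq ?_
    rintro _ rfl
    refine (does_elimReg (a := a) (b := b) (p := q) (by simpa using g3) (by simpa using g4)
      (by simpa using h7) (by omega) (by omega) (by omega)).seq ?_
    rintro _ rfl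
    refine (does_elimReg (a := a) (b := b) (p := p) (by simpa using g3) (by simpa using g4)
      (by simpa using h6) (by omega) (by omega) (by omega)).seq ?_
    rintro _ rfl
    refine (does_setBase hW le_rfl (by simpa using g0) (by simp) (by simp) hep heq).seq ?_
    rintro _ rfl
    refine (does_setBase hW le_rfl (by simpa using g0) (by simpa using g3) (by simp) ha hep).seq ?_
    rintro _ rfl
    refine (does_setBase hW le_rfl (by simpa using g0) (by simpa using g4) (by simp) hb hep).seq ?_
    rintro _ rfl
    refine (does_setBase hW le_rfl (by simpa using g0) (by simpa using g3) (by simp) ha heq).seq ?_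
    rintro _ rfl
    refine (does_setBase hW le_rfl (by simpa using g0) (by simpa using g4) (by simp) hb heq).seq ?_
    rintro _ rfl
    refine (does_newBlk (B := m * p + q) (elimTensor (x.cons (e p') (e q')) (x.cons a (e p'))
      (x.cons b (e p')) (x.cons a (e q')) (x.cons b (e q')) φ) (by simp) hbm ?_).mono ?_
    · rintro s' j1 j2 t - κ
      have := eval_elimExp (W := W) (s := s') (B₀ := (m + 2) * elimMap a b p + elimMap a b q)
        (B₁ := (m + 2) * a + elimMap a b p) (B₂ := (m + 2) * b + elimMap a b p)
        (B₃ := (m + 2) * a + elimMap a b q) (B₄ := (m + 2) * b + elimMap a b q)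
        (by rw [j1]; simp) (by rw [j1]; simp) (by rw [j1]; simp) (by rw [j1]; simp)
        (by rw [j1]; simp) (hW.block le_rfl hep heq) (hW.block le_rfl ha hep)
        (hW.block le_rfl hb hep) (hW.block le_rfl ha heq) (hW.block le_rfl hb heq) t κ
      rw [j2 2 (by simp) (by simp), j2 6 (by simp) (by simp)] at this
      simp only [Memory.setInt_nums, gn2, gn6] at this
      have e0 : blk (s.nums 2) ((m + 2) * elimMap a b p + elimMap a b q) = x.cons (e p') (e q') :=
        hf (e p') (e q') fun h => hpq.ne (congrArg Fin.val (hinj h))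
      have e1 : blk (s.nums 2) ((m + 2) * a + elimMap a b p) = x.cons a (e p') := hf _ (e p') (hea _)
      have e2 : blk (s.nums 2) ((m + 2) * b + elimMap a b p) = x.cons b (e p') := hf _ (e p') (heb _)
      have e3 : blk (s.nums 2) ((m + 2) * a + elimMap a b q) = x.cons a (e q') := hf _ (e q') (hea _)
      have e4 : blk (s.nums 2) ((m + 2) * b + elimMap a b q) = x.cons b (e q') := hf _ (e q') (heb _)
      rwa [e0, e1, e2, e3, e4] at this
    · rintro s' ⟨j1, j2, j3, j4, j5⟩
      refine ⟨⟨?_, ?_, ?_, ?_, ?_, ?_, ?_⟩, ?_, ?_⟩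
      iterate 4 first | (rw [j1]; simp; assumption)
      · rw [j2 2 (by simp) (by simp)]; exact gn2
      · rw [j2 6 (by simp) (by simp)]; exact gn6
      · intro c d hcd hS
        by_cases he : c = p' ∧ d = q'
        · rw [he.1, he.2]
          refine ⟨j3, fun v => (j4 v).trans ⟨fun h t => h t ?_, fun h t _ => h t⟩⟩
          obtain ⟨k, τ, i⟩ := t
          refine List.mem_product.2 ⟨?_, mem_pairs2 _⟩
          fin_cases k <;> simp
        · have hne : m * (c : ℕ) + d ≠ m * p + q := fun h => he <| by
            obtain ⟨e1, e2⟩ := block_index_inj d.isLt hq h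
            exact ⟨Fin.ext e1, Fin.ext e2⟩
          rw [j5 _ hne]
          refine hJ c d hcd (hS.resolve_left fun h => he ?_)
          rw [Prod.mk.injEq] at h
          exact ⟨Fin.ext h.1, Fin.ext h.2⟩
      · rw [j1]; simp; assumption
      · rw [j1]; simp; assumption
  · rintro s2 ⟨g11, g0, -, -, -, -, hJ⟩
    refine (does_setReg (Q := fun s' => s' = s2.setInt 0 0 m) (fits_reg (by omega))
      (by simp [IExp.eval, g11])).seq ?_
    rintro _ rfl
    refine does_setReg (show 3 ≤ W by omega) ⟨by simp, by simp [IExp.eval], m, by omega, ?_⟩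
    have hJ' : ∀ p q : Fin m, p < q → Ker p q (blk (s2.nums 0) (m * p + q)) :=
      fun p q hpq => hJ p q hpq ⟨hpq, q.isLt⟩
    let y : Instance m := ⟨fun p q => blk (s2.nums 0) (m * p + q), fun p q hpq => (hJ' p q hpq).1⟩
    refine ⟨y, holds_of_blk (by simp) fun p q _ => rfl, ?_⟩
    have key : ∀ p q : Fin m, p < q → ∀ v, y.cons p q *ᵥ v = 0 ↔ _ := fun p q hpq v =>
      (by rw [y.cons_of_lt hpq]; exact (hJ' p q hpq).2 v : y.cons p q *ᵥ v = 0 ↔ _).trans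
        (elimTensor_dotProduct_eq_zero_iff _ _ _ _ _ _ _)
    refine Instance.eliminatesTo_of (e := e) hab (fun p => ?_) hφ hφab
      (fun v hv => exists_smul_of_rank_eq_three hr hφ hφab hv) hinj ?_ ?_
    · have : Nontrivial (Fin m) := Fin.nontrivial_iff_two_le.2 (by omega)
      obtain ⟨q, hq⟩ := exists_ne p
      exact ⟨q, hq.symm⟩
    · ext g
      simp only [Set.mem_range, Set.mem_compl_iff, Set.mem_insert_iff, Set.mem_singleton_iff,
        not_or]
      constructor
      · rintro ⟨p, rfl⟩
        exact ⟨(hea p).symm, (heb p).symm⟩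
      · rintro ⟨hg, hg'⟩
        obtain ⟨r, hr, hrg⟩ := exists_elimMap_eq hab' hb g.isLt (fun h => hg (Fin.ext h))
          fun h => hg' (Fin.ext h)
        exact ⟨⟨r, hr⟩, Fin.ext hrg⟩
    · intro p q hpq v
      rcases lt_or_gt_of_ne hpq with hl | hl
      · exact key p q hl v
      · rw [y.cons_swap hpq.symm, x.cons_swap fun h => hpq (hinj h).symm,
          submatrix_swap_mulVec_eq_zero_iff, submatrix_swap_mulVec_eq_zero_iff]
        exact (key q p hl _).trans (and_congr_right fun _ => and_comm)

/-! ### A round -/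

theorem EliminatesTo.satisfiable_iff {n m : ℕ} {x : Instance n} {y : Instance m} {a b : Fin n}
    (h : EliminatesTo x y a b) : x.Satisfiable ↔ y.Satisfiable := by
  obtain ⟨φ, e, -, -, -, -, h⟩ := h
  exact Instance.satisfiable_congr h

theorem MergesTo.satisfiable_iff {n m : ℕ} {x : Instance n} {y : Instance m} {a b : Fin n}
    (h : MergesTo x y a b) : x.Satisfiable ↔ y.Satisfiable := by
  obtain ⟨V, c, e, -, -, -, -, -, h⟩ := h
  exact Instance.satisfiable_congr h

theorem Instance.not_satisfiable_of_rank_eq_four {n : ℕ} {x : Instance n} {a b : Fin n}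
    (hab : a < b)
    (hr : (x.proj a b).rank = 4) : ¬ x.Satisfiable := by
  rintro ⟨Ψ, hΨ⟩
  obtain ⟨h0, h⟩ := x.isSA_iff.1 hΨ
  refine h0 (funext fun σ => ?_)
  by_contra hσ
  have hv : slice Ψ a b σ ≠ 0 := fun h => hσ (by rw [← slice_apply_self Ψ a b σ, h]; rfl)
  have := exists_mulVec_eq_zero_iff_rank_lt.1 ⟨_, hv, h a b hab.ne σ⟩
  rw [x.cons_of_lt hab, hr] at this
  simp at this

/-- The round. A pair of rank two or more is looked for; if there is none, the instance is closed
under the rule, which may produce one. Such a pair is merged, eliminated, or rules out satisfying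
assignments; without one, the closed instance has a product solution. -/
def roundProg : Program :=
  .seq loadFull (.seq scan (.seq (.ite (.le (reg 2) (.lit 0)) closeProg .skip)
    (.ite (.le (reg 2) (.lit 0)) (.seq productProg (setReg 1 (.lit 2)))
      (.ite (.le (reg 2) (.lit 2)) mergeProg
        (.ite (.le (reg 2) (.lit 3)) (.ite (.le (reg 0) (.lit 3)) mergeProg elimProg)
          (setReg 1 (.lit 1)))))))

theorem does_roundProg {W n : ℕ} {x : Instance n} {s : Memory} (hW : Roomy W n) (hn : 3 ≤ n)
    (hs : Holds s x) :
    Does W n roundProg s fun s' => RoundOutput x s' ∧ s'.ints 0 0 ≤ n := by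
  have hWn := hW.le
  refine (does_loadFull hW hs).seq ?_
  rintro s1 ⟨h0, hf⟩
  refine (does_scan hW h0 hf).seq ?_
  rintro s2 ⟨h0, hn2, hfound⟩
  rw [← hn2] at hf
  have h4 : ∀ z : Instance n, Found s2.ints z → s2.ints 2 0 ≤ 4 := by
    rintro z ⟨a, b, -, -, -, hr, -⟩
    rw [hr]
    simpa using rank_le_card_width (z.proj a b)
  have hle : ∀ {s : Memory} {k : ℕ}, s.ints 2 0 ≤ 4 → k ≤ 4 →
      (Test.le (reg 2) (.lit k)).fits W s := fun h hk =>
    ⟨fits_reg (h.trans (by omega)), hk.trans (by omega)⟩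
  have h24 : s2.ints 2 0 ≤ 4 := hfound.elim (fun h => by omega) (h4 x)
  refine Does.seq (Q := fun s' => s'.ints 0 0 = n ∧ s'.ints 2 0 ≤ 4 ∧ ∃ z : Instance n,
    (∀ Ψ, x.IsSA Ψ ↔ z.IsSA Ψ) ∧ Full (s'.nums 2) z ∧
    (s'.ints 2 0 = 0 ∧ z.Homogeneous ∧ z.ClosedBelow n ∨ Found s'.ints z ∧
      (z = x ∨ s'.ints 2 0 = 2 ∧ x.Homogeneous ∧ Relation.ReflTransGen RuleStep x z))) ?_ ?_
  · refine does_ite (hle h24 (by omega)) (fun h => ?_) fun h => ?_ <;>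
      simp only [Test.holds, IExp.eval, Nat.le_zero] at h
    · have hx : x.Homogeneous := by
        rcases hfound with h' | ⟨a, b, -, -, -, h', h''⟩
        · exact h'.2
        · omega
      refine (does_closeProg hW hx h0 h hf).mono ?_
      rintro s3 ⟨g0, z, hxz, hz, h3⟩
      refine ⟨g0, by omega, z, isSA_iff_of_reflTransGen hxz, hz, h3.imp_right fun h3 => ?_⟩
      exact ⟨h3.2, .inr ⟨h3.1, hx, hxz⟩⟩
    · exact does_skip ⟨h0, h24, x, fun _ => Iff.rfl, hf,
        .inr ⟨hfound.resolve_left fun h' => h h'.1, .inl rfl⟩⟩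
  rintro s3 ⟨h0, h24, z, hxz, hfz, hz⟩
  have hsat : x.Satisfiable ↔ z.Satisfiable := exists_congr hxz
  refine does_ite (hle h24 (by omega)) (fun h => ?_) fun h => ?_ <;>
    simp only [Test.holds, IExp.eval, Nat.le_zero] at h
  · have hz' : z.Homogeneous ∧ z.ClosedBelow n := by
      rcases hz with h' | ⟨⟨a, b, -, -, -, h', h''⟩, -⟩
      · exact h'.2
      · omega
    refine (does_productProg hW hz'.1 hz'.2 h0 hfz).seq ?_
    rintro s4 ⟨g0, g⟩
    refine does_setReg (show 2 ≤ W by omega) ⟨.product (by simp [Memory.status, IExp.eval]) ?_, ?_⟩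
    · rw [Memory.setInt_vectors]
      exact (hxz _).2 g
    · simp [g0]
  obtain ⟨⟨a, b, hab, h3, h4, hr, hr2⟩, hzx⟩ := hz.resolve_left fun h' => h h'.1
  have hmerge : (z.proj a b).rank < 4 → ((z.proj a b).rank = 2 ∨ n = 3 ∧ (z.proj a b).rank = 3) →
      Does W n mergeProg s3 fun s' => RoundOutput x s' ∧ s'.ints 0 0 ≤ n := by
    intro hr4 hr'
    refine (does_mergeProg hW hn h0 hfz hab h3 h4 hr2 hr4).mono ?_
    rintro s4 ⟨g0, g1, m, hm, y, hy, hzy⟩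
    refine ⟨.reduced g1 m y hm hy (hsat.trans hzy.satisfiable_iff) ?_, g0.le⟩
    rcases hzx with rfl | ⟨h2, hx, hxz⟩
    · exact .merge a b hab hr' hzy
    -- after the closure the recorded rank is two
    · exact .close z hx hxz a b hab (hr.symm.trans h2) hzy
  refine does_ite (hle h24 (by omega)) (fun h2 => ?_) fun h2 => ?_ <;>
    simp only [Test.holds, IExp.eval] at h2
  · exact hmerge (by omega) (.inl (by omega))
  have hzx : z = x := hzx.resolve_right fun h => by omega
  subst hzx
  refine does_ite (hle h24 (by omega)) (fun hr3 => ?_) fun hr3 => ?_ <;>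
    simp only [Test.holds, IExp.eval] at hr3
  · have hr3 : (z.proj a b).rank = 3 := by omega
    refine does_ite ⟨fits_reg (by omega), show 3 ≤ W by omega⟩ (fun h => ?_) fun h => ?_ <;>
      simp only [Test.holds, IExp.eval, h0] at h
    · exact hmerge (by omega) (.inr ⟨by omega, hr3⟩)
    · refine (does_elimProg hW (by omega) h0 hfz hab h3 h4 hr3).mono ?_
      rintro s4 ⟨g0, g1, m, hm, y, hy, hzy⟩
      exact ⟨.reduced g1 m y hm hy hzy.satisfiable_iff (.eliminate a b hab hr3 hzy), g0.le⟩
  · exact does_setReg (show 1 ≤ W by omega) ⟨.unsat (by simp [Memory.status, IExp.eval])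
      (Instance.not_satisfiable_of_rank_eq_four hab (by omega)), by simp [h0]⟩

section Depth

variable {α κ : Type} (D R : ℕ)

theorem depth_foldr_seq (L : List α) (f : α → Program) (hf : ∀ x, (f x).depth = 0) :
    (L.foldr (fun x p => Program.seq (f x) p) Program.skip).depth = 0 := by
  induction L with
  | nil => rfl
  | cons x L ih => simp only [List.foldr_cons, Program.depth, hf, ih, max_self]

theorem depth_fill (L : List α) (idx : α → IExp) (e : α → NExp) : (fill D L idx e).depth = 0 :=
  depth_foldr_seq L (fun o => .setNum D (idx o) (e o)) fun _ => rfl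

theorem depth_addTensorProg (w : Fin 2 × Fin 2 → NExp) : (addTensorProg D R w).depth = 0 := by
  simp [addTensorProg, setBlk, Program.depth, depth_fill]

theorem depth_addAll (L : List α) (w : α → Fin 2 × Fin 2 → NExp) : (addAll D R L w).depth = 0 :=
  depth_foldr_seq L (fun x => addTensorProg D R (w x)) fun _ => depth_addTensorProg D R _

theorem depth_pick (K : List κ) (idx : κ → IExp) (L : List α) (f : α → κ → NExp) :
    (pick D K idx L f).depth = 0 :=
  depth_foldr_seq L (fun x => .ite (zeroTest K (f x)) .skip (fill D K idx (f x))) fun _ => by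
    simp [Program.depth, depth_fill]

end Depth

/-- The closure under the rule is the only part with three nested loops. -/
theorem depth_roundProg : roundProg.depth = 3 := by
  simp [roundProg, loadFull, scan, closeProg, closeBody, productProg, mergeProg, mergeBody, elimProg,
    elimBody, forPairs, forLoop, setBlk, newBlk, pickRow, pickKer, kerProg, orthProg, embedProg, mark,
    setBase, setDouble, mapReg, elimReg, Program.depth, depth_fill, depth_addTensorProg, depth_addAll,
    depth_pick]

/-! ### At most two qubits -/

theorem Instance.satisfiable_of_le_one {n : ℕ} (hn : n ≤ 1) (x : Instance n) : x.Satisfiable :=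
  ⟨fun _ => 1, fun h => one_ne_zero (congrFun h fun _ => 0), fun a b hab => by
    have : (a : ℕ) < b := hab
    omega⟩

theorem Instance.satisfiable_iff_rank_ne_four (x : Instance 2) :
    x.Satisfiable ↔ (x.proj 0 1).rank ≠ 4 := by
  have h01 : (0 : Fin 2) < 1 := by decide
  refine ⟨fun h hr => x.not_satisfiable_of_rank_eq_four h01 hr h, fun h => ?_⟩
  have h4 : (x.proj 0 1).rank ≤ 4 := by simpa using rank_le_card_width (x.proj 0 1)
  obtain ⟨v, hv, hPv⟩ := (exists_mulVec_eq_zero_iff_rank_lt (P := x.proj 0 1)).2 (by simp; omega)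
  refine ⟨fun σ => v (σ 0, σ 1), fun h => hv (funext fun τ => ?_), fun a b hab => ?_⟩
  · exact congrFun h ![τ.1, τ.2]
  · obtain ⟨rfl, rfl⟩ : a = 0 ∧ b = 1 := by omega
    refine (applyPair_eq_zero_iff _ hab.ne _).2 fun σ => ?_
    have : slice (fun σ : Fin 2 → Fin 2 => v (σ 0, σ 1)) 0 1 σ = v := by
      funext τ
      simp [slice]
    rw [this, hPv]

/-- On two qubits, the instance is satisfiable unless the trace of its projector is four. -/
def baseProg : Program :=
  .ite (.and (.le (.lit 2) (reg 0))
    (.eq (sum4 fun τ => .get 0 (.lit (16 + cell (τ, τ)))) (.lit 4)))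
    (setReg 1 (.lit 1)) (setReg 1 (.lit 2))

/-- The verdict in the status register is right. -/
def Decided {n : ℕ} (x : Instance n) (s : Memory) : Prop :=
  s.status = 1 ∧ ¬ x.Satisfiable ∨ s.status = 2 ∧ x.Satisfiable

theorem decided_congr {n m : ℕ} {x : Instance n} {y : Instance m} {s : Memory}
    (h : x.Satisfiable ↔ y.Satisfiable) : Decided x s ↔ Decided y s := by
  unfold Decided
  rw [h]

theorem does_baseProg {W N n : ℕ} {x : Instance n} {s : Memory} (hW : 40 ≤ W) (hn : n ≤ 2)
    (hs : Holds s x) : Does W N baseProg s (Decided x) := by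
  have h0 := hs.1
  have hfit : ∀ τ, (NExp.get 0 (.lit (16 + cell (τ, τ)))).fits W s := fun τ => by
    have := cell_lt (τ, τ)
    change 16 + cell (τ, τ) ≤ W
    omega
  have htest : 2 ≤ n → ((sum4 fun τ => .get 0 (.lit (16 + cell (τ, τ)))).eval s = 4 ↔
      ¬ x.Satisfiable) := by
    intro h2
    obtain rfl : n = 2 := by omega
    have h01 : (0 : Fin 2) < 1 := by decide
    have hb : blk (s.nums 0) 1 = x.proj 0 1 := hs.blk_eq h01
    have htr : (sum4 fun τ => .get 0 (.lit (16 + cell (τ, τ)))).eval s =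
        ((x.proj 0 1).rank : ℂ) := by
      rw [rank_eq_trace (x.isProj _ _ h01), ← hb, eval_sum4]
      rfl
    rw [htr, x.satisfiable_iff_rank_ne_four, not_not]
    exact_mod_cast Iff.rfl
  refine does_ite ⟨⟨show 2 ≤ W by omega, fits_reg (by omega)⟩, fits_sum4 hfit, trivial⟩
    (fun h => ?_) fun h => ?_ <;> simp only [Test.holds, IExp.eval, NExp.eval, h0] at h
  · exact does_setReg (show 1 ≤ W by omega) (.inl ⟨by simp [Memory.status, IExp.eval],
      (htest h.1).1 (by simpa using h.2)⟩)
  · refine does_setReg (show 2 ≤ W by omega) (.inr ⟨by simp [Memory.status, IExp.eval], ?_⟩)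
    by_cases h2 : 2 ≤ n
    · by_contra hx
      exact h ⟨h2, by simpa using (htest h2).2 hx⟩
    · exact x.satisfiable_of_le_one (by omega)

/-! ### The iteration -/

/-- The guard of the main loop. -/
def roundTest : Test := .and statusIsThree (.le (.lit 3) (.get 0 (.lit 0)))

theorem statusIsThree_holds (s : Memory) : statusIsThree.holds s ↔ s.status = 3 := by
  simp only [statusIsThree, Test.holds, IExp.eval, Memory.status]
  omega

theorem statusIsThree_fits {W : ℕ} {s : Memory} (hW : 3 ≤ W) (hs : s.status ≤ W) :
    statusIsThree.fits W s :=
  ⟨⟨hW, Nat.zero_le _, hs⟩, ⟨Nat.zero_le _, hs⟩, hW⟩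

/-- The main loop stops with the right verdict, or on an equivalent instance with at most two
qubits. -/
def Settled {n : ℕ} (x : Instance n) (s : Memory) : Prop :=
  Decided x s ∨
    s.status = 3 ∧ ∃ m ≤ 2, ∃ y : Instance m, Holds s y ∧ (x.Satisfiable ↔ y.Satisfiable)

theorem RoundOutput.status_le {n : ℕ} {x : Instance n} {s : Memory} (h : RoundOutput x s) :
    s.status ≤ 3 := by
  cases h <;> omega

theorem exists_runs_loop {W N T n : ℕ} (hW : Roomy W N) (hT : ∀ m ≤ N, roundProg.bound m ≤ T)
    (hn : n ≤ N) {x : Instance n} {s : Memory} (hs : Holds s x) (h3 : s.status = 3) :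
    ∃ t s', Runs W (.loop roundTest roundProg) s t s' ∧
      t ≤ n * (roundTest.cost + T) + roundTest.cost ∧ Settled x s' := by
  have hWN := hW.le
  have hfits : ∀ s : Memory, s.status ≤ 3 → s.ints 0 0 ≤ N → roundTest.fits W s := fun s h h' =>
    ⟨statusIsThree_fits (by omega) (by omega), show 3 ≤ W by omega, fits_reg (by omega)⟩
  induction n using Nat.strong_induction_on generalizing s with
  | _ n ih =>
    have h0 := hs.1
    have hfit := hfits s h3.le (by omega)
    have hholds : roundTest.holds s ↔ 3 ≤ n := by
      change statusIsThree.holds s ∧ 3 ≤ s.ints 0 0 ↔ 3 ≤ n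
      rw [statusIsThree_holds, h0]
      exact and_iff_right h3
    by_cases h : 3 ≤ n
    · have hWn : Roomy W n := by
        have := Nat.mul_le_mul hn hn
        unfold Roomy at hW ⊢
        omega
      obtain ⟨t, s', hrun, ht, hout, hsize⟩ := does_roundProg hWn h hs
      have ht' := ht.trans (hT n hn)
      -- a round with a verdict is the last one
      have hlast : s'.status ≠ 3 → Decided x s' → ∃ t s'',
          Runs W (.loop roundTest roundProg) s t s'' ∧
          t ≤ n * (roundTest.cost + T) + roundTest.cost ∧ Settled x s'' := by
        intro hne hdec
        refine ⟨_, s', .loopTrue hfit (hholds.2 h) hrun (.loopFalse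
          (hfits s' hout.status_le (by omega)) fun hc => hne ((statusIsThree_holds s').1 hc.1)), ?_,
          .inl hdec⟩
        have := Nat.mul_le_mul_right (roundTest.cost + T) (show 1 ≤ n by omega)
        omega
      cases hout with
      | unsat h1 h2 => exact hlast (by omega) (.inl ⟨h1, h2⟩)
      | product h1 h2 => exact hlast (by omega) (.inr ⟨h1, _, h2⟩)
      | reduced h1 m y hm hy hequiv _ =>
        obtain ⟨t', s'', hrun', ht'', hset⟩ := ih m hm (by omega) hy h1
        refine ⟨_, s'', .loopTrue hfit (hholds.2 h) hrun hrun', ?_, ?_⟩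
        · have := Nat.mul_le_mul_right (roundTest.cost + T) (show m + 1 ≤ n by omega)
          rw [add_mul, one_mul] at this
          omega
        · exact hset.imp (decided_congr hequiv).2 fun h => by simpa only [hequiv] using h
    · exact ⟨_, s, .loopFalse hfit fun hc => h (hholds.1 hc), by omega,
        .inr ⟨h3, n, by omega, x, hs, Iff.rfl⟩⟩

theorem exists_runs_iterated {W N T n : ℕ} (hW : Roomy W N) (hT : ∀ m ≤ N, roundProg.bound m ≤ T)
    (hn : n ≤ N) {x : Instance n} {s : Memory} (hs : Holds s x) :
    ∃ t s', Runs W (iterated roundProg baseProg) s t s' ∧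
      t ≤ 3 + (n * (roundTest.cost + T) + roundTest.cost +
        (statusIsThree.cost + (baseProg.bound 0 + 1))) ∧ Decided x s' := by
  have hWN := hW.le
  obtain ⟨t, s1, hrun, ht, hset⟩ := exists_runs_loop (s := s.setInt 1 0 3) hW hT hn
    ⟨by simpa using hs.1, hs.2⟩ (by simp [Memory.status])
  have h1 : s1.status ≤ 3 := by
    rcases hset with (h | h) | h <;> omega
  obtain ⟨t', s2, hrun', ht', hdec⟩ :
      Does W 0 (.ite statusIsThree baseProg .skip) s1 (Decided x) := by
    refine does_ite (statusIsThree_fits (by omega) (by omega)) (fun h => ?_) fun h => ?_ <;>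
      rw [statusIsThree_holds] at h
    · rcases hset with hset | ⟨-, m, hm, y, hy, hequiv⟩
      · rcases hset with h' | h' <;> omega
      · exact (does_baseProg (by omega) hm hy).mono fun _ => (decided_congr hequiv).2
    · exact does_skip (hset.resolve_right fun h' => h h'.1)
  exact ⟨_, s2, .seq (.setInt s 1 (.lit 0) (.lit 3) (Nat.zero_le _) (show 3 ≤ W by omega))
    (.seq hrun hrun'), Nat.add_le_add_left (add_le_add ht ht') 3, hdec⟩

end Q2SAT

theorem mainTheorem1 :
    ∃ (round base : Q2SAT.Program) (C d : ℕ),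
      (∀ (n : ℕ), 3 ≤ n → ∀ (x : Q2SAT.Instance n) (s : Q2SAT.Memory), Q2SAT.Holds s x →
        ∃ (t : ℕ) (s' : Q2SAT.Memory),
          Q2SAT.Runs (C * (n + 1) ^ d) round s t s' ∧ t ≤ C * n ^ 3 ∧
          Q2SAT.RoundOutput x s') ∧
      (∀ (n : ℕ) (x : Q2SAT.Instance n) (s : Q2SAT.Memory), Q2SAT.Holds s x →
        ∃ (t : ℕ) (s' : Q2SAT.Memory),
          Q2SAT.Runs (C * (n + 1) ^ d) (Q2SAT.iterated round base) s t s' ∧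
          t ≤ C * (n + 1) ^ 4 ∧
          (s'.status = 1 ∧ ¬ x.Satisfiable ∨ s'.status = 2 ∧ x.Satisfiable)) := by
  obtain ⟨K, hK⟩ := Q2SAT.roundProg.exists_bound_le
  rw [Q2SAT.depth_roundProg] at hK
  set c := Q2SAT.roundTest.cost
  set L := 3 + (c + (Q2SAT.statusIsThree.cost + (Q2SAT.baseProg.bound 0 + 1))) with hL
  have hW : ∀ n, Q2SAT.Roomy ((8 * K + c + L + 60) * (n + 1) ^ 2) n := by
    intro n
    unfold Q2SAT.Roomy
    nlinarith [Nat.zero_le ((8 * K + c + L) * (n + 1) ^ 2)]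
  refine ⟨Q2SAT.roundProg, Q2SAT.baseProg, 8 * K + c + L + 60, 2, fun n hn x s hs => ?_,
    fun n x s hs => ?_⟩
  · obtain ⟨t, s', hrun, ht, hout, -⟩ := Q2SAT.does_roundProg (hW n) hn hs
    refine ⟨t, s', hrun, ?_, hout⟩
    calc t ≤ K * (n + 1) ^ 3 := ht.trans (hK n)
      _ ≤ K * (2 * n) ^ 3 := by gcongr; omega
      _ = 8 * K * n ^ 3 := by ring
      _ ≤ _ := by gcongr; omega
  · obtain ⟨t, s', hrun, ht, hdec⟩ := Q2SAT.exists_runs_iterated (T := K * (n + 1) ^ 3) (hW n)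
      (fun m hm => (hK m).trans (by gcongr)) le_rfl hs
    refine ⟨t, s', hrun, ?_, hdec⟩
    have h4 : 1 ≤ (n + 1) ^ 4 := Nat.one_le_pow _ _ n.succ_pos
    have h1 : n ≤ (n + 1) ^ 4 := n.le_succ.trans (Nat.le_self_pow (by norm_num) _)
    have h3 : n * (n + 1) ^ 3 ≤ (n + 1) ^ 4 := by
      rw [pow_succ _ 3, mul_comm]
      gcongr
      omega
    calc t ≤ n * c + K * (n * (n + 1) ^ 3) + L * 1 := by
          refine ht.trans (le_of_eq ?_)
          rw [hL]
          ring
      _ ≤ (n + 1) ^ 4 * c + K * (n + 1) ^ 4 + L * (n + 1) ^ 4 := by gcongr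
      _ = (K + c + L) * (n + 1) ^ 4 := by ring
      _ ≤ _ := Nat.mul_le_mul_right _ (by omega)
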